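/- Let $\mathfrak g$ be a finite-dimensional nilpotent real Lie algebra with an integrable complex structure, that is, a complex Lie subalgebra $\mathfrak g^{1,0}\subset\mathfrak g_{\mathbb C}:=\mathfrak g\otimes_{\mathbb R}\mathbb C$ with $\mathfrak g_{\mathbb C}=\mathfrak g^{1,0}\oplus\mathfrak g^{0,1}$, where $\mathfrak g^{0,1}:=\overline{\mathfrak g^{1,0}}$. Let $\Lambda^{*,*}\mathfrak g^*=\bigoplus_{p,q}\Lambda^{p,q}\mathfrak g^*$ be the exterior algebra of the complex dual space $(\mathfrak g_{\mathbb C})^*$ with its Hodge bigrading, in which covectors vanishing on $\mathfrak g^{0,1}$ have type $(1,0)$ and covectors vanishing on $\mathfrak g^{1,0}$ have type $(0,1)$. Let $d_w$ be the Chevalley–Eilenberg differential on it: the map $(\mathfrak g_{\mathbb C})^*\to\Lambda^2(\mathfrak g_{\mathbb C})^*$ dual to the Lie bracket, extended by the graded Leibniz rule. Write $d_w=\partial_w+\bar\partial_w$, where $\partial_w$ has Hodge type $(1,0)$ and $\bar\partial_w$ has Hodge type $(0,1)$. Put $\Lambda^{0,*}\mathfrak g^*=\bigoplus_q\Lambda^{0,q}\mathfrak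 g^*$. A DGA here is a unital graded-commutative $\mathbb C$-algebra $A=\bigoplus_{i\ge 0}A^i$ with a differential of degree $1$ satisfying the graded Leibniz rule. A quasi-isomorphism is a homomorphism of DGAs inducing an isomorphism on cohomology. A DGA is formal if it is connected by a finite chain of quasi-isomorphisms (pointing in either direction, through arbitrary DGAs) to its cohomology algebra with zero differential. Then: 1. the DGA $(\Lambda^{*,*}\mathfrak g^*,\bar\partial_w)$, graded by total degree, is formal if and only if $\mathfrak g$ is abelian; 2. the DGA $(\Lambda^{0,*}\mathfrak g^*,\bar\partial_w)$ is formal if and only if the complex Lie algebra $\mathfrak g^{0,1}$ is abelian. -/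

import Mathlib

noncomputable section

open scoped TensorProduct DirectSum

universe u v

section DGA

/-- A differential graded algebra over a field `K`: a unital, associative, `ℕ`-graded `K`-algebra
which is graded commutative, with a differential of degree one that satisfies the
graded Leibniz rule. -/
structure DGAlgebra (K : Type v) [Field K] : Type (max v (u + 1)) where
  carrier : Type u
  [ring : Ring carrier]
  [algebra : Algebra K carrier]
  /-- the homogeneous components -/
  gr : ℕ → Submodule K carrier
  [graded : GradedAlgebra gr]
  graded_comm : ∀ {i j : ℕ} {x y : carrier}, x ∈ gr i → y ∈ gr j →
    x * y = (-1 : carrier) ^ (i * j) * (y * x)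
  /-- the differential -/
  d : carrier →ₗ[K] carrier
  d_mem : ∀ {i : ℕ} {x : carrier}, x ∈ gr i → d x ∈ gr (i + 1)
  d_d : ∀ x : carrier, d (d x) = 0
  leibniz : ∀ {i : ℕ} {x : carrier}, x ∈ gr i → ∀ y : carrier,
    d (x * y) = d x * y + (-1 : carrier) ^ i * (x * d y)

namespace DGAlgebra

variable {K : Type v} [Field K]

instance instRingCarrier (A : DGAlgebra.{u} K) : Ring A.carrier := A.ring
instance instAlgebraCarrier (A : DGAlgebra.{u} K) : Algebra K A.carrier := A.algebra
instance instGradedCarrier (A : DGAlgebra.{u} K) : GradedAlgebra A.gr := A.graded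

/-- The projection of a graded algebra to its component of degree `i`, as a linear map. -/
def proj (A : DGAlgebra.{u} K) (i : ℕ) : A.carrier →ₗ[K] A.carrier :=
  GradedAlgebra.proj A.gr i

theorem proj_mem (A : DGAlgebra.{u} K) (i : ℕ) (x : A.carrier) : A.proj i x ∈ A.gr i := by
  simp [proj, GradedAlgebra.proj_apply]

theorem proj_same (A : DGAlgebra.{u} K) {i : ℕ} {x : A.carrier} (h : x ∈ A.gr i) :
    A.proj i x = x := by
  simp [proj, GradedAlgebra.proj_apply, DirectSum.decompose_of_mem_same A.gr h]

theorem proj_ne (A : DGAlgebra.{u} K) {i j : ℕ} {x : A.carrier} (h : x ∈ A.gr i) (hij : i ≠ j) :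
    A.proj j x = 0 := by
  simp [proj, GradedAlgebra.proj_apply, DirectSum.decompose_of_mem_ne A.gr h hij]

theorem mem_iSup (A : DGAlgebra.{u} K) (x : A.carrier) :
    ∃ s : Finset ℕ, x = ∑ i ∈ s, A.proj i x := by
  classical
  exact ⟨_, (DirectSum.sum_support_decompose A.gr x).symm⟩

theorem proj_d (A : DGAlgebra.{u} K) (i : ℕ) (x : A.carrier) :
    A.proj (i + 1) (A.d x) = A.d (A.proj i x) := by
  obtain ⟨s, hs⟩ := A.mem_iSup x
  have key : ∀ j, A.proj (i + 1) (A.d (A.proj j x)) = A.d (A.proj i (A.proj j x)) := by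
    intro j
    rcases eq_or_ne j i with rfl | h
    · rw [A.proj_same (A.d_mem (A.proj_mem _ _)), A.proj_same (A.proj_mem _ _)]
    · rw [A.proj_ne (A.d_mem (A.proj_mem _ _)) (by omega), A.proj_ne (A.proj_mem _ _) h, map_zero]
  rw [hs]
  simp only [map_sum, key]

/-- A criterion for a family of submodules to be an algebra grading. -/
@[reducible]
def gradedAlgebraOfProj {R : Type u} [Ring R] [Algebra K R] (𝒜 : ℕ → Submodule K R)
    [SetLike.GradedMonoid 𝒜] (π : ℕ → R →ₗ[K] R)
    (same : ∀ i x, x ∈ 𝒜 i → π i x = x) (ne : ∀ i j x, x ∈ 𝒜 i → i ≠ j → π j x = 0)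
    (top : ∀ x, x ∈ ⨆ i, 𝒜 i) : GradedAlgebra 𝒜 :=
  letI : DirectSum.Decomposition 𝒜 := DirectSum.IsInternal.chooseDecomposition 𝒜 (by
    rw [DirectSum.isInternal_submodule_iff_iSupIndep_and_iSup_eq_top]
    refine ⟨?_, eq_top_iff.2 fun x _ => top x⟩
    intro i
    rw [Submodule.disjoint_def]
    intro x hx hx'
    rw [← same i x hx]
    have : (⨆ j, ⨆ (_ : j ≠ i), 𝒜 j) ≤ LinearMap.ker (π i) :=
      iSup_le fun j => iSup_le fun hj => fun y hy => ne j i y hy hj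
    exact this hx')
  { (inferInstance : SetLike.GradedMonoid 𝒜), this with }

/-- A differential graded subalgebra: a subalgebra which is spanned by its homogeneous elements and
closed under the differential, with the induced structure. -/
def sub (A : DGAlgebra.{u} K) (S : Subalgebra K A.carrier)
    (hS : ∀ i, ∀ x ∈ S, A.proj i x ∈ S) (hd : ∀ x ∈ S, A.d x ∈ S) : DGAlgebra.{u} K where
  carrier := S
  gr i := (A.gr i).comap S.val.toLinearMap
  graded :=
    haveI : SetLike.GradedMonoid fun i => (A.gr i).comap S.val.toLinearMap :=
      { one_mem := SetLike.GradedOne.one_mem (A := A.gr)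
        mul_mem := fun _ _ _ _ hx hy => SetLike.GradedMul.mul_mem (A := A.gr) hx hy }
    gradedAlgebraOfProj _
      (fun i => ((A.proj i).comp S.val.toLinearMap).codRestrict (Subalgebra.toSubmodule S)
        (fun x => hS i x x.2))
      (fun i x hx => Subtype.ext (A.proj_same hx))
      (fun i j x hx hij => Subtype.ext (A.proj_ne hx hij))
      (fun x => by
        obtain ⟨s, hs⟩ := A.mem_iSup x
        have : x = ∑ i ∈ s, (⟨A.proj i x, hS i x x.2⟩ : S) := by
          apply Subtype.ext
          rw [AddSubmonoidClass.coe_finsetSum]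
          exact hs
        rw [this]
        refine Submodule.sum_mem _ fun i _ => Submodule.mem_iSup_of_mem i ?_
        exact A.proj_mem i x)
  graded_comm hx hy := Subtype.ext (by simpa using A.graded_comm hx hy)
  d := (A.d.comp S.val.toLinearMap).codRestrict (Subalgebra.toSubmodule S) (fun x => hd x x.2)
  d_mem hx := A.d_mem hx
  d_d x := Subtype.ext (A.d_d x)
  leibniz {i x} hx y := Subtype.ext (by
    have h := A.leibniz (x := (x : A.carrier)) hx (y : A.carrier)
    have e : (((-1 : S) ^ i : S) : A.carrier) = (-1) ^ i := by simp
    change A.d (x * y) = A.d x * y + (((-1 : S) ^ i : S) : A.carrier) * (x * A.d y)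
    rw [e, h])

/-- A homomorphism of differential graded algebras. -/
structure Hom (A B : DGAlgebra.{u} K) where
  toAlgHom : A.carrier →ₐ[K] B.carrier
  map_gr : ∀ {i : ℕ} {x : A.carrier}, x ∈ A.gr i → toAlgHom x ∈ B.gr i
  map_d : ∀ x : A.carrier, toAlgHom (A.d x) = B.d (toAlgHom x)

theorem d_one (A : DGAlgebra.{u} K) : A.d 1 = 0 := by
  have h := A.leibniz (SetLike.GradedOne.one_mem (A := A.gr)) 1
  simpa using h

theorem cocycle_proj (A : DGAlgebra.{u} K) {x : A.carrier} (hx : A.d x = 0) (i : ℕ) :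
    A.d (A.proj i x) = 0 := by
  rw [← A.proj_d, hx, map_zero]

theorem d_mul_of_cocycle (A : DGAlgebra.{u} K) {x y : A.carrier} (hx : A.d x = 0)
    (hy : A.d y = 0) : A.d (x * y) = 0 := by
  obtain ⟨s, hs⟩ := A.mem_iSup x
  rw [hs, Finset.sum_mul, map_sum]
  refine Finset.sum_eq_zero fun i _ => ?_
  rw [A.leibniz (A.proj_mem i x), A.cocycle_proj hx, hy]
  simp

/-- The algebra of cocycles, the kernel of the differential. -/
def cocycles (A : DGAlgebra.{u} K) : Subalgebra K A.carrier where
  carrier := {x | A.d x = 0}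
  mul_mem' hx hy := A.d_mul_of_cocycle hx hy
  add_mem' {x y} hx hy := by
    change A.d (x + y) = 0
    rw [map_add, show A.d x = 0 from hx, show A.d y = 0 from hy, add_zero]
  algebraMap_mem' r := by
    change A.d (algebraMap K A.carrier r) = 0
    rw [Algebra.algebraMap_eq_smul_one, map_smul, A.d_one, smul_zero]

theorem mem_cocycles (A : DGAlgebra.{u} K) {x : A.carrier} : x ∈ A.cocycles ↔ A.d x = 0 := Iff.rfl

theorem exact_mul (A : DGAlgebra.{u} K) {x y : A.carrier} (hx : A.d x = 0)
    (hy : y ∈ LinearMap.range A.d) : x * y ∈ LinearMap.range A.d := by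
  obtain ⟨z, rfl⟩ := hy
  obtain ⟨s, hs⟩ := A.mem_iSup x
  rw [hs, Finset.sum_mul]
  refine Submodule.sum_mem _ fun i _ => ⟨(-1) ^ i * (A.proj i x * z), ?_⟩
  have hneg : ∀ w : A.carrier, A.d ((-1) ^ i * w) = (-1) ^ i * A.d w := by
    intro w
    rcases neg_one_pow_eq_or A.carrier i with h | h <;> simp [h]
  rw [hneg, A.leibniz (A.proj_mem i x), A.cocycle_proj hx, zero_mul, zero_add, ← mul_assoc,
    ← pow_add, Even.neg_one_pow ⟨i, rfl⟩, one_mul]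

theorem mul_exact (A : DGAlgebra.{u} K) {x y : A.carrier} (hx : x ∈ LinearMap.range A.d)
    (hy : A.d y = 0) : x * y ∈ LinearMap.range A.d := by
  obtain ⟨z, rfl⟩ := hx
  obtain ⟨s, hs⟩ := A.mem_iSup z
  rw [hs, map_sum, Finset.sum_mul]
  refine Submodule.sum_mem _ fun i _ => ⟨A.proj i z * y, ?_⟩
  rw [A.leibniz (A.proj_mem i z), hy]
  simp

/-- The ideal of coboundaries in the algebra of cocycles. -/
def coboundaries (A : DGAlgebra.{u} K) : Ideal A.cocycles where
  carrier := {x | (x : A.carrier) ∈ LinearMap.range A.d}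
  add_mem' hx hy := (LinearMap.range A.d).add_mem hx hy
  zero_mem' := (LinearMap.range A.d).zero_mem
  smul_mem' c _ hx := A.exact_mul c.2 hx

theorem mem_coboundaries (A : DGAlgebra.{u} K) {x : A.cocycles} :
    x ∈ A.coboundaries ↔ (x : A.carrier) ∈ LinearMap.range A.d := Iff.rfl

instance coboundaries_isTwoSided (A : DGAlgebra.{u} K) : A.coboundaries.IsTwoSided :=
  ⟨fun b hx => A.mem_coboundaries.2 (A.mul_exact (A.mem_coboundaries.1 hx) b.2)⟩

/-- The cohomology ring `ker d / im d`. -/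
abbrev H (A : DGAlgebra.{u} K) : Type u := A.cocycles ⧸ A.coboundaries

/-- The class of a cocycle. -/
def cls (A : DGAlgebra.{u} K) : A.cocycles →ₐ[K] A.H := Ideal.Quotient.mkₐ K A.coboundaries

theorem cls_surjective (A : DGAlgebra.{u} K) : Function.Surjective A.cls :=
  Ideal.Quotient.mkₐ_surjective K A.coboundaries

theorem cls_eq_zero (A : DGAlgebra.{u} K) {x : A.cocycles} :
    A.cls x = 0 ↔ (x : A.carrier) ∈ LinearMap.range A.d :=
  (Ideal.Quotient.eq_zero_iff_mem (I := A.coboundaries)).trans A.mem_coboundaries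

/-- The classes of the cocycles of degree `i`. -/
def cohomologyGr (A : DGAlgebra.{u} K) (i : ℕ) : Submodule K A.H :=
  ((A.gr i).comap A.cocycles.val.toLinearMap).map A.cls.toLinearMap

theorem mem_cohomologyGr (A : DGAlgebra.{u} K) {i : ℕ} {ξ : A.H} :
    ξ ∈ A.cohomologyGr i ↔ ∃ x : A.cocycles, (x : A.carrier) ∈ A.gr i ∧ A.cls x = ξ := Iff.rfl

instance cohomologyGr_gradedMonoid (A : DGAlgebra.{u} K) :
    SetLike.GradedMonoid A.cohomologyGr where
  one_mem := ⟨1, SetLike.GradedOne.one_mem (A := A.gr), map_one A.cls⟩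
  mul_mem := by
    rintro i j _ _ ⟨x, hx, rfl⟩ ⟨y, hy, rfl⟩
    exact ⟨x * y, SetLike.GradedMul.mul_mem (A := A.gr) hx hy, map_mul A.cls _ _⟩

/-- The projection of the cocycles to their components of degree `i`. -/
def cocyclesProj (A : DGAlgebra.{u} K) (i : ℕ) : A.cocycles →ₗ[K] A.cocycles :=
  ((A.proj i).comp A.cocycles.val.toLinearMap).codRestrict (Subalgebra.toSubmodule A.cocycles)
    (fun x => A.cocycle_proj x.2 i)

theorem proj_exact (A : DGAlgebra.{u} K) (i : ℕ) {x : A.carrier} (hx : x ∈ LinearMap.range A.d) :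
    A.proj i x ∈ LinearMap.range A.d := by
  obtain ⟨z, rfl⟩ := hx
  cases i with
  | succ i => exact ⟨A.proj i z, (A.proj_d i z).symm⟩
  | zero =>
    obtain ⟨s, hs⟩ := A.mem_iSup z
    rw [hs, map_sum, map_sum]
    refine Submodule.sum_mem _ fun j _ => ?_
    rw [A.proj_ne (A.d_mem (A.proj_mem j z)) (Nat.succ_ne_zero j)]
    exact Submodule.zero_mem _

/-- The projection of the cohomology to its component of degree `i`. -/
def cohomologyProj (A : DGAlgebra.{u} K) (i : ℕ) : A.H →ₗ[K] A.H where
  toFun := Quotient.lift (s := Submodule.quotientRel A.coboundaries)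
    (fun x => A.cls (A.cocyclesProj i x)) (by
      intro x y hxy
      rw [← sub_eq_zero, ← map_sub, ← map_sub, A.cls_eq_zero]
      exact A.proj_exact i (A.mem_coboundaries.1 ((Submodule.quotientRel_def A.coboundaries).1 hxy)))
  map_add' ξ η := by
    obtain ⟨x, rfl⟩ := A.cls_surjective ξ
    obtain ⟨y, rfl⟩ := A.cls_surjective η
    rw [← map_add]
    change A.cls (A.cocyclesProj i (x + y)) =
      A.cls (A.cocyclesProj i x) + A.cls (A.cocyclesProj i y)
    rw [map_add, map_add]
  map_smul' c ξ := by
    obtain ⟨x, rfl⟩ := A.cls_surjective ξ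
    rw [← map_smul]
    change A.cls (A.cocyclesProj i (c • x)) = c • A.cls (A.cocyclesProj i x)
    rw [map_smul, map_smul]

theorem cohomologyProj_cls (A : DGAlgebra.{u} K) (i : ℕ) (x : A.cocycles) :
    A.cohomologyProj i (A.cls x) = A.cls (A.cocyclesProj i x) := rfl

instance cohomologyGr_gradedAlgebra (A : DGAlgebra.{u} K) : GradedAlgebra A.cohomologyGr :=
  gradedAlgebraOfProj _ A.cohomologyProj
    (by
      rintro i _ ⟨x, hx, rfl⟩
      exact congrArg A.cls (Subtype.ext (A.proj_same hx)))
    (by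
      rintro i j _ ⟨x, hx, rfl⟩ hij
      exact (congrArg A.cls (Subtype.ext (A.proj_ne hx hij))).trans (map_zero _))
    (by
      intro ξ
      obtain ⟨x, rfl⟩ := A.cls_surjective ξ
      obtain ⟨s, hs⟩ := A.mem_iSup x
      have : x = ∑ i ∈ s, A.cocyclesProj i x := by
        apply Subtype.ext
        rw [AddSubmonoidClass.coe_finsetSum]
        exact hs
      rw [this, map_sum]
      exact Submodule.sum_mem _ fun i _ =>
        Submodule.mem_iSup_of_mem i ⟨A.cocyclesProj i x, A.proj_mem i x, rfl⟩)

/-- The cohomology algebra of a differential graded algebra, with zero differential. -/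
def cohomology (A : DGAlgebra.{u} K) : DGAlgebra.{u} K where
  carrier := A.H
  gr := A.cohomologyGr
  graded_comm := by
    rintro i j _ _ ⟨x, hx, rfl⟩ ⟨y, hy, rfl⟩
    have : x * y = (-1) ^ (i * j) * (y * x) :=
      Subtype.ext (by simpa using A.graded_comm hx hy)
    change A.cls x * A.cls y = (-1) ^ (i * j) * (A.cls y * A.cls x)
    rw [← map_mul, this]
    simp
  d := 0
  d_mem _ := Submodule.zero_mem _
  d_d _ := rfl
  leibniz _ _ := by simp

/-- The map induced on cohomology by a homomorphism of differential graded algebras. -/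
def Hom.mapH {A B : DGAlgebra.{u} K} (f : Hom A B) : A.H →+* B.H :=
  Ideal.quotientMap B.coboundaries
    ((f.toAlgHom.comp A.cocycles.val).codRestrict B.cocycles (fun x => by
      change B.d (f.toAlgHom x) = 0
      rw [← f.map_d, A.mem_cocycles.1 x.2, map_zero])).toRingHom
    (by
      intro x hx
      obtain ⟨z, hz⟩ := A.mem_coboundaries.1 hx
      refine Ideal.mem_comap.2 (B.mem_coboundaries.2 ?_)
      exact ⟨f.toAlgHom z, by rw [← f.map_d, hz]; rfl⟩)

/-- A quasi-isomorphism is a homomorphism that induces an isomorphism on cohomology. -/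
def Hom.IsQuasiIso {A B : DGAlgebra.{u} K} (f : Hom A B) : Prop := Function.Bijective f.mapH

/-- Two differential graded algebras are quasi-isomorphic if they are connected by a chain of
quasi-isomorphisms, which may point in either direction. -/
def QuasiIsomorphic (A B : DGAlgebra.{u} K) : Prop :=
  Relation.EqvGen (fun A B : DGAlgebra.{u} K => ∃ f : Hom A B, f.IsQuasiIso) A B

/-- A differential graded algebra is formal if it is quasi-isomorphic to its cohomology algebra
with zero differential. -/
def IsFormal (A : DGAlgebra.{u} K) : Prop := QuasiIsomorphic A A.cohomology

end DGAlgebra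

end DGA

section Exterior

variable {M : Type u} [AddCommGroup M] [Module ℂ M]

/-- The automorphism of the exterior algebra which is multiplication by `(-1) ^ i` in degree `i`. -/
def signAut (M : Type u) [AddCommGroup M] [Module ℂ M] :
    ExteriorAlgebra ℂ M →ₐ[ℂ] ExteriorAlgebra ℂ M :=
  ExteriorAlgebra.map (-LinearMap.id)

theorem signAut_ι (m : M) : signAut M (ExteriorAlgebra.ι ℂ m) = -ExteriorAlgebra.ι ℂ m := by
  simp [signAut]

theorem signAut_apply {i : ℕ} {x : ExteriorAlgebra ℂ M} (hx : x ∈ ⋀[ℂ]^i M) :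
    signAut M x = (-1) ^ i * x := by
  induction hx using Submodule.pow_induction_on_left' with
  | algebraMap r => simp
  | add x y i _ _ hx hy => rw [map_add, hx, hy, mul_add]
  | mem_mul m hm i x _ ih =>
    obtain ⟨m, rfl⟩ := hm
    rw [map_mul, signAut_ι, ih, pow_succ]
    rcases neg_one_pow_eq_or (ExteriorAlgebra ℂ M) i with h | h <;> simp [h]

theorem ι_anticomm (a b : M) : ExteriorAlgebra.ι ℂ a * ExteriorAlgebra.ι ℂ b =
    -(ExteriorAlgebra.ι ℂ b * ExteriorAlgebra.ι ℂ a) :=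
  eq_neg_of_add_eq_zero_left (ExteriorAlgebra.ι_add_mul_swap a b)

theorem ι_mul_comm {j : ℕ} (m : M) {y : ExteriorAlgebra ℂ M} (hy : y ∈ ⋀[ℂ]^j M) :
    ExteriorAlgebra.ι ℂ m * y = (-1) ^ j * (y * ExteriorAlgebra.ι ℂ m) := by
  induction hy using Submodule.pow_induction_on_left' with
  | algebraMap r => simp [Algebra.commutes]
  | add x y i _ _ hx hy => rw [mul_add, hx, hy, add_mul, mul_add]
  | mem_mul a ha i x _ ih =>
    obtain ⟨a, rfl⟩ := ha
    rw [← mul_assoc, ι_anticomm, neg_mul, mul_assoc, ih, pow_succ]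
    rcases neg_one_pow_eq_or (ExteriorAlgebra ℂ M) i with h | h <;> simp [h, mul_assoc]

theorem exterior_graded_comm {i j : ℕ} {x y : ExteriorAlgebra ℂ M} (hx : x ∈ ⋀[ℂ]^i M)
    (hy : y ∈ ⋀[ℂ]^j M) : x * y = (-1) ^ (i * j) * (y * x) := by
  induction hx using Submodule.pow_induction_on_left' with
  | algebraMap r => simp [Algebra.commutes]
  | add x x' i _ _ hx hx' => rw [add_mul, hx, hx', mul_add, mul_add]
  | mem_mul a ha i x _ ih =>
    obtain ⟨a, rfl⟩ := ha
    rw [mul_assoc, ih, Nat.succ_mul, pow_add]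
    have h := ι_mul_comm a hy
    rcases neg_one_pow_eq_or (ExteriorAlgebra ℂ M) (i * j) with h1 | h1 <;>
    rcases neg_one_pow_eq_or (ExteriorAlgebra ℂ M) j with h2 | h2 <;>
    rw [h2] at h <;> simp [h1, h2, h, ← mul_assoc]

/-- Auxiliary: the algebra homomorphism `x ↦ (±x, d x; 0, x)` that determines the antiderivation
`d` extending `δ`. -/
def antiderivMatrix (δ : M →ₗ[ℂ] ⋀[ℂ]^2 M) :
    ExteriorAlgebra ℂ M →ₐ[ℂ] Matrix (Fin 2) (Fin 2) (ExteriorAlgebra ℂ M) :=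
  ExteriorAlgebra.lift ℂ
    ⟨{ toFun := fun m =>
        !![-ExteriorAlgebra.ι ℂ m, (δ m : ExteriorAlgebra ℂ M); 0, ExteriorAlgebra.ι ℂ m]
       map_add' := fun m n => by
        ext i j; fin_cases i <;> fin_cases j <;> simp [add_comm]
       map_smul' := fun c m => by
        ext i j; fin_cases i <;> fin_cases j <;> simp },
     fun m => by
      have h := ι_mul_comm m (δ m).2
      ext i j; fin_cases i <;> fin_cases j <;>
        simp [Matrix.mul_apply, Fin.sum_univ_two, h]⟩

theorem antiderivMatrix_ι (δ : M →ₗ[ℂ] ⋀[ℂ]^2 M) (m : M) :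
    antiderivMatrix δ (ExteriorAlgebra.ι ℂ m) =
      !![-ExteriorAlgebra.ι ℂ m, (δ m : ExteriorAlgebra ℂ M); 0, ExteriorAlgebra.ι ℂ m] := by
  simp [antiderivMatrix]

theorem antiderivMatrix_entries (δ : M →ₗ[ℂ] ⋀[ℂ]^2 M) (x : ExteriorAlgebra ℂ M) :
    antiderivMatrix δ x 0 0 = signAut M x ∧ antiderivMatrix δ x 1 0 = 0 ∧
      antiderivMatrix δ x 1 1 = x := by
  induction x using ExteriorAlgebra.induction with
  | algebraMap r => simp [Matrix.algebraMap_matrix_apply]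
  | ι m => simp [antiderivMatrix_ι, signAut_ι]
  | mul x y hx hy =>
    simp [Matrix.mul_apply, Fin.sum_univ_two, hx, hy]
  | add x y hx hy => simp [hx, hy]

/-- The extension of a linear map `δ : M → Λ² M` to the exterior algebra by the
graded Leibniz rule. -/
def antideriv (δ : M →ₗ[ℂ] ⋀[ℂ]^2 M) : ExteriorAlgebra ℂ M →ₗ[ℂ] ExteriorAlgebra ℂ M where
  toFun x := antiderivMatrix δ x 0 1
  map_add' x y := by simp
  map_smul' c x := by simp

theorem antideriv_ι (δ : M →ₗ[ℂ] ⋀[ℂ]^2 M) (m : M) :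
    antideriv δ (ExteriorAlgebra.ι ℂ m) = δ m := by
  simp [antideriv, antiderivMatrix_ι]

theorem antideriv_mul (δ : M →ₗ[ℂ] ⋀[ℂ]^2 M) (x y : ExteriorAlgebra ℂ M) :
    antideriv δ (x * y) = antideriv δ x * y + signAut M x * antideriv δ y := by
  simp [antideriv, Matrix.mul_apply, Fin.sum_univ_two, antiderivMatrix_entries, add_comm]

theorem antideriv_algebraMap (δ : M →ₗ[ℂ] ⋀[ℂ]^2 M) (r : ℂ) :
    antideriv δ (algebraMap ℂ _ r) = 0 := by
  simp [antideriv, Matrix.algebraMap_matrix_apply]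

/-- The antiderivation is the only extension by the Leibniz rule. -/
theorem antideriv_unique (δ : M →ₗ[ℂ] ⋀[ℂ]^2 M)
    (D : ExteriorAlgebra ℂ M →ₗ[ℂ] ExteriorAlgebra ℂ M)
    (hι : ∀ m, D (ExteriorAlgebra.ι ℂ m) = δ m)
    (hmul : ∀ x y, D (x * y) = D x * y + signAut M x * D y) : D = antideriv δ := by
  have h1 : D 1 = 0 := by simpa using hmul 1 1
  refine LinearMap.ext fun x => ?_
  induction x using ExteriorAlgebra.induction with
  | algebraMap r => rw [antideriv_algebraMap, Algebra.algebraMap_eq_smul_one, map_smul, h1,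
      smul_zero]
  | ι m => rw [hι, antideriv_ι]
  | mul x y hx hy => rw [hmul, antideriv_mul, hx, hy]
  | add x y hx hy => rw [map_add, map_add, hx, hy]

theorem antideriv_mem (δ : M →ₗ[ℂ] ⋀[ℂ]^2 M) {i : ℕ} {x : ExteriorAlgebra ℂ M}
    (hx : x ∈ ⋀[ℂ]^i M) : antideriv δ x ∈ ⋀[ℂ]^(i + 1) M := by
  induction hx using Submodule.pow_induction_on_left' with
  | algebraMap r => rw [antideriv_algebraMap]; exact Submodule.zero_mem _
  | add x y i _ _ hx hy => rw [map_add]; exact Submodule.add_mem _ hx hy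
  | mem_mul m hm i x hx ih =>
    obtain ⟨m, rfl⟩ := hm
    rw [antideriv_mul, antideriv_ι, signAut_ι, neg_mul]
    refine Submodule.add_mem _ ?_ (Submodule.neg_mem _ ?_)
    · have := SetLike.GradedMul.mul_mem (A := fun i : ℕ => ⋀[ℂ]^i M) (δ m).2 hx
      rwa [show 2 +  i = i + 1 + 1 by omega] at this
    · have h1 : ExteriorAlgebra.ι ℂ m ∈ ⋀[ℂ]^1 M := by
        change _ ∈ LinearMap.range (ExteriorAlgebra.ι ℂ (M := M)) ^ 1
        rw [pow_one]
        exact ⟨m, rfl⟩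
      have := SetLike.GradedMul.mul_mem (A := fun i : ℕ => ⋀[ℂ]^i M) h1 ih
      rwa [show 1 + (i + 1) = i + 1 + 1 by omega] at this

theorem signAut_antideriv (δ : M →ₗ[ℂ] ⋀[ℂ]^2 M) (x : ExteriorAlgebra ℂ M) :
    signAut M (antideriv δ x) = -antideriv δ (signAut M x) := by
  induction x using ExteriorAlgebra.induction with
  | algebraMap r => simp [antideriv_algebraMap]
  | ι m => rw [antideriv_ι, signAut_ι, map_neg, antideriv_ι, signAut_apply (δ m).2]; simp
  | mul x y hx hy =>
    simp only [antideriv_mul, map_add, map_mul, hx, hy]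
    simp only [neg_mul, mul_neg]
    abel
  | add x y hx hy => simp only [map_add, hx, hy]; abel

/-- An antiderivation squares to zero if it does so on generators. -/
theorem antideriv_sq (δ : M →ₗ[ℂ] ⋀[ℂ]^2 M) (h : ∀ m, antideriv δ (δ m : ExteriorAlgebra ℂ M) = 0)
    (x : ExteriorAlgebra ℂ M) : antideriv δ (antideriv δ x) = 0 := by
  induction x using ExteriorAlgebra.induction with
  | algebraMap r => rw [antideriv_algebraMap, map_zero]
  | ι m => rw [antideriv_ι, h]
  | mul x y hx hy =>
    simp only [antideriv_mul, map_add, hx, hy, signAut_antideriv]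
    simp
  | add x y hx hy => simp only [map_add, hx, hy, add_zero]

end Exterior

section Bracket

variable {V : Type u} [AddCommGroup V] [Module ℂ V]

/-- The algebra homomorphism `Λ V* → Λ V*` given on covectors by `α ↦ α ∘ T`. -/
def pullback (T : V →ₗ[ℂ] V) :
    ExteriorAlgebra ℂ (Module.Dual ℂ V) →ₐ[ℂ] ExteriorAlgebra ℂ (Module.Dual ℂ V) :=
  ExteriorAlgebra.map (Module.Dual.transpose T)

theorem pullback_ι (T : V →ₗ[ℂ] V) (α : Module.Dual ℂ V) :
    pullback T (ExteriorAlgebra.ι ℂ α) = ExteriorAlgebra.ι ℂ (α ∘ₗ T) := by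
  simp [pullback, Module.Dual.transpose_apply]

variable [FiniteDimensional ℂ V]

/-- The linear functionals of the dual basis of a (chosen) basis of `V`. -/
abbrev dualCoord (V : Type u) [AddCommGroup V] [Module ℂ V] [FiniteDimensional ℂ V]
    (i : Fin (Module.finrank ℂ V)) : Module.Dual ℂ V := (Module.finBasis ℂ V).coord i

theorem sum_pullback {F : Type*} [AddCommGroup F] [Module ℂ F]
    (φ : Module.Dual ℂ V →ₗ[ℂ] Module.Dual ℂ V →ₗ[ℂ] F) (b : V →ₗ[ℂ] V →ₗ[ℂ] ℂ)
    (S T : V →ₗ[ℂ] V) :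
    ∑ i, ∑ j, b (S (Module.finBasis ℂ V i)) (T (Module.finBasis ℂ V j)) •
        φ (dualCoord V i) (dualCoord V j) =
      ∑ i, ∑ j, b (Module.finBasis ℂ V i) (Module.finBasis ℂ V j) •
        φ (dualCoord V i ∘ₗ S) (dualCoord V j ∘ₗ T) := by
  set e := Module.finBasis ℂ V with he
  have hS : ∀ (T : V →ₗ[ℂ] V) i, dualCoord V i ∘ₗ T = ∑ k, (e.coord i (T (e k))) • dualCoord V k := by
    intro T i
    refine e.ext fun l => ?_
    simp [dualCoord, ← he, Finsupp.single_apply]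
  have hb : ∀ i j, b (S (e i)) (T (e j)) =
      ∑ k, ∑ l, e.coord k (S (e i)) * e.coord l (T (e j)) * b (e k) (e l) := by
    intro i j
    conv_lhs => rw [← e.sum_repr (S (e i)), ← e.sum_repr (T (e j))]
    simp only [map_sum, LinearMap.sum_apply, map_smul, LinearMap.smul_apply, smul_eq_mul,
      Module.Basis.coord_apply, Finset.mul_sum]
    rw [Finset.sum_comm]
    refine Finset.sum_congr rfl fun k _ => Finset.sum_congr rfl fun l _ => ?_
    ring
  simp only [hb, hS, map_sum, LinearMap.sum_apply, map_smul, LinearMap.smul_apply,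
    Finset.sum_smul, Finset.smul_sum, smul_smul]
  have key : ∀ (f : Fin (Module.finrank ℂ V) → Fin (Module.finrank ℂ V) →
      Fin (Module.finrank ℂ V) → Fin (Module.finrank ℂ V) → F),
      ∑ i, ∑ j, ∑ k, ∑ l, f i j k l = ∑ k, ∑ l, ∑ j, ∑ i, f i j k l := by
    intro f
    calc ∑ i, ∑ j, ∑ k, ∑ l, f i j k l = ∑ i, ∑ k, ∑ j, ∑ l, f i j k l :=
          Finset.sum_congr rfl fun i _ => Finset.sum_comm
      _ = ∑ k, ∑ i, ∑ l, ∑ j, f i j k l := by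
          rw [Finset.sum_comm]
          exact Finset.sum_congr rfl fun k _ => Finset.sum_congr rfl fun i _ => Finset.sum_comm
      _ = ∑ k, ∑ l, ∑ j, ∑ i, f i j k l :=
          Finset.sum_congr rfl fun k _ => by
            rw [Finset.sum_comm]
            exact Finset.sum_congr rfl fun l _ => Finset.sum_comm
  rw [key]
  refine Finset.sum_congr rfl fun k _ => Finset.sum_congr rfl fun l _ =>
    Finset.sum_congr rfl fun j _ => Finset.sum_congr rfl fun i _ => ?_
  congr 1
  ring

/-- The element `½ ∑ b (e_i, e_j) e^i ∧ e^j` of `Λ² V*`; when `b` is alternating this is `b`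
regarded as a two-form. -/
def twoForm : (V →ₗ[ℂ] V →ₗ[ℂ] ℂ) →ₗ[ℂ] ⋀[ℂ]^2 (Module.Dual ℂ V) where
  toFun b := (1 / 2 : ℂ) • ∑ i, ∑ j, b (Module.finBasis ℂ V i) (Module.finBasis ℂ V j) •
      exteriorPower.ιMulti ℂ 2 ![dualCoord V i, dualCoord V j]
  map_add' b c := by
    simp [add_smul, Finset.sum_add_distrib, smul_add]
  map_smul' r b := by
    simp only [LinearMap.smul_apply, smul_eq_mul, mul_smul, RingHom.id_apply]
    simp only [← Finset.smul_sum]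
    rw [smul_comm]

/-- The product of two covectors, as a bilinear map. -/
def ιMul (V : Type u) [AddCommGroup V] [Module ℂ V] : Module.Dual ℂ V →ₗ[ℂ] Module.Dual ℂ V →ₗ[ℂ]
    ExteriorAlgebra ℂ (Module.Dual ℂ V) :=
  (LinearMap.mul ℂ _).compl₁₂ (ExteriorAlgebra.ι ℂ) (ExteriorAlgebra.ι ℂ)

theorem coe_twoForm (b : V →ₗ[ℂ] V →ₗ[ℂ] ℂ) :
    (twoForm b : ExteriorAlgebra ℂ (Module.Dual ℂ V)) =
      (1 / 2 : ℂ) • ∑ i, ∑ j, b (Module.finBasis ℂ V i) (Module.finBasis ℂ V j) •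
      (ExteriorAlgebra.ι ℂ (dualCoord V i) * ExteriorAlgebra.ι ℂ (dualCoord V j)) := by
  simp [twoForm, ExteriorAlgebra.ιMulti_apply]

theorem twoForm_comp (b : V →ₗ[ℂ] V →ₗ[ℂ] ℂ) (S T : V →ₗ[ℂ] V) :
    (twoForm (b.compl₁₂ S T) : ExteriorAlgebra ℂ (Module.Dual ℂ V)) =
      (1 / 2 : ℂ) • ∑ i, ∑ j, b (Module.finBasis ℂ V i) (Module.finBasis ℂ V j) •
      (ExteriorAlgebra.ι ℂ (dualCoord V i ∘ₗ S) * ExteriorAlgebra.ι ℂ (dualCoord V j ∘ₗ T)) :=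
  (coe_twoForm _).trans (congrArg _ (sum_pullback (ιMul V) b S T))

theorem pullback_twoForm (b : V →ₗ[ℂ] V →ₗ[ℂ] ℂ) (T : V →ₗ[ℂ] V) :
    pullback T (twoForm b : ExteriorAlgebra ℂ (Module.Dual ℂ V)) = twoForm (b.compl₁₂ T T) := by
  rw [twoForm_comp, coe_twoForm]
  simp [pullback_ι]

/-- The two-form of an alternating bilinear form `b` pairs with `x ∧ y` to `b x y`. -/
theorem pairing_twoForm (b : V →ₗ[ℂ] V →ₗ[ℂ] ℂ) (hb : ∀ x, b x x = 0) (x y : V) :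
    exteriorPower.pairingDual ℂ V 2 (twoForm b) (exteriorPower.ιMulti ℂ 2 ![x, y]) = b x y := by
  have hsum : ∀ x y, ∑ i, ∑ j, b (Module.finBasis ℂ V i) (Module.finBasis ℂ V j) *
      (dualCoord V i x * dualCoord V j y) = b x y := by
    intro x y
    conv_rhs => rw [← (Module.finBasis ℂ V).sum_repr x, ← (Module.finBasis ℂ V).sum_repr y]
    simp only [map_sum, LinearMap.sum_apply, map_smul, LinearMap.smul_apply, smul_eq_mul,
      Finset.mul_sum, dualCoord, Module.Basis.coord_apply]
    rw [Finset.sum_comm]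
    refine Finset.sum_congr rfl fun k _ => Finset.sum_congr rfl fun l _ => ?_
    ring
  have hanti : b y x = -b x y := by
    have h := hb (x + y)
    simp only [map_add, LinearMap.add_apply, hb] at h
    linear_combination h
  have key : ∀ i j, exteriorPower.pairingDual ℂ V 2
      (exteriorPower.ιMulti ℂ 2 ![dualCoord V i, dualCoord V j])
      (exteriorPower.ιMulti ℂ 2 ![x, y]) =
      dualCoord V i x * dualCoord V j y - dualCoord V i y * dualCoord V j x := by
    intro i j
    rw [exteriorPower.pairingDual_ιMulti_ιMulti, Matrix.det_fin_two]
    simp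
    try ring
  simp only [twoForm, LinearMap.coe_mk, AddHom.coe_mk, map_smul, map_sum, LinearMap.smul_apply,
    LinearMap.sum_apply, key, smul_eq_mul, mul_sub, Finset.sum_sub_distrib, hsum, hanti]
  ring

/-- The map `V* → Λ² V*` dual to a bracket `w` on `V`: it sends `α` to the two-form
`(x, y) ↦ α (w x y)`. -/
def dualBracket (w : V →ₗ[ℂ] V →ₗ[ℂ] V) : Module.Dual ℂ V →ₗ[ℂ] ⋀[ℂ]^2 (Module.Dual ℂ V) where
  toFun α := twoForm (w.compr₂ α)
  map_add' α β := by rw [← map_add]; rfl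
  map_smul' r α := by rw [← map_smul]; rfl

/-- The Chevalley-Eilenberg differential `d_w` on `Λ V*`: the map dual to `w`, extended by
the Leibniz rule. -/
def ceDifferential (w : V →ₗ[ℂ] V →ₗ[ℂ] V) :
    ExteriorAlgebra ℂ (Module.Dual ℂ V) →ₗ[ℂ] ExteriorAlgebra ℂ (Module.Dual ℂ V) :=
  antideriv (dualBracket w)

theorem ceDifferential_sq (w : V →ₗ[ℂ] V →ₗ[ℂ] V) (alt : ∀ x, w x x = 0)
    (jac : ∀ x y z, w (w x y) z + w (w y z) x + w (w z x) y = 0)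
    (x : ExteriorAlgebra ℂ (Module.Dual ℂ V)) :
    ceDifferential w (ceDifferential w x) = 0 := by
  refine antideriv_sq _ (fun α => ?_) x
  have anti : ∀ x y, w y x = -w x y := by
    intro x y
    have h := alt (x + y)
    simp only [map_add, LinearMap.add_apply, alt, zero_add, add_zero] at h
    exact eq_neg_of_add_eq_zero_left h
  set e := Module.finBasis ℂ V with he
  set f : Fin (Module.finrank ℂ V) → ExteriorAlgebra ℂ (Module.Dual ℂ V) :=
    fun i => ExteriorAlgebra.ι ℂ (dualCoord V i) with hf
  have hδ : ∀ β : Module.Dual ℂ V,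
      (dualBracket w β : ExteriorAlgebra ℂ (Module.Dual ℂ V)) =
      (1 / 2 : ℂ) • ∑ i, ∑ j, β (w (e i) (e j)) • (f i * f j) := fun β => coe_twoForm _
  have hD : ∀ i j, antideriv (dualBracket w) (f i * f j) =
      (dualBracket w (dualCoord V i) : ExteriorAlgebra ℂ (Module.Dual ℂ V)) * f j -
      (dualBracket w (dualCoord V j) : ExteriorAlgebra ℂ (Module.Dual ℂ V)) * f i := by
    intro i j
    rw [antideriv_mul, antideriv_ι, antideriv_ι, signAut_ι, neg_mul,
      ι_mul_comm _ (dualBracket w (dualCoord V j)).2, ← sub_eq_add_neg]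
    simp [hf]
  have step : antideriv (dualBracket w) (dualBracket w α : ExteriorAlgebra ℂ (Module.Dual ℂ V)) =
      ∑ i, ∑ j, α (w (e i) (e j)) •
        ((dualBracket w (dualCoord V i) : ExteriorAlgebra ℂ (Module.Dual ℂ V)) * f j) := by
    rw [hδ α]
    simp only [map_smul, map_sum, hD, smul_sub, Finset.sum_sub_distrib]
    rw [Finset.sum_comm (f := fun i j => α (w (e i) (e j)) •
      ((dualBracket w (dualCoord V j) : ExteriorAlgebra ℂ (Module.Dual ℂ V)) * f i))]
    have : ∀ i j, α (w (e j) (e i)) •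
      ((dualBracket w (dualCoord V i) : ExteriorAlgebra ℂ (Module.Dual ℂ V)) * f j) =
      -(α (w (e i) (e j)) •
      ((dualBracket w (dualCoord V i) : ExteriorAlgebra ℂ (Module.Dual ℂ V)) * f j)) := by
      intro i j
      rw [anti, map_neg, neg_smul]
    simp only [this, Finset.sum_neg_distrib]
    module
  have step2 : antideriv (dualBracket w) (dualBracket w α : ExteriorAlgebra ℂ (Module.Dual ℂ V)) =
      (1 / 2 : ℂ) • ∑ k, ∑ l, ∑ j, α (w (w (e k) (e l)) (e j)) • (f k * f l * f j) := by
    rw [step]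
    have h1 : ∀ k l j, α (w (w (e k) (e l)) (e j)) =
        ∑ i, α (w (e i) (e j)) * dualCoord V i (w (e k) (e l)) := by
      intro k l j
      conv_lhs => rw [← e.sum_repr (w (e k) (e l))]
      simp only [map_sum, LinearMap.sum_apply, map_smul, LinearMap.smul_apply, smul_eq_mul]
      exact Finset.sum_congr rfl fun i _ => mul_comm _ _
    have h2 : ∀ i j, α (w (e i) (e j)) •
        ((dualBracket w (dualCoord V i) : ExteriorAlgebra ℂ (Module.Dual ℂ V)) * f j) =
        (1 / 2 : ℂ) • ∑ k, ∑ l, (α (w (e i) (e j)) * dualCoord V i (w (e k) (e l))) •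
          (f k * f l * f j) := by
      intro i j
      rw [hδ, smul_mul_assoc, smul_comm, Finset.sum_mul, Finset.smul_sum]
      congr 1
      refine Finset.sum_congr rfl fun k _ => ?_
      rw [Finset.sum_mul, Finset.smul_sum]
      refine Finset.sum_congr rfl fun l _ => ?_
      rw [smul_mul_assoc, smul_smul]
    simp only [h1, h2, Finset.sum_smul, ← Finset.smul_sum]
    congr 1
    rw [Finset.sum_comm]
    calc _ = ∑ j, ∑ k, ∑ i, ∑ l, (α (w (e i) (e j)) * dualCoord V i (w (e k) (e l))) •
          (f k * f l * f j) := Finset.sum_congr rfl fun j _ => Finset.sum_comm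
      _ = ∑ j, ∑ k, ∑ l, ∑ i, (α (w (e i) (e j)) * dualCoord V i (w (e k) (e l))) •
          (f k * f l * f j) := Finset.sum_congr rfl fun j _ => Finset.sum_congr rfl fun k _ =>
            Finset.sum_comm
      _ = ∑ k, ∑ j, ∑ l, ∑ i, (α (w (e i) (e j)) * dualCoord V i (w (e k) (e l))) •
          (f k * f l * f j) := Finset.sum_comm
      _ = _ := Finset.sum_congr rfl fun k _ => Finset.sum_comm
  have cyc : ∀ k l j, f k * f l * f j = f l * f j * f k := by
    intro k l j
    simp only [hf]
    rw [mul_assoc, ι_anticomm (dualCoord V l), mul_neg, ← mul_assoc,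
      ι_anticomm (dualCoord V k) (dualCoord V j), neg_mul, neg_neg, mul_assoc,
      ι_anticomm (dualCoord V k) (dualCoord V l), mul_neg, ← mul_assoc,
      ι_anticomm (dualCoord V j) (dualCoord V l), neg_mul, neg_neg, neg_mul, neg_mul, neg_neg]
  have rot : ∀ G : Fin (Module.finrank ℂ V) → Fin (Module.finrank ℂ V) →
      Fin (Module.finrank ℂ V) → ExteriorAlgebra ℂ (Module.Dual ℂ V),
      ∑ k, ∑ l, ∑ j, G k l j = ∑ k, ∑ l, ∑ j, G l j k := by
    intro G
    calc ∑ k, ∑ l, ∑ j, G k l j = ∑ k, ∑ j, ∑ l, G k l j :=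
          Finset.sum_congr rfl fun k _ => Finset.sum_comm
      _ = ∑ j, ∑ k, ∑ l, G k l j := Finset.sum_comm
  set T : ExteriorAlgebra ℂ (Module.Dual ℂ V) :=
    ∑ k, ∑ l, ∑ j, α (w (w (e k) (e l)) (e j)) • (f k * f l * f j) with hT
  have t1 : T = ∑ k, ∑ l, ∑ j, α (w (w (e l) (e j)) (e k)) • (f k * f l * f j) := by
    rw [hT, rot]
    exact Finset.sum_congr rfl fun k _ => Finset.sum_congr rfl fun l _ =>
      Finset.sum_congr rfl fun j _ => by rw [cyc k l j]
  have t2 : T = ∑ k, ∑ l, ∑ j, α (w (w (e j) (e k)) (e l)) • (f k * f l * f j) := by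
    rw [t1, rot]
    exact Finset.sum_congr rfl fun k _ => Finset.sum_congr rfl fun l _ =>
      Finset.sum_congr rfl fun j _ => by rw [cyc k l j]
  have h3 : T + T + T = 0 := by
    have : T + T + T = T + ∑ k, ∑ l, ∑ j, α (w (w (e l) (e j)) (e k)) • (f k * f l * f j) +
        ∑ k, ∑ l, ∑ j, α (w (w (e j) (e k)) (e l)) • (f k * f l * f j) := by rw [← t1, ← t2]
    rw [this, hT]
    simp only [← Finset.sum_add_distrib, ← add_smul, ← map_add, jac, map_zero, zero_smul,
      Finset.sum_const_zero]
  have h4 : T = 0 := by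
    have : (3 : ℂ) • T = 0 := by rw [← h3]; module
    exact (smul_eq_zero.1 this).resolve_left (by norm_num)
  rw [step2, h4, smul_zero]

end Bracket

section ComplexStructure

variable {g : Type u} [LieRing g] [LieAlgebra ℝ g]

/-- The Lie bracket of a complex Lie algebra as a bilinear map. -/
def bracketMap (L : Type u) [LieRing L] [LieAlgebra ℂ L] : L →ₗ[ℂ] L →ₗ[ℂ] L :=
  LinearMap.mk₂ ℂ (fun x y => ⁅x, y⁆) add_lie smul_lie lie_add (fun c x y => lie_smul c x y)

/-- Complex conjugation on the complexification of a real Lie algebra. -/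
def conjC (g : Type u) [LieRing g] [LieAlgebra ℝ g] :
    (ℂ ⊗[ℝ] g) →ₛₗ[starRingEnd ℂ] (ℂ ⊗[ℝ] g) where
  toFun := LinearMap.rTensor g Complex.conjAe.toLinearMap
  map_add' := map_add _
  map_smul' c x := by
    induction x with
    | zero => simp
    | tmul a v => simp [TensorProduct.smul_tmul']
    | add x y hx hy => simp only [smul_add, map_add, hx, hy]

theorem conjC_tmul (a : ℂ) (v : g) : conjC g (a ⊗ₜ v) = (starRingEnd ℂ a) ⊗ₜ v := rfl

theorem conjC_lie (x y : ℂ ⊗[ℝ] g) : conjC g ⁅x, y⁆ = ⁅conjC g x, conjC g y⁆ := by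
  change conjC g (bracketMap _ x y) = bracketMap _ (conjC g x) (conjC g y)
  induction x with
  | zero => simp
  | add x x' hx hx' => simp only [map_add, LinearMap.add_apply, hx, hx']
  | tmul a v =>
    induction y with
    | zero => simp
    | add y y' hy hy' => simp only [map_add, hy, hy']
    | tmul b z =>
      change conjC g ((a * b) ⊗ₜ ⁅v, z⁆) = (starRingEnd ℂ a * starRingEnd ℂ b) ⊗ₜ ⁅v, z⁆
      rw [conjC_tmul, map_mul]

/-- The complex conjugate of a complex Lie subalgebra of the complexification. -/
def conjSubalgebra (S : LieSubalgebra ℂ (ℂ ⊗[ℝ] g)) : LieSubalgebra ℂ (ℂ ⊗[ℝ] g) :=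
  { S.toSubmodule.map (conjC g) with
    lie_mem' := by
      rintro _ _ ⟨x, hx, rfl⟩ ⟨y, hy, rfl⟩
      exact ⟨⁅x, y⁆, S.lie_mem hx hy, conjC_lie x y⟩ }

variable (g) in
/-- An integrable complex structure on a real Lie algebra: a complex subalgebra of the
complexification which is complementary to its complex conjugate. -/
structure LieComplexStructure where
  /-- the subalgebra of vectors of type `(1,0)` -/
  g10 : LieSubalgebra ℂ (ℂ ⊗[ℝ] g)
  isCompl : IsCompl g10.toSubmodule (conjSubalgebra g10).toSubmodule

variable (g) in
/-- The algebra `Λ^{*,*} 𝔤*` of complex-valued forms on `𝔤`. -/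
abbrev ComplexForms : Type u := ExteriorAlgebra ℂ (Module.Dual ℂ (ℂ ⊗[ℝ] g))

namespace LieComplexStructure

variable (I : LieComplexStructure g)

/-- The subalgebra of vectors of type `(0,1)`, the complex conjugate of `g10`. -/
def g01 : LieSubalgebra ℂ (ℂ ⊗[ℝ] g) := conjSubalgebra I.g10

/-- The projection of a complex vector to its component of type `(1,0)`. -/
def P : (ℂ ⊗[ℝ] g) →ₗ[ℂ] (ℂ ⊗[ℝ] g) :=
  I.g10.toSubmodule.projection I.g01.toSubmodule I.isCompl

/-- The projection of a complex vector to its component of type `(0,1)`. -/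
def Q : (ℂ ⊗[ℝ] g) →ₗ[ℂ] (ℂ ⊗[ℝ] g) :=
  I.g01.toSubmodule.projection I.g10.toSubmodule I.isCompl.symm

/-- The complex structure operator: `√-1` on vectors of type `(1,0)` and `-√-1` on
vectors of type `(0,1)`. -/
def J : (ℂ ⊗[ℝ] g) →ₗ[ℂ] (ℂ ⊗[ℝ] g) := Complex.I • I.P - Complex.I • I.Q

/-- The covectors of type `(1,0)`: those which vanish on vectors of type `(0,1)`. -/
def covectors10 : Submodule ℂ (Module.Dual ℂ (ℂ ⊗[ℝ] g)) := I.g01.toSubmodule.dualAnnihilator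

/-- The covectors of type `(0,1)`: those which vanish on vectors of type `(1,0)`. -/
def covectors01 : Submodule ℂ (Module.Dual ℂ (ℂ ⊗[ℝ] g)) := I.g10.toSubmodule.dualAnnihilator

/-- The forms of Hodge type `(p, q)`: sums of products of `p` covectors of type `(1,0)` and `q`
covectors of type `(0,1)`. -/
def forms (p q : ℕ) : Submodule ℂ (ComplexForms g) :=
  I.covectors10.map (ExteriorAlgebra.ι ℂ) ^ p * I.covectors01.map (ExteriorAlgebra.ι ℂ) ^ q

theorem P_add_Q (x : ℂ ⊗[ℝ] g) : I.P x + I.Q x = x :=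
  Submodule.projection_add_projection_eq_self I.isCompl x

theorem P_mem (x : ℂ ⊗[ℝ] g) : I.P x ∈ I.g10 := Submodule.projection_apply_mem I.isCompl x

theorem Q_mem (x : ℂ ⊗[ℝ] g) : I.Q x ∈ I.g01 := Submodule.projection_apply_mem I.isCompl.symm x

theorem P_of_mem {x : ℂ ⊗[ℝ] g} (hx : x ∈ I.g10) : I.P x = x :=
  (Submodule.projection_eq_self_iff I.isCompl x).2 hx

theorem Q_of_mem {x : ℂ ⊗[ℝ] g} (hx : x ∈ I.g01) : I.Q x = x :=
  (Submodule.projection_eq_self_iff I.isCompl.symm x).2 hx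

theorem P_eq_zero {x : ℂ ⊗[ℝ] g} (hx : x ∈ I.g01) : I.P x = 0 :=
  (Submodule.projection_apply_eq_zero_iff I.isCompl).2 hx

theorem Q_eq_zero {x : ℂ ⊗[ℝ] g} (hx : x ∈ I.g10) : I.Q x = 0 :=
  (Submodule.projection_apply_eq_zero_iff I.isCompl.symm).2 hx

/-- The part of the Lie bracket of Hodge type `(0,1)`. -/
def bracket01 : (ℂ ⊗[ℝ] g) →ₗ[ℂ] (ℂ ⊗[ℝ] g) →ₗ[ℂ] (ℂ ⊗[ℝ] g) :=
  (bracketMap _).compl₁₂ I.Q I.Q +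
    (((bracketMap _).compl₁₂ I.P I.Q).compr₂ I.P + ((bracketMap _).compl₁₂ I.Q I.P).compr₂ I.P)

/-- The part of the Lie bracket of Hodge type `(1,0)`. -/
def bracket10 : (ℂ ⊗[ℝ] g) →ₗ[ℂ] (ℂ ⊗[ℝ] g) →ₗ[ℂ] (ℂ ⊗[ℝ] g) :=
  (bracketMap _).compl₁₂ I.P I.P +
    (((bracketMap _).compl₁₂ I.P I.Q).compr₂ I.Q + ((bracketMap _).compl₁₂ I.Q I.P).compr₂ I.Q)

theorem bracket01_apply (x y : ℂ ⊗[ℝ] g) : I.bracket01 x y =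
    ⁅I.Q x, I.Q y⁆ + (I.P ⁅I.P x, I.Q y⁆ + I.P ⁅I.Q x, I.P y⁆) := rfl

theorem bracket10_apply (x y : ℂ ⊗[ℝ] g) : I.bracket10 x y =
    ⁅I.P x, I.P y⁆ + (I.Q ⁅I.P x, I.Q y⁆ + I.Q ⁅I.Q x, I.P y⁆) := rfl

theorem bracket_decomp : bracketMap (ℂ ⊗[ℝ] g) = I.bracket10 + I.bracket01 := by
  refine LinearMap.ext₂ fun x y => ?_
  change ⁅x, y⁆ = I.bracket10 x y + I.bracket01 x y
  rw [bracket01_apply, bracket10_apply]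
  conv_lhs => rw [← I.P_add_Q x, ← I.P_add_Q y]
  simp only [add_lie, lie_add]
  rw [← I.P_add_Q ⁅I.P x, I.Q y⁆, ← I.P_add_Q ⁅I.Q x, I.P y⁆]
  simp only [map_add, I.P_of_mem (I.P_mem _), I.Q_of_mem (I.Q_mem _), I.P_eq_zero (I.Q_mem _),
    I.Q_eq_zero (I.P_mem _)]
  abel

theorem bracket01_self (x : ℂ ⊗[ℝ] g) : I.bracket01 x x = 0 := by
  rw [bracket01_apply, lie_self, zero_add, ← map_add, ← lie_skew (I.P x) (I.Q x), neg_add_cancel,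
    map_zero]

theorem bracket01_jacobi (x y z : ℂ ⊗[ℝ] g) :
    I.bracket01 (I.bracket01 x y) z + I.bracket01 (I.bracket01 y z) x +
      I.bracket01 (I.bracket01 z x) y = 0 := by
  have hQ : ∀ x y, I.Q (I.bracket01 x y) = ⁅I.Q x, I.Q y⁆ := by
    intro x y
    rw [bracket01_apply, map_add, map_add, I.Q_eq_zero (I.P_mem _), I.Q_eq_zero (I.P_mem _),
      I.Q_of_mem (I.g01.lie_mem (I.Q_mem _) (I.Q_mem _)), add_zero, add_zero]
  have hP : ∀ x y, I.P (I.bracket01 x y) = I.P ⁅I.P x, I.Q y⁆ + I.P ⁅I.Q x, I.P y⁆ := by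
    intro x y
    rw [bracket01_apply, map_add, map_add, I.P_of_mem (I.P_mem _), I.P_of_mem (I.P_mem _),
      I.P_eq_zero (I.g01.lie_mem (I.Q_mem _) (I.Q_mem _)), zero_add]
  have hPP : ∀ u z, I.P ⁅I.P u, I.Q z⁆ = I.P ⁅u, I.Q z⁆ := by
    intro u z
    conv_rhs => rw [← I.P_add_Q u]
    rw [add_lie, map_add, I.P_eq_zero (I.g01.lie_mem (I.Q_mem _) (I.Q_mem _)), add_zero]
  have hw : ∀ x y z, I.bracket01 (I.bracket01 x y) z = ⁅⁅I.Q x, I.Q y⁆, I.Q z⁆ +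
      I.P (⁅⁅I.P x, I.Q y⁆, I.Q z⁆ + ⁅⁅I.Q x, I.P y⁆, I.Q z⁆ + ⁅⁅I.Q x, I.Q y⁆, I.P z⁆) := by
    intro x y z
    rw [I.bracket01_apply (I.bracket01 x y) z, hQ, hP, add_lie, map_add, hPP, hPP]
    simp only [map_add, add_assoc]
  have jac : ∀ a b c : ℂ ⊗[ℝ] g, ⁅⁅a, b⁆, c⁆ + ⁅⁅b, c⁆, a⁆ + ⁅⁅c, a⁆, b⁆ = 0 := by
    intro a b c
    have h := lie_jacobi c a b
    rw [← lie_skew ⁅a, b⁆ c, ← lie_skew ⁅b, c⁆ a, ← lie_skew ⁅c, a⁆ b, ← neg_add, ← neg_add, h,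
      neg_zero]
  have e1 := jac (I.Q x) (I.Q y) (I.Q z)
  have e2 := jac (I.P x) (I.Q y) (I.Q z)
  have e3 := jac (I.Q x) (I.P y) (I.Q z)
  have e4 := jac (I.Q x) (I.Q y) (I.P z)
  rw [hw, hw, hw]
  have e5 := congrArg I.P (congrArg₂ (· + ·) (congrArg₂ (· + ·) e2 e3) e4)
  simp only [map_add, add_zero, map_zero] at e5 ⊢
  rw [← add_zero (0 : ℂ ⊗[ℝ] g)]
  nth_rewrite 1 [← e1]
  rw [← e5]
  abel

theorem J_J (x : ℂ ⊗[ℝ] g) : I.J (I.J x) = -x := by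
  simp only [J, LinearMap.sub_apply, LinearMap.smul_apply, map_sub, map_smul,
    I.P_of_mem (I.P_mem _), I.Q_of_mem (I.Q_mem _), I.P_eq_zero (I.Q_mem _),
    I.Q_eq_zero (I.P_mem _), smul_zero, sub_zero, zero_sub, smul_neg, sub_neg_eq_add, smul_smul,
    Complex.I_mul_I]
  rw [← smul_add, P_add_Q, neg_one_smul]

theorem signAut_pullback (T : (ℂ ⊗[ℝ] g) →ₗ[ℂ] (ℂ ⊗[ℝ] g)) (x : ComplexForms g) :
    signAut _ (pullback T x) = pullback T (signAut _ x) := by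
  induction x using ExteriorAlgebra.induction with
  | algebraMap r => simp
  | ι α => rw [pullback_ι, signAut_ι, signAut_ι, map_neg, pullback_ι]
  | mul x y hx hy => simp only [map_mul, hx, hy]
  | add x y hx hy => simp only [map_add, hx, hy]

/-- The action of the complex structure on forms: a covector `α` is sent to `α ∘ J⁻¹`, where
`J⁻¹ = -J`, and products to products. -/
def formAct : ComplexForms g →ₐ[ℂ] ComplexForms g := pullback (-I.J)

/-- The inverse of the action of the complex structure on forms. -/
def formActInv : ComplexForms g →ₐ[ℂ] ComplexForms g := pullback I.J

theorem formAct_formActInv (x : ComplexForms g) : I.formAct (I.formActInv x) = x := by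
  induction x using ExteriorAlgebra.induction with
  | algebraMap r => simp
  | ι α =>
    rw [formActInv, pullback_ι, formAct, pullback_ι]
    congr 1
    ext x
    simp [J_J]
  | mul x y hx hy => rw [map_mul, map_mul, hx, hy]
  | add x y hx hy => rw [map_add, map_add, hx, hy]

theorem covectors_comm :
    Commute (I.covectors10.map (ExteriorAlgebra.ι ℂ)) (I.covectors01.map (ExteriorAlgebra.ι ℂ)) := by
  have h : ∀ A B : Submodule ℂ (Module.Dual ℂ (ℂ ⊗[ℝ] g)),
      A.map (ExteriorAlgebra.ι ℂ) * B.map (ExteriorAlgebra.ι ℂ) ≤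
        B.map (ExteriorAlgebra.ι ℂ) * A.map (ExteriorAlgebra.ι ℂ) := by
    intro A B
    rw [Submodule.mul_le]
    rintro _ ⟨a, ha, rfl⟩ _ ⟨b, hb, rfl⟩
    rw [ι_anticomm]
    exact Submodule.neg_mem _ (Submodule.mul_mem_mul ⟨b, hb, rfl⟩ ⟨a, ha, rfl⟩)
  exact le_antisymm (h _ _) (h _ _)

theorem forms_mul (p q p' q' : ℕ) : I.forms p q * I.forms p' q' = I.forms (p + p') (q + q') := by
  simp only [forms, pow_add]
  have h := (I.covectors_comm.pow_pow p' q).eq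
  rw [mul_assoc, ← mul_assoc (_ ^ q), ← h, mul_assoc, mul_assoc]

theorem covectors_map_le (A : Submodule ℂ (Module.Dual ℂ (ℂ ⊗[ℝ] g))) (n : ℕ) :
    A.map (ExteriorAlgebra.ι ℂ) ^ n ≤ ⋀[ℂ]^n (Module.Dual ℂ (ℂ ⊗[ℝ] g)) :=
  pow_le_pow_left' LinearMap.map_le_range n

theorem forms_le (p q : ℕ) : I.forms p q ≤ ⋀[ℂ]^(p + q) (Module.Dual ℂ (ℂ ⊗[ℝ] g)) := by
  refine (mul_le_mul' (covectors_map_le _ p) (covectors_map_le _ q)).trans ?_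
  rw [← pow_add]

theorem signAut_mem_forms {p q : ℕ} {x : ComplexForms g} (hx : x ∈ I.forms p q) :
    signAut _ x ∈ I.forms p q := by
  rw [signAut_apply (I.forms_le p q hx)]
  rcases neg_one_pow_eq_or (ComplexForms g) (p + q) with h | h <;> simpa [h] using hx

theorem antideriv_forms (δ : Module.Dual ℂ (ℂ ⊗[ℝ] g) →ₗ[ℂ] ⋀[ℂ]^2 (Module.Dual ℂ (ℂ ⊗[ℝ] g)))
    (a b : ℕ) (h10 : ∀ α ∈ I.covectors10, (δ α : ComplexForms g) ∈ I.forms (a + 1) b)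
    (h01 : ∀ α ∈ I.covectors01, (δ α : ComplexForms g) ∈ I.forms a (b + 1))
    {p q : ℕ} {x : ComplexForms g} (hx : x ∈ I.forms p q) :
    antideriv δ x ∈ I.forms (p + a) (q + b) := by
  have f0 : ∀ p, I.forms p 0 = I.covectors10.map (ExteriorAlgebra.ι ℂ) ^ p := fun p => by
    simp [forms]
  have f1 : ∀ q, I.forms 0 q = I.covectors01.map (ExteriorAlgebra.ι ℂ) ^ q := fun q => by
    simp [forms]
  have mulmem : ∀ {p q p' q' r s} {x y : ComplexForms g}, x ∈ I.forms p q → y ∈ I.forms p' q' →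
      p + p' = r → q + q' = s → x * y ∈ I.forms r s := by
    rintro p q p' q' r s x y hx hy rfl rfl
    rw [← forms_mul]
    exact Submodule.mul_mem_mul hx hy
  have key1 : ∀ p, ∀ x ∈ I.forms p 0, antideriv δ x ∈ I.forms (p + a) b := by
    intro p x hx
    rw [f0] at hx
    induction hx using Submodule.pow_induction_on_left' with
    | algebraMap r => rw [antideriv_algebraMap]; exact Submodule.zero_mem _
    | add x y i _ _ hx hy => rw [map_add]; exact Submodule.add_mem _ hx hy
    | mem_mul m hm i x hx ih =>
      rw [← f0] at hx
      obtain ⟨α, hα, rfl⟩ := hm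
      rw [antideriv_mul, antideriv_ι, signAut_ι, neg_mul]
      refine Submodule.add_mem _ (mulmem (h10 α hα) hx (by omega) (by omega))
        (Submodule.neg_mem _ (mulmem (p := 1) (q := 0) ?_ ih (by omega) (by omega)))
      rw [f0, pow_one]
      exact ⟨α, hα, rfl⟩
  have key2 : ∀ q, ∀ x ∈ I.forms 0 q, antideriv δ x ∈ I.forms a (q + b) := by
    intro q x hx
    rw [f1] at hx
    induction hx using Submodule.pow_induction_on_left' with
    | algebraMap r => rw [antideriv_algebraMap]; exact Submodule.zero_mem _
    | add x y i _ _ hx hy => rw [map_add]; exact Submodule.add_mem _ hx hy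
    | mem_mul m hm i x hx ih =>
      rw [← f1] at hx
      obtain ⟨α, hα, rfl⟩ := hm
      rw [antideriv_mul, antideriv_ι, signAut_ι, neg_mul]
      refine Submodule.add_mem _ (mulmem (h01 α hα) hx (by omega) (by omega))
        (Submodule.neg_mem _ (mulmem (p := 0) (q := 1) ?_ ih (by omega) (by omega)))
      rw [f1, pow_one]
      exact ⟨α, hα, rfl⟩
  rw [forms] at hx
  induction hx using Submodule.mul_induction_on' with
  | mem_mul_mem x hx y hy =>
    rw [← f0] at hx
    rw [← f1] at hy
    rw [antideriv_mul]
    exact Submodule.add_mem _ (mulmem (key1 p x hx) hy (by omega) (by omega))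
      (mulmem (I.signAut_mem_forms hx) (key2 q y hy) (by omega) (by omega))
  | add x _ y _ hx hy => rw [map_add]; exact Submodule.add_mem _ hx hy

theorem comp_P_mem (α : Module.Dual ℂ (ℂ ⊗[ℝ] g)) : α ∘ₗ I.P ∈ I.covectors10 :=
  (Submodule.mem_dualAnnihilator _).2 fun x hx => by
    rw [LinearMap.comp_apply, I.P_eq_zero hx, map_zero]

theorem comp_Q_mem (α : Module.Dual ℂ (ℂ ⊗[ℝ] g)) : α ∘ₗ I.Q ∈ I.covectors01 :=
  (Submodule.mem_dualAnnihilator _).2 fun x hx => by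
    rw [LinearMap.comp_apply, I.Q_eq_zero hx, map_zero]

/-- The algebra `Λ^{0,*} 𝔤*`, generated by the covectors of type `(0,1)`. -/
def zeroForms : Subalgebra ℂ (ComplexForms g) :=
  Algebra.adjoin ℂ (I.covectors01.map (ExteriorAlgebra.ι ℂ) : Set (ComplexForms g))

/-- `Λ^{0,*} 𝔤*` is the sum of the spaces of forms of Hodge type `(0, q)`. -/
theorem zeroForms_eq : Subalgebra.toSubmodule I.zeroForms = ⨆ q, I.forms 0 q := by
  have f1 : ∀ q, I.forms 0 q = I.covectors01.map (ExteriorAlgebra.ι ℂ) ^ q := fun q => by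
    simp [forms]
  apply le_antisymm
  · rw [zeroForms, Algebra.adjoin_eq_span, Submodule.span_le]
    intro x hx
    have : ∃ q, x ∈ I.forms 0 q := by
      induction hx using Submonoid.closure_induction with
      | mem x hx => exact ⟨1, by rw [f1, pow_one]; exact hx⟩
      | one => exact ⟨0, by rw [f1, pow_zero]; exact Submodule.one_le.1 le_rfl⟩
      | mul x y _ _ hx hy =>
        obtain ⟨q, hq⟩ := hx
        obtain ⟨r, hr⟩ := hy
        exact ⟨q + r, by rw [f1, pow_add, ← f1, ← f1]; exact Submodule.mul_mem_mul hq hr⟩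
    obtain ⟨q, hq⟩ := this
    exact Submodule.mem_iSup_of_mem q hq
  · refine iSup_le fun q => ?_
    rw [f1]
    induction q with
    | zero =>
      rw [pow_zero, Submodule.one_le]
      exact I.zeroForms.one_mem
    | succ q ih =>
      rw [pow_succ, Submodule.mul_le]
      exact fun x hx y hy => I.zeroForms.mul_mem (ih hx) (Algebra.subset_adjoin hy)

variable [FiniteDimensional ℝ g]

variable (g) in
/-- The Chevalley-Eilenberg differential of `𝔤`, extended to complex-valued forms. -/
def dC : ComplexForms g →ₗ[ℂ] ComplexForms g := ceDifferential (bracketMap (ℂ ⊗[ℝ] g))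

/-- The twisted differential `d^c = I d I⁻¹`. -/
def twistedD : ComplexForms g →ₗ[ℂ] ComplexForms g :=
  I.formAct.toLinearMap ∘ₗ dC g ∘ₗ I.formActInv.toLinearMap

/-- The Dolbeault differential `∂̄ = (d - √-1 d^c) / 2`, the part of Hodge type `(0,1)` of the
Chevalley-Eilenberg differential. -/
def delbar : ComplexForms g →ₗ[ℂ] ComplexForms g :=
  (1 / 2 : ℂ) • (dC g - Complex.I • I.twistedD)

/-- The Dolbeault differential corresponds to the part of type `(0,1)` of the bracket. -/
theorem delbar_eq : I.delbar = ceDifferential I.bracket01 := by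
  refine antideriv_unique _ _ (fun α => ?_) (fun x y => ?_)
  · have h1 : I.twistedD (ExteriorAlgebra.ι ℂ α) =
        twoForm (((bracketMap (ℂ ⊗[ℝ] g)).compr₂ (α ∘ₗ I.J)).compl₁₂ (-I.J) (-I.J)) := by
      rw [← pullback_twoForm]
      change pullback (-I.J) (dC g (pullback I.J (ExteriorAlgebra.ι ℂ α))) = _
      rw [pullback_ι, dC, ceDifferential, antideriv_ι]
      rfl
    have h2 : dC g (ExteriorAlgebra.ι ℂ α) = twoForm ((bracketMap (ℂ ⊗[ℝ] g)).compr₂ α) :=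
      antideriv_ι _ _
    have h3 : I.bracket01.compr₂ α = (1 / 2 : ℂ) • ((bracketMap (ℂ ⊗[ℝ] g)).compr₂ α -
        Complex.I • ((bracketMap (ℂ ⊗[ℝ] g)).compr₂ (α ∘ₗ I.J)).compl₁₂ (-I.J) (-I.J)) := by
      refine LinearMap.ext₂ fun x y => ?_
      have hb : I.bracket01 x y = (1 / 2 : ℂ) • (⁅x, y⁆ - Complex.I • I.J ⁅I.J x, I.J y⁆) := by
        have hJ : ∀ u, I.J u = Complex.I • I.P u - Complex.I • I.Q u := fun u => rfl
        have hm : ⁅I.J x, I.J y⁆ = -⁅I.P x, I.P y⁆ + (⁅I.P x, I.Q y⁆ + ⁅I.Q x, I.P y⁆) -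
            ⁅I.Q x, I.Q y⁆ := by
          change bracketMap _ (I.J x) (I.J y) = -bracketMap _ (I.P x) (I.P y) +
            (bracketMap _ (I.P x) (I.Q y) + bracketMap _ (I.Q x) (I.P y)) -
            bracketMap _ (I.Q x) (I.Q y)
          rw [hJ, hJ]
          simp only [map_sub, LinearMap.sub_apply, map_smul, LinearMap.smul_apply, smul_sub,
            smul_smul, Complex.I_mul_I]
          module
        have hxy : ⁅x, y⁆ = I.bracket10 x y + I.bracket01 x y :=
          congrArg (fun f => f x y) I.bracket_decomp
        rw [hm, hJ, hxy, bracket10_apply, bracket01_apply]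
        simp only [map_add, map_sub, map_neg, I.P_of_mem (I.g10.lie_mem (I.P_mem x) (I.P_mem y)),
          I.Q_eq_zero (I.g10.lie_mem (I.P_mem x) (I.P_mem y)),
          I.P_eq_zero (I.g01.lie_mem (I.Q_mem x) (I.Q_mem y)),
          I.Q_of_mem (I.g01.lie_mem (I.Q_mem x) (I.Q_mem y)), smul_sub, smul_add, smul_smul,
          Complex.I_mul_I, smul_neg, smul_zero]
        module
      change α (I.bracket01 x y) = (1 / 2 : ℂ) * (α ⁅x, y⁆ -
        Complex.I * α (I.J ⁅-I.J x, -I.J y⁆))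
      rw [hb, map_smul, map_sub, map_smul, neg_lie, lie_neg, neg_neg]
      simp
    change (1 / 2 : ℂ) • (dC g (ExteriorAlgebra.ι ℂ α) -
      Complex.I • I.twistedD (ExteriorAlgebra.ι ℂ α)) = (twoForm (I.bracket01.compr₂ α) : _)
    rw [h3, h1, h2, map_smul, map_sub, map_smul]
    rfl
  · have hd : ∀ x y, dC g (x * y) = dC g x * y + signAut _ x * dC g y := antideriv_mul _
    have hc : I.twistedD (x * y) = I.twistedD x * y + signAut _ x * I.twistedD y := by
      change I.formAct (dC g (I.formActInv (x * y))) = I.formAct (dC g (I.formActInv x)) * y +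
        signAut _ x * I.formAct (dC g (I.formActInv y))
      rw [map_mul, hd, map_add, map_mul, map_mul, formAct_formActInv, formActInv,
        signAut_pullback, ← formActInv, formAct_formActInv]
    change (1 / 2 : ℂ) • (dC g (x * y) - Complex.I • I.twistedD (x * y)) =
      (1 / 2 : ℂ) • (dC g x - Complex.I • I.twistedD x) * y +
      signAut _ x * (1 / 2 : ℂ) • (dC g y - Complex.I • I.twistedD y)
    rw [hd, hc]
    simp only [smul_mul_assoc, mul_smul_comm, sub_mul, mul_sub]
    module

/-- The Dolbeault differential graded algebra `(Λ^{*,*} 𝔤*, ∂̄)`, graded by total degree. -/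
def dolbeault : DGAlgebra.{u} ℂ where
  carrier := ComplexForms g
  gr i := ⋀[ℂ]^i (Module.Dual ℂ (ℂ ⊗[ℝ] g))
  graded := inferInstance
  graded_comm := exterior_graded_comm
  d := I.delbar
  d_mem hx := by rw [delbar_eq]; exact antideriv_mem _ hx
  d_d x := by
    rw [delbar_eq]; exact ceDifferential_sq _ I.bracket01_self I.bracket01_jacobi x
  leibniz hx y := by
    rw [delbar_eq, ceDifferential, antideriv_mul, signAut_apply hx, mul_assoc]

theorem twoForm_mem (b : (ℂ ⊗[ℝ] g) →ₗ[ℂ] (ℂ ⊗[ℝ] g) →ₗ[ℂ] ℂ) (S T : (ℂ ⊗[ℝ] g) →ₗ[ℂ] (ℂ ⊗[ℝ] g))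
    (A B : Submodule ℂ (Module.Dual ℂ (ℂ ⊗[ℝ] g))) (hS : ∀ α : Module.Dual ℂ (ℂ ⊗[ℝ] g), α ∘ₗ S ∈ A)
    (hT : ∀ α : Module.Dual ℂ (ℂ ⊗[ℝ] g), α ∘ₗ T ∈ B) :
    (twoForm (b.compl₁₂ S T) : ComplexForms g) ∈
      A.map (ExteriorAlgebra.ι ℂ) * B.map (ExteriorAlgebra.ι ℂ) := by
  rw [twoForm_comp]
  exact Submodule.smul_mem _ _ (Submodule.sum_mem _ fun i _ => Submodule.sum_mem _ fun j _ =>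
    Submodule.smul_mem _ _ (Submodule.mul_mem_mul ⟨_, hS _, rfl⟩ ⟨_, hT _, rfl⟩))

theorem twoForm_PP (b : (ℂ ⊗[ℝ] g) →ₗ[ℂ] (ℂ ⊗[ℝ] g) →ₗ[ℂ] ℂ) :
    (twoForm (b.compl₁₂ I.P I.P) : ComplexForms g) ∈ I.forms 2 0 := by
  simpa [forms, pow_two] using twoForm_mem b _ _ _ _ I.comp_P_mem I.comp_P_mem

theorem twoForm_QQ (b : (ℂ ⊗[ℝ] g) →ₗ[ℂ] (ℂ ⊗[ℝ] g) →ₗ[ℂ] ℂ) :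
    (twoForm (b.compl₁₂ I.Q I.Q) : ComplexForms g) ∈ I.forms 0 2 := by
  simpa [forms, pow_two] using twoForm_mem b _ _ _ _ I.comp_Q_mem I.comp_Q_mem

theorem twoForm_PQ (b : (ℂ ⊗[ℝ] g) →ₗ[ℂ] (ℂ ⊗[ℝ] g) →ₗ[ℂ] ℂ) :
    (twoForm (b.compl₁₂ I.P I.Q) : ComplexForms g) ∈ I.forms 1 1 := by
  simpa [forms] using twoForm_mem b _ _ _ _ I.comp_P_mem I.comp_Q_mem

theorem twoForm_QP (b : (ℂ ⊗[ℝ] g) →ₗ[ℂ] (ℂ ⊗[ℝ] g) →ₗ[ℂ] ℂ) :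
    (twoForm (b.compl₁₂ I.Q I.P) : ComplexForms g) ∈ I.forms 1 1 := by
  have h := twoForm_mem b _ _ _ _ I.comp_Q_mem I.comp_P_mem
  rw [← I.covectors_comm.eq] at h
  simpa [forms] using h

/-- The Dolbeault differential has Hodge type `(0,1)`. -/
theorem delbar_mem {p q : ℕ} {x : ComplexForms g} (hx : x ∈ I.forms p q) :
    I.delbar x ∈ I.forms p (q + 1) := by
  rw [delbar_eq]
  refine I.antideriv_forms (dualBracket I.bracket01) 0 1 (fun α hα => ?_) (fun α hα => ?_) hx
  · have e : I.bracket01.compr₂ α = ((bracketMap (ℂ ⊗[ℝ] g)).compr₂ (α ∘ₗ I.P)).compl₁₂ I.P I.Q +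
        ((bracketMap (ℂ ⊗[ℝ] g)).compr₂ (α ∘ₗ I.P)).compl₁₂ I.Q I.P := by
      refine LinearMap.ext₂ fun x y => ?_
      change α (I.bracket01 x y) = α (I.P ⁅I.P x, I.Q y⁆) + α (I.P ⁅I.Q x, I.P y⁆)
      rw [bracket01_apply, map_add, map_add, (Submodule.mem_dualAnnihilator α).1 hα _
        (I.g01.lie_mem (I.Q_mem x) (I.Q_mem y)), zero_add]
    change (twoForm (I.bracket01.compr₂ α) : ComplexForms g) ∈ I.forms 1 1
    rw [e, map_add]
    exact Submodule.add_mem _ (I.twoForm_PQ _) (I.twoForm_QP _)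
  · have e : I.bracket01.compr₂ α = ((bracketMap (ℂ ⊗[ℝ] g)).compr₂ α).compl₁₂ I.Q I.Q := by
      refine LinearMap.ext₂ fun x y => ?_
      change α (I.bracket01 x y) = α ⁅I.Q x, I.Q y⁆
      rw [bracket01_apply, map_add, map_add, (Submodule.mem_dualAnnihilator α).1 hα _ (I.P_mem _),
        (Submodule.mem_dualAnnihilator α).1 hα _ (I.P_mem _), add_zero, add_zero]
    change (twoForm (I.bracket01.compr₂ α) : ComplexForms g) ∈ I.forms 0 2
    rw [e]
    exact I.twoForm_QQ _

/-- The remaining part `∂ = d - ∂̄` of the Chevalley-Eilenberg differential has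
Hodge type `(1,0)`. -/
theorem del_mem {p q : ℕ} {x : ComplexForms g} (hx : x ∈ I.forms p q) :
    dC g x - I.delbar x ∈ I.forms (p + 1) q := by
  have hd : dC g x - I.delbar x = antideriv (dualBracket I.bracket10) x := by
    have h : dC g - I.delbar = antideriv (dualBracket I.bracket10) := by
      rw [delbar_eq]
      refine antideriv_unique _ _ (fun α => ?_) (fun x y => ?_)
      · have e : (bracketMap (ℂ ⊗[ℝ] g)).compr₂ α = I.bracket10.compr₂ α + I.bracket01.compr₂ α := by
          rw [I.bracket_decomp]
          exact LinearMap.ext₂ fun x y => map_add α _ _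
        rw [LinearMap.sub_apply, dC, ceDifferential, ceDifferential, antideriv_ι, antideriv_ι]
        change (twoForm ((bracketMap (ℂ ⊗[ℝ] g)).compr₂ α) : ComplexForms g) -
          (twoForm (I.bracket01.compr₂ α) : ComplexForms g) = twoForm (I.bracket10.compr₂ α)
        rw [e, map_add]
        exact add_sub_cancel_right _ _
      · simp only [LinearMap.sub_apply, dC, ceDifferential, antideriv_mul, sub_mul, mul_sub]
        abel
    rw [← h]
    rfl
  rw [hd]
  refine I.antideriv_forms (dualBracket I.bracket10) 1 0 (fun α hα => ?_) (fun α hα => ?_) hx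
  · have e : I.bracket10.compr₂ α = ((bracketMap (ℂ ⊗[ℝ] g)).compr₂ α).compl₁₂ I.P I.P := by
      refine LinearMap.ext₂ fun x y => ?_
      change α (I.bracket10 x y) = α ⁅I.P x, I.P y⁆
      rw [bracket10_apply, map_add, map_add, (Submodule.mem_dualAnnihilator α).1 hα _ (I.Q_mem _),
        (Submodule.mem_dualAnnihilator α).1 hα _ (I.Q_mem _), add_zero, add_zero]
    change (twoForm (I.bracket10.compr₂ α) : ComplexForms g) ∈ I.forms 2 0
    rw [e]
    exact I.twoForm_PP _
  · have e : I.bracket10.compr₂ α = ((bracketMap (ℂ ⊗[ℝ] g)).compr₂ (α ∘ₗ I.Q)).compl₁₂ I.P I.Q +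
        ((bracketMap (ℂ ⊗[ℝ] g)).compr₂ (α ∘ₗ I.Q)).compl₁₂ I.Q I.P := by
      refine LinearMap.ext₂ fun x y => ?_
      change α (I.bracket10 x y) = α (I.Q ⁅I.P x, I.Q y⁆) + α (I.Q ⁅I.Q x, I.P y⁆)
      rw [bracket10_apply, map_add, map_add, (Submodule.mem_dualAnnihilator α).1 hα _
        (I.g10.lie_mem (I.P_mem x) (I.P_mem y)), zero_add]
    change (twoForm (I.bracket10.compr₂ α) : ComplexForms g) ∈ I.forms 1 1
    rw [e, map_add]
    exact Submodule.add_mem _ (I.twoForm_PQ _) (I.twoForm_QP _)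

theorem zeroForms_homogeneous (i : ℕ) {x : ComplexForms g} (hx : x ∈ I.zeroForms) :
    I.dolbeault.proj i x ∈ I.zeroForms := by
  have h : (⨆ q, I.forms 0 q) ≤
      (Subalgebra.toSubmodule I.zeroForms).comap (I.dolbeault.proj i) := by
    refine iSup_le fun q y hy => ?_
    have hgr : y ∈ I.dolbeault.gr q := by
      have := I.forms_le 0 q hy
      rwa [zero_add] at this
    have hy' : y ∈ I.zeroForms := by
      rw [← Subalgebra.mem_toSubmodule, zeroForms_eq]
      exact Submodule.mem_iSup_of_mem q hy
    rcases eq_or_ne q i with rfl | hne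
    · change I.dolbeault.proj q y ∈ Subalgebra.toSubmodule I.zeroForms
      rw [I.dolbeault.proj_same hgr]
      exact hy'
    · change I.dolbeault.proj i y ∈ Subalgebra.toSubmodule I.zeroForms
      rw [I.dolbeault.proj_ne hgr hne]
      exact I.zeroForms.zero_mem
  exact h (I.zeroForms_eq ▸ hx)

theorem zeroForms_delbar {x : ComplexForms g} (hx : x ∈ I.zeroForms) :
    I.delbar x ∈ I.zeroForms := by
  have h : (⨆ q, I.forms 0 q) ≤ (Subalgebra.toSubmodule I.zeroForms).comap I.delbar := by
    refine iSup_le fun q y hy => ?_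
    rw [Submodule.mem_comap, zeroForms_eq]
    exact Submodule.mem_iSup_of_mem (q + 1) (I.delbar_mem hy)
  exact h (I.zeroForms_eq ▸ hx)

/-- The differential graded algebra `(Λ^{0,*} 𝔤*, ∂̄)`. -/
def dolbeaultZero : DGAlgebra.{u} ℂ :=
  I.dolbeault.sub I.zeroForms (fun i _ hx => I.zeroForms_homogeneous i hx)
    (fun _ hx => I.zeroForms_delbar hx)

end LieComplexStructure

end ComplexStructure

end

/-!
The Dolbeault algebra is the Chevalley-Eilenberg algebra of `𝔤_ℂ` with the part `bracket01` of type
`(0,1)` of its bracket, that is, of the semidirect product of `𝔤^{0,1}` with the abelian ideal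
`𝔤^{1,0} = 𝔤_ℂ / 𝔤^{0,1}`, and `Λ^{0,*}` is the Chevalley-Eilenberg algebra of `𝔤^{0,1}`. Both Lie
algebras are nilpotent, so the statement follows from Hasegawa's theorem: the Chevalley-Eilenberg
algebra of a nilpotent Lie algebra is formal only if its differential vanishes. For the first part,
conjugation shows that `bracket01` vanishes only if the whole bracket does
(`LieComplexStructure.bracket01_eq_zero_iff`).

By nilpotency, covectors have a basis `e` for which `d (e k)` is a form in the `e i` with `i < k`
(`exists_triangular_basis`). This has two consequences.

* Such an algebra `M` behaves like a cofibrant object: a quasi-isomorphism from `M` to the target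
  of a quasi-isomorphism `A → B` may be replaced by one from `M` to `A`
  (`DGAlgebra.exists_quasiIso_lift`). One lifts along the path object of `A → B`, consisting of
  pairs of an element of `A` and a polynomial path in `B` that starts at its image, generator by
  generator (`IsTriangular.exists_lift`). Hence, if `M` is formal, then the chain of
  quasi-isomorphisms may be replaced by a single one `φ : M → H(M)`.
* Top forms are not exact (`IsTriangular.topCoeff_apply`).

If the differential of some covector were nonzero, then some nonzero covector `v` would have
`φ v = 0`, because `φ` already maps the closed covectors onto the cohomology of degree one. The
product of `v` with further covectors is a nonzero top form; it is closed, not exact, and in the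
kernel of `φ`, a contradiction (`DGAlgebra.IsFormal.d_ι_eq_zero`).
-/

noncomputable section

open scoped TensorProduct DirectSum

universe u v w

/-! ### Quasi-isomorphisms -/

/-- A submodule that contains `1` and is closed under left multiplication by generators contains the
subalgebra they generate. -/
theorem mem_of_mem_adjoin_of_mul_mem {R A : Type*} [CommSemiring R] [Semiring A] [Algebra R A]
    {s : Set A} {U : Submodule R A} (one : 1 ∈ U) (mul : ∀ a ∈ s, ∀ y ∈ U, a * y ∈ U) {x : A}
    (hx : x ∈ Algebra.adjoin R s) : x ∈ U := by
  have h : ∀ y ∈ U, x * y ∈ U := by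
    induction hx using Algebra.adjoin_induction with
    | mem a ha => exact mul a ha
    | algebraMap r =>
      intro y hy
      rw [← Algebra.smul_def]
      exact U.smul_mem r hy
    | add a b _ _ ha hb =>
      intro y hy
      rw [add_mul]
      exact U.add_mem (ha y hy) (hb y hy)
    | mul a b _ _ ha hb =>
      intro y hy
      rw [mul_assoc]
      exact ha _ (hb y hy)
  simpa using h 1 one

theorem mul_le_adjoin {R A : Type*} [CommSemiring R] [Semiring A] [Algebra R A]
    (S : Submodule R A) : S * S ≤ Subalgebra.toSubmodule (Algebra.adjoin R (S : Set A)) :=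
  Submodule.mul_le.2 fun _ hx _ hy =>
    (Algebra.adjoin R (S : Set A)).mul_mem (Algebra.subset_adjoin hx) (Algebra.subset_adjoin hy)

namespace DGAlgebra

section General

variable {K : Type v} [Field K]

theorem Hom.mapH_cls {A B : DGAlgebra.{u} K} (f : Hom A B) {x : A.carrier} (hx : A.d x = 0) :
    f.mapH (A.cls ⟨x, hx⟩) =
      B.cls ⟨f.toAlgHom x, by rw [mem_cocycles, ← f.map_d, hx, map_zero]⟩ := rfl

theorem Hom.isQuasiIso_iff {A B : DGAlgebra.{u} K} (f : Hom A B) :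
    f.IsQuasiIso ↔
      (∀ x, A.d x = 0 → f.toAlgHom x ∈ LinearMap.range B.d → x ∈ LinearMap.range A.d) ∧
      (∀ y, B.d y = 0 → ∃ x, A.d x = 0 ∧ y - f.toAlgHom x ∈ LinearMap.range B.d) := by
  refine and_congr ⟨fun h x hx hfx => ?_, fun h => ?_⟩ ⟨fun h y hy => ?_, fun h => ?_⟩
  · have h0 : A.cls ⟨x, hx⟩ = 0 := by
      apply h
      rw [map_zero, f.mapH_cls hx, cls_eq_zero]
      exact hfx
    exact A.cls_eq_zero.1 h0
  · refine (injective_iff_map_eq_zero f.mapH.toAddMonoidHom).2 fun ξ hξ => ?_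
    change f.mapH ξ = 0 at hξ
    obtain ⟨⟨x, hx⟩, rfl⟩ := A.cls_surjective ξ
    rw [f.mapH_cls hx, cls_eq_zero] at hξ
    exact A.cls_eq_zero.2 (h x hx hξ)
  · obtain ⟨ξ, hξ⟩ := h (B.cls ⟨y, hy⟩)
    obtain ⟨⟨x, hx⟩, rfl⟩ := A.cls_surjective ξ
    rw [f.mapH_cls hx, eq_comm, ← sub_eq_zero, ← map_sub, cls_eq_zero] at hξ
    exact ⟨x, hx, hξ⟩
  · intro η
    obtain ⟨⟨y, hy⟩, rfl⟩ := B.cls_surjective η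
    obtain ⟨x, hx, hxy⟩ := h y hy
    refine ⟨A.cls ⟨x, hx⟩, ?_⟩
    rw [f.mapH_cls hx, eq_comm, ← sub_eq_zero, ← map_sub, cls_eq_zero]
    exact hxy

/-- A primitive of a homogeneous exact element may be chosen homogeneous. -/
theorem exists_homogeneous_primitive (A : DGAlgebra.{u} K) {i : ℕ} {x : A.carrier}
    (hx : x ∈ A.gr (i + 1)) (h : x ∈ LinearMap.range A.d) : ∃ z ∈ A.gr i, A.d z = x := by
  obtain ⟨z, rfl⟩ := h
  exact ⟨A.proj i z, A.proj_mem i z, by rw [← A.proj_d, A.proj_same hx]⟩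

theorem Hom.map_proj {A B : DGAlgebra.{u} K} (f : Hom A B) (i : ℕ) (x : A.carrier) :
    f.toAlgHom (A.proj i x) = B.proj i (f.toAlgHom x) := by
  obtain ⟨s, hs⟩ := A.mem_iSup x
  have key : ∀ j, f.toAlgHom (A.proj i (A.proj j x)) = B.proj i (f.toAlgHom (A.proj j x)) := by
    intro j
    rcases eq_or_ne j i with rfl | h
    · rw [A.proj_same (A.proj_mem _ _), B.proj_same (f.map_gr (A.proj_mem _ _))]
    · rw [A.proj_ne (A.proj_mem _ _) h, B.proj_ne (f.map_gr (A.proj_mem _ _)) h, map_zero]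
  rw [hs]
  simp only [map_sum, key]

/-- A homogeneous cocycle in the target of a quasi-isomorphism is, up to the differential of a
homogeneous element, the image of a homogeneous cocycle. -/
theorem Hom.IsQuasiIso.exists_cocycle {A B : DGAlgebra.{u} K} {f : Hom A B} (hf : f.IsQuasiIso)
    {i : ℕ} {y : B.carrier} (hy : y ∈ B.gr (i + 1)) (hd : B.d y = 0) :
    ∃ x ∈ A.gr (i + 1), A.d x = 0 ∧ ∃ c ∈ B.gr i, y = f.toAlgHom x + B.d c := by
  obtain ⟨x, hx, c, hc⟩ := (f.isQuasiIso_iff.1 hf).2 y hd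
  refine ⟨A.proj (i + 1) x, A.proj_mem _ _, A.cocycle_proj hx _, B.proj i c, B.proj_mem _ _, ?_⟩
  rw [← B.proj_d, hc, map_sub, B.proj_same hy, f.map_proj]
  abel

/-- The composition of homomorphisms of differential graded algebras. -/
def Hom.comp {A B C : DGAlgebra.{u} K} (g : Hom B C) (f : Hom A B) : Hom A C where
  toAlgHom := g.toAlgHom.comp f.toAlgHom
  map_gr hx := g.map_gr (f.map_gr hx)
  map_d x := by simp [f.map_d, g.map_d]

theorem Hom.IsQuasiIso.comp {A B C : DGAlgebra.{u} K} {g : Hom B C} {f : Hom A B}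
    (hg : g.IsQuasiIso) (hf : f.IsQuasiIso) : (g.comp f).IsQuasiIso := by
  have h : ⇑(g.comp f).mapH = g.mapH ∘ f.mapH := by
    funext ξ
    obtain ⟨x, rfl⟩ := A.cls_surjective ξ
    rfl
  rw [Hom.IsQuasiIso, h]
  exact Function.Bijective.comp hg hf

/-- If `f` is a quasi-isomorphism and `f ∘ ψ` agrees on cohomology with a quasi-isomorphism, then
`ψ` is a quasi-isomorphism. -/
theorem Hom.IsQuasiIso.of_comp {A B C : DGAlgebra.{u} K} {f : Hom B C} {φ : Hom A C}
    (hf : f.IsQuasiIso) (hφ : φ.IsQuasiIso) (ψ : Hom A B)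
    (h : ∀ x, A.d x = 0 → φ.toAlgHom x - f.toAlgHom (ψ.toAlgHom x) ∈ LinearMap.range C.d) :
    ψ.IsQuasiIso := by
  have e : ⇑φ.mapH = f.mapH ∘ ψ.mapH := by
    funext ξ
    obtain ⟨⟨x, hx⟩, rfl⟩ := A.cls_surjective ξ
    rw [← sub_eq_zero]
    exact C.cls_eq_zero.2 (h x hx)
  exact (Function.Bijective.of_comp_iff' hf _).1 (e ▸ hφ)

/-- A differential graded algebra with zero differential is formal. -/
theorem isFormal_of_d_eq_zero (A : DGAlgebra.{u} K) (h : A.d = 0) : A.IsFormal := by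
  have hz : ∀ x, A.d x = 0 := fun x => by rw [h]; rfl
  let e : A.carrier →ₐ[K] A.cocycles := (AlgHom.id K A.carrier).codRestrict A.cocycles hz
  let f : Hom A A.cohomology :=
    { toAlgHom := A.cls.comp e
      map_gr := fun {i x} hx => ⟨⟨x, hz x⟩, hx, rfl⟩
      map_d := fun x => by
        rw [hz]
        exact map_zero (A.cls.comp e) }
  refine Relation.EqvGen.rel _ _ ⟨f, f.isQuasiIso_iff.2 ⟨fun x _ hx => ?_, fun y _ => ?_⟩⟩
  · obtain ⟨w, hw⟩ := hx
    have h0 : A.cls ⟨x, hz x⟩ = 0 := hw.symm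
    exact A.cls_eq_zero.1 h0
  · obtain ⟨x, rfl⟩ := A.cls_surjective y
    exact ⟨x, x.2, 0, by rw [map_zero, eq_comm]; exact sub_self _⟩

end General

end DGAlgebra

/-! ### Polynomials with coefficients in a differential graded algebra -/

open Polynomial in
/-- The antiderivative of a polynomial that vanishes at `0`. -/
def polyIntegral : ℂ[X] →ₗ[ℂ] ℂ[X] :=
  (Polynomial.basisMonomials ℂ).constr ℂ fun n => Polynomial.monomial (n + 1) ((n + 1 : ℂ)⁻¹)

theorem polyIntegral_monomial (n : ℕ) :
    polyIntegral (Polynomial.monomial n 1) = Polynomial.monomial (n + 1) ((n + 1 : ℂ)⁻¹) := by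
  have h := (Polynomial.basisMonomials ℂ).constr_basis ℂ
    (fun n => Polynomial.monomial (n + 1) ((n + 1 : ℂ)⁻¹)) n
  rwa [Polynomial.coe_basisMonomials] at h

theorem derivative_polyIntegral (p : Polynomial ℂ) :
    Polynomial.derivative (polyIntegral p) = p := by
  have h : Polynomial.derivative (R := ℂ) ∘ₗ polyIntegral = LinearMap.id := by
    refine (Polynomial.basisMonomials ℂ).ext fun n => ?_
    have hn : (n + 1 : ℂ) ≠ 0 := by exact_mod_cast n.succ_ne_zero
    simp [polyIntegral_monomial, hn]
  exact LinearMap.congr_fun h p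

theorem polyIntegral_derivative (p : Polynomial ℂ) :
    polyIntegral (Polynomial.derivative p) = p - Polynomial.C (p.eval 0) := by
  have h : polyIntegral ∘ₗ Polynomial.derivative (R := ℂ) =
      LinearMap.id - Polynomial.CAlgHom.toLinearMap ∘ₗ (Polynomial.aeval (R := ℂ) 0).toLinearMap := by
    refine (Polynomial.basisMonomials ℂ).ext fun n => ?_
    cases n with
    | zero => simp
    | succ n =>
      have hn : (n + 1 : ℂ) ≠ 0 := by exact_mod_cast n.succ_ne_zero
      have e : Polynomial.monomial n (n + 1 : ℂ) = (n + 1 : ℂ) • Polynomial.monomial n 1 := by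
        simp [Polynomial.smul_monomial]
      have e' : Polynomial.derivative (Polynomial.monomial (n + 1) (1 : ℂ)) =
          (n + 1 : ℂ) • Polynomial.monomial n 1 := by
        rw [← e, Polynomial.derivative_monomial]
        simp
      rw [Polynomial.coe_basisMonomials, LinearMap.comp_apply, e', map_smul,
        polyIntegral_monomial, Polynomial.smul_monomial, smul_eq_mul, mul_inv_cancel₀ hn]
      simp
  simpa [Polynomial.aeval_def] using LinearMap.congr_fun h p

theorem eval_zero_polyIntegral (p : Polynomial ℂ) : (polyIntegral p).eval 0 = 0 := by
  have h : (Polynomial.aeval (R := ℂ) (0 : ℂ)).toLinearMap ∘ₗ polyIntegral = 0 := by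
    refine (Polynomial.basisMonomials ℂ).ext fun n => ?_
    simp [polyIntegral_monomial]
  simpa [Polynomial.aeval_def] using LinearMap.congr_fun h p

namespace DGAlgebra

variable (B : DGAlgebra.{u} ℂ)

/-- Polynomials in one variable `t` with coefficients in a differential graded algebra. -/
def Poly : Type u := Polynomial ℂ ⊗[ℂ] B.carrier

instance : Ring B.Poly := inferInstanceAs (Ring (Polynomial ℂ ⊗[ℂ] B.carrier))
instance : Algebra ℂ B.Poly := inferInstanceAs (Algebra ℂ (Polynomial ℂ ⊗[ℂ] B.carrier))

/-- The polynomial `p * b` with `p` a scalar polynomial and `b` a coefficient. -/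
def polyMk : Polynomial ℂ →ₗ[ℂ] B.carrier →ₗ[ℂ] B.Poly :=
  TensorProduct.mk ℂ (Polynomial ℂ) B.carrier

/-- The differential of `B`, applied to the coefficients of a polynomial. -/
def polyD : B.Poly →ₗ[ℂ] B.Poly := LinearMap.lTensor (Polynomial ℂ) B.d

/-- The derivative with respect to the variable `t`. -/
def polyDeriv : B.Poly →ₗ[ℂ] B.Poly := LinearMap.rTensor B.carrier Polynomial.derivative

/-- The integral from `0` to `t`. -/
def polyInt : B.Poly →ₗ[ℂ] B.Poly := LinearMap.rTensor B.carrier polyIntegral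

/-- The value of a polynomial at `t = r`. -/
def polyEval (r : ℂ) : B.Poly →ₐ[ℂ] B.carrier :=
  (Algebra.TensorProduct.lid ℂ B.carrier).toAlgHom.comp
    (Algebra.TensorProduct.map (Polynomial.aeval r) (AlgHom.id ℂ B.carrier))

/-- The constant polynomial. -/
def polyConst : B.carrier →ₗ[ℂ] B.Poly := B.polyMk 1

/-- The polynomials whose coefficients are homogeneous of degree `i`. -/
def polyGr (i : ℕ) : Submodule ℂ B.Poly :=
  Submodule.span ℂ {z | ∃ p : Polynomial ℂ, ∃ b ∈ B.gr i, B.polyMk p b = z}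

variable {B}

@[elab_as_elim]
theorem poly_induction {C : B.Poly → Prop} (x : B.Poly) (zero : C 0)
    (mk : ∀ p b, C (B.polyMk p b)) (add : ∀ x y, C x → C y → C (x + y)) : C x :=
  TensorProduct.induction_on (motive := C) x zero mk add

@[simp] theorem polyMk_mul (p q : Polynomial ℂ) (a b : B.carrier) :
    B.polyMk p a * B.polyMk q b = B.polyMk (p * q) (a * b) :=
  Algebra.TensorProduct.tmul_mul_tmul p q a b

@[simp] theorem polyD_mk (p : Polynomial ℂ) (b : B.carrier) :
    B.polyD (B.polyMk p b) = B.polyMk p (B.d b) := rfl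

@[simp] theorem polyDeriv_mk (p : Polynomial ℂ) (b : B.carrier) :
    B.polyDeriv (B.polyMk p b) = B.polyMk (Polynomial.derivative p) b := rfl

@[simp] theorem polyInt_mk (p : Polynomial ℂ) (b : B.carrier) :
    B.polyInt (B.polyMk p b) = B.polyMk (polyIntegral p) b := rfl

@[simp] theorem polyEval_mk (r : ℂ) (p : Polynomial ℂ) (b : B.carrier) :
    B.polyEval r (B.polyMk p b) = p.eval r • b := by
  change Polynomial.aeval r p • b = _
  rw [Polynomial.coe_aeval_eq_eval]

theorem polyD_polyConst (b : B.carrier) : B.polyD (B.polyConst b) = B.polyConst (B.d b) := rfl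

theorem polyDeriv_polyConst (b : B.carrier) : B.polyDeriv (B.polyConst b) = 0 := by
  simp [polyConst]

theorem polyEval_polyConst (r : ℂ) (b : B.carrier) : B.polyEval r (B.polyConst b) = b := by
  simp [polyConst]

theorem polyMk_mem {i : ℕ} (p : Polynomial ℂ) {b : B.carrier} (hb : b ∈ B.gr i) :
    B.polyMk p b ∈ B.polyGr i := Submodule.subset_span ⟨p, b, hb, rfl⟩

theorem polyConst_mem {i : ℕ} {b : B.carrier} (hb : b ∈ B.gr i) : B.polyConst b ∈ B.polyGr i :=
  polyMk_mem 1 hb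

theorem polyDeriv_polyInt (x : B.Poly) : B.polyDeriv (B.polyInt x) = x := by
  induction x using poly_induction with
  | zero => simp
  | mk p b => simp [derivative_polyIntegral]
  | add x y hx hy => rw [map_add, map_add, hx, hy]

theorem polyInt_polyDeriv (x : B.Poly) :
    B.polyInt (B.polyDeriv x) = x - B.polyConst (B.polyEval 0 x) := by
  induction x using poly_induction with
  | zero => simp
  | mk p b =>
    have e : (Polynomial.C (p.eval 0) : Polynomial ℂ) = p.eval 0 • 1 := by
      rw [Polynomial.smul_eq_C_mul, mul_one]
    rw [polyDeriv_mk, polyInt_mk, polyIntegral_derivative, polyEval_mk, map_smul, e, map_sub,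
      map_smul]
    rfl
  | add x y hx hy => rw [map_add, map_add, hx, hy, map_add, map_add]; abel

theorem polyEval_zero_polyInt (x : B.Poly) : B.polyEval 0 (B.polyInt x) = 0 := by
  induction x using poly_induction with
  | zero => simp
  | mk p b => simp [eval_zero_polyIntegral]
  | add x y hx hy => rw [map_add, map_add, hx, hy, add_zero]

theorem polyD_polyInt (x : B.Poly) : B.polyD (B.polyInt x) = B.polyInt (B.polyD x) := by
  induction x using poly_induction with
  | zero => simp
  | mk p b => simp
  | add x y hx hy => simp only [map_add, hx, hy]

theorem polyEval_polyD (r : ℂ) (x : B.Poly) : B.polyEval r (B.polyD x) = B.d (B.polyEval r x) := by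
  induction x using poly_induction with
  | zero => simp
  | mk p b => simp
  | add x y hx hy => simp only [map_add, hx, hy]

/-- The fundamental theorem of calculus. -/
theorem polyEval_one_sub_polyEval_zero (x : B.Poly) :
    B.polyEval 1 x - B.polyEval 0 x = B.polyEval 1 (B.polyInt (B.polyDeriv x)) := by
  rw [polyInt_polyDeriv, map_sub, polyEval_polyConst]

theorem polyInt_mem {i : ℕ} {x : B.Poly} (hx : x ∈ B.polyGr i) : B.polyInt x ∈ B.polyGr i := by
  have h : B.polyGr i ≤ (B.polyGr i).comap B.polyInt := by
    refine Submodule.span_le.2 ?_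
    rintro _ ⟨p, b, hb, rfl⟩
    exact polyMk_mem _ hb
  exact h hx

theorem polyEval_mem (r : ℂ) {i : ℕ} {x : B.Poly} (hx : x ∈ B.polyGr i) :
    B.polyEval r x ∈ B.gr i := by
  have h : B.polyGr i ≤ (B.gr i).comap (B.polyEval r).toLinearMap := by
    refine Submodule.span_le.2 ?_
    rintro _ ⟨p, b, hb, rfl⟩
    have h := (B.gr i).smul_mem (p.eval r) hb
    rwa [← polyEval_mk] at h
  exact h hx

theorem polyGr_induction₂ {i j : ℕ} {C : B.Poly → B.Poly → Prop}
    (mk : ∀ p q : Polynomial ℂ, ∀ a ∈ B.gr i, ∀ b ∈ B.gr j, C (B.polyMk p a) (B.polyMk q b))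
    (zero_left : ∀ y, C 0 y) (zero_right : ∀ x, C x 0)
    (add_left : ∀ x x' y, C x y → C x' y → C (x + x') y)
    (add_right : ∀ x y y', C x y → C x y' → C x (y + y'))
    (smul_left : ∀ (r : ℂ) x y, C x y → C (r • x) y)
    (smul_right : ∀ (r : ℂ) x y, C x y → C x (r • y))
    {x y : B.Poly} (hx : x ∈ B.polyGr i) (hy : y ∈ B.polyGr j) : C x y := by
  induction hx, hy using Submodule.span_induction₂ with
  | mem_mem x y hx hy =>
    obtain ⟨p, a, ha, rfl⟩ := hx
    obtain ⟨q, b, hb, rfl⟩ := hy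
    exact mk p q a ha b hb
  | zero_left y hy => exact zero_left y
  | zero_right x hx => exact zero_right x
  | add_left x y z hx hy hz h1 h2 => exact add_left _ _ _ h1 h2
  | add_right x y z hx hy hz h1 h2 => exact add_right _ _ _ h1 h2
  | smul_left r x y hx hy h => exact smul_left _ _ _ h
  | smul_right r x y hx hy h => exact smul_right _ _ _ h

theorem polyGr_mul_mem {i j : ℕ} {x y : B.Poly} (hx : x ∈ B.polyGr i) (hy : y ∈ B.polyGr j) :
    x * y ∈ B.polyGr (i + j) := by
  refine polyGr_induction₂ (C := fun x y => x * y ∈ B.polyGr (i + j)) (fun p q a ha b hb => ?_)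
    ?_ ?_ ?_ ?_ ?_ ?_ hx hy
  · rw [polyMk_mul]
    exact polyMk_mem _ (SetLike.GradedMul.mul_mem (A := B.gr) ha hb)
  · intro y; simp
  · intro x; simp
  · intro x x' y h h'; rw [add_mul]; exact Submodule.add_mem _ h h'
  · intro x x' y h h'; rw [mul_add]; exact Submodule.add_mem _ h h'
  · intro r x y h; rw [smul_mul_assoc]; exact Submodule.smul_mem _ _ h
  · intro r x y h; rw [mul_smul_comm]; exact Submodule.smul_mem _ _ h

theorem poly_graded_comm {i j : ℕ} {x y : B.Poly} (hx : x ∈ B.polyGr i) (hy : y ∈ B.polyGr j) :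
    x * y = (-1) ^ (i * j) * (y * x) := by
  have hc : ∀ (r : ℂ) (z : B.Poly), (-1) ^ (i * j) * (r • z) = r • ((-1) ^ (i * j) * z) :=
    fun r z => mul_smul_comm _ _ _
  refine polyGr_induction₂ (C := fun x y => x * y = (-1) ^ (i * j) * (y * x))
    (fun p q a ha b hb => ?_) ?_ ?_ ?_ ?_ ?_ ?_ hx hy
  · rw [polyMk_mul, polyMk_mul, B.graded_comm ha hb, mul_comm p q]
    rcases Nat.even_or_odd (i * j) with h | h <;> simp [h.neg_one_pow]
  · intro y; simp
  · intro x; simp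
  · intro x x' y h h'; rw [add_mul, h, h', mul_add, mul_add]
  · intro x x' y h h'; rw [mul_add, h, h', add_mul, mul_add]
  · intro r x y h; rw [smul_mul_assoc, h, mul_smul_comm, hc]
  · intro r x y h; rw [mul_smul_comm, h, smul_mul_assoc, hc]

theorem poly_mul_self {x : B.Poly} (hx : x ∈ B.polyGr 1) : x * x = 0 := by
  have h := poly_graded_comm hx hx
  have h2 : (2 : ℂ) • (x * x) = 0 := by
    rw [two_smul]
    nth_rewrite 1 [h]
    simp
  exact (smul_eq_zero.1 h2).resolve_left two_ne_zero

theorem mul_self_of_mem (A : DGAlgebra.{u} ℂ) {x : A.carrier} (hx : x ∈ A.gr 1) : x * x = 0 := by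
  have h := A.graded_comm hx hx
  have h2 : (2 : ℂ) • (x * x) = 0 := by
    rw [two_smul]
    nth_rewrite 1 [h]
    simp
  exact (smul_eq_zero.1 h2).resolve_left two_ne_zero

theorem polyDeriv_mul (x y : B.Poly) :
    B.polyDeriv (x * y) = B.polyDeriv x * y + x * B.polyDeriv y := by
  induction x using poly_induction with
  | zero => simp
  | add x x' h h' => simp only [map_add, add_mul, h, h']; abel
  | mk p a =>
    induction y using poly_induction with
    | zero => simp
    | add y y' h h' => simp only [map_add, mul_add, h, h']; abel
    | mk q b => simp [Polynomial.derivative_mul]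

theorem polyD_mul {i : ℕ} {x : B.Poly} (hx : x ∈ B.polyGr i) (y : B.Poly) :
    B.polyD (x * y) = B.polyD x * y + (-1) ^ i * (x * B.polyD y) := by
  induction hx using Submodule.span_induction with
  | zero => simp
  | add x x' _ _ h h' => simp only [map_add, add_mul, mul_add, h, h']; abel
  | smul r x _ h => rw [smul_mul_assoc, map_smul, map_smul, h, smul_add, smul_mul_assoc,
      smul_mul_assoc, mul_smul_comm]
  | mem x hx =>
    obtain ⟨p, a, ha, rfl⟩ := hx
    induction y using poly_induction with
    | zero => simp
    | add y y' h h' => simp only [map_add, mul_add, mul_add, h, h']; abel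
    | mk q b =>
      simp only [polyMk_mul, polyD_mk, B.leibniz ha, map_add]
      rcases Nat.even_or_odd i with h | h <;> simp [h.neg_one_pow]

end DGAlgebra

/-! ### Exterior algebras with triangular differential -/

section Triangular

variable {W : Type w} [AddCommGroup W] [Module ℂ W] {n : ℕ}

/-- The subalgebra of the exterior algebra generated by the first `k` vectors of a family. -/
def flagAlgebra (e : Fin n → W) (k : ℕ) : Subalgebra ℂ (ExteriorAlgebra ℂ W) :=
  Algebra.adjoin ℂ {x | ∃ i : Fin n, (i : ℕ) < k ∧ ExteriorAlgebra.ι ℂ (e i) = x}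

theorem ι_mem_flagAlgebra (e : Fin n → W) {k : ℕ} {i : Fin n} (h : (i : ℕ) < k) :
    ExteriorAlgebra.ι ℂ (e i) ∈ flagAlgebra e k := Algebra.subset_adjoin ⟨i, h, rfl⟩

theorem flagAlgebra_mono (e : Fin n → W) {k l : ℕ} (h : k ≤ l) :
    flagAlgebra e k ≤ flagAlgebra e l :=
  Algebra.adjoin_mono fun _ ⟨i, hi, hx⟩ => ⟨i, hi.trans_le h, hx⟩

/-- A differential on an exterior algebra which is triangular with respect to a basis: the
differential of each basis vector only involves the preceding ones. -/
structure IsTriangular (e : Module.Basis (Fin n) ℂ W)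
    (δ : ExteriorAlgebra ℂ W →ₗ[ℂ] ExteriorAlgebra ℂ W) : Prop where
  leibniz : ∀ x y, δ (x * y) = δ x * y + signAut W x * δ y
  sq : ∀ x, δ (δ x) = 0
  ι_mem : ∀ v, δ (ExteriorAlgebra.ι ℂ v) ∈ ⋀[ℂ]^2 W
  mem_flag : ∀ k : Fin n, δ (ExteriorAlgebra.ι ℂ (e k)) ∈ flagAlgebra e k

theorem IsTriangular.one {e : Module.Basis (Fin n) ℂ W}
    {δ : ExteriorAlgebra ℂ W →ₗ[ℂ] ExteriorAlgebra ℂ W} (h : IsTriangular e δ) : δ 1 = 0 := by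
  simpa using h.leibniz 1 1

theorem IsTriangular.ι_mul {e : Module.Basis (Fin n) ℂ W}
    {δ : ExteriorAlgebra ℂ W →ₗ[ℂ] ExteriorAlgebra ℂ W} (h : IsTriangular e δ) (v : W)
    (y : ExteriorAlgebra ℂ W) : δ (ExteriorAlgebra.ι ℂ v * y) =
      δ (ExteriorAlgebra.ι ℂ v) * y - ExteriorAlgebra.ι ℂ v * δ y := by
  rw [h.leibniz, signAut_ι, neg_mul, sub_eq_add_neg]

theorem flagAlgebra_eq_top (e : Module.Basis (Fin n) ℂ W) : flagAlgebra e n = ⊤ := by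
  rw [eq_top_iff]
  intro x _
  induction x using ExteriorAlgebra.induction with
  | algebraMap r => exact Subalgebra.algebraMap_mem _ r
  | ι v =>
    rw [← e.sum_repr v, map_sum]
    refine Subalgebra.sum_mem _ fun i _ => ?_
    rw [map_smul]
    exact Subalgebra.smul_mem _ (ι_mem_flagAlgebra e i.2) _
  | mul x y hx hy => exact Subalgebra.mul_mem _ (hx trivial) (hy trivial)
  | add x y hx hy => exact Subalgebra.add_mem _ (hx trivial) (hy trivial)

variable {P B : Type*} [Ring P] [Algebra ℂ P] [Ring B] [Algebra ℂ B]

/-- Obstruction theory: a homomorphism from an exterior algebra with triangular differential may be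
lifted along `F` generator by generator, if closed elements of degree two in `P` that become exact
in `B` have primitives with prescribed image. The map `F` only has to be multiplicative with
respect to left factors of degree one. -/
theorem IsTriangular.exists_lift {e : Module.Basis (Fin n) ℂ W}
    {δ : ExteriorAlgebra ℂ W →ₗ[ℂ] ExteriorAlgebra ℂ W} (h : IsTriangular e δ)
    (P1 P2 : Submodule ℂ P) (D : P →ₗ[ℂ] P) (F : P →ₗ[ℂ] B) (dB : B →ₗ[ℂ] B)
    (B1 : Submodule ℂ B) (φ : ExteriorAlgebra ℂ W →ₐ[ℂ] B)
    (hφ1 : ∀ v, φ (ExteriorAlgebra.ι ℂ v) ∈ B1) (hφ : ∀ x, φ (δ x) = dB (φ x))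
    (hsq : ∀ x ∈ P1, x * x = 0) (hP : P1 * P1 ≤ P2)
    (hleib : ∀ x ∈ P1, ∀ y, D (x * y) = D x * y - x * D y) (hD1 : D 1 = 0) (hF1 : F 1 = 1)
    (hF : ∀ x ∈ P1, ∀ y, F (x * y) = F x * F y)
    (hlift : ∀ x ∈ P2, D x = 0 → ∀ b ∈ B1, F x = dB b → ∃ y ∈ P1, D y = x ∧ F y = b) :
    ∃ ψ : ExteriorAlgebra ℂ W →ₐ[ℂ] P, (∀ v, ψ (ExteriorAlgebra.ι ℂ v) ∈ P1) ∧
      (∀ x, ψ (δ x) = D (ψ x)) ∧ ∀ x, F (ψ x) = φ x := by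
  -- a homomorphism which is compatible on generators is compatible on the flag algebra
  have ext : ∀ (k : ℕ) (ψ : ExteriorAlgebra ℂ W →ₐ[ℂ] P),
      (∀ v, ψ (ExteriorAlgebra.ι ℂ v) ∈ P1) →
      (∀ i : Fin n, (i : ℕ) < k → ψ (δ (ExteriorAlgebra.ι ℂ (e i))) =
        D (ψ (ExteriorAlgebra.ι ℂ (e i))) ∧ F (ψ (ExteriorAlgebra.ι ℂ (e i))) =
          φ (ExteriorAlgebra.ι ℂ (e i))) →
      ∀ x ∈ flagAlgebra e k, ψ (δ x) = D (ψ x) ∧ F (ψ x) = φ x := by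
    intro k ψ hψ1 hψ x hx
    let U : Submodule ℂ (ExteriorAlgebra ℂ W) :=
      LinearMap.eqLocus (ψ.toLinearMap ∘ₗ δ) (D ∘ₗ ψ.toLinearMap) ⊓
        LinearMap.eqLocus (F ∘ₗ ψ.toLinearMap) φ.toLinearMap
    have hU : x ∈ U := by
      refine mem_of_mem_adjoin_of_mul_mem ?_ ?_ hx
      · refine ⟨?_, ?_⟩
        · change ψ (δ 1) = D (ψ 1)
          rw [h.one, map_zero, map_one, hD1]
        · change F (ψ 1) = φ 1
          rw [map_one ψ, hF1, map_one φ]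
      · rintro _ ⟨i, hi, rfl⟩ y ⟨hy1, hy2⟩
        change ψ (δ y) = D (ψ y) at hy1
        change F (ψ y) = φ y at hy2
        refine ⟨?_, ?_⟩
        · change ψ (δ (_ * y)) = D (ψ (_ * y))
          rw [h.ι_mul, map_sub, map_mul, map_mul, map_mul, hleib _ (hψ1 _), hy1, (hψ i hi).1]
        · change F (ψ (_ * y)) = φ (_ * y)
          rw [map_mul ψ, hF _ (hψ1 _), hy2, (hψ i hi).2, map_mul φ]
    exact hU
  have main : ∀ k ≤ n, ∃ ψ : ExteriorAlgebra ℂ W →ₐ[ℂ] P,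
      (∀ v, ψ (ExteriorAlgebra.ι ℂ v) ∈ P1) ∧
      ∀ i : Fin n, (i : ℕ) < k → ψ (δ (ExteriorAlgebra.ι ℂ (e i))) =
        D (ψ (ExteriorAlgebra.ι ℂ (e i))) ∧ F (ψ (ExteriorAlgebra.ι ℂ (e i))) =
          φ (ExteriorAlgebra.ι ℂ (e i)) := by
    intro k
    induction k with
    | zero =>
      intro _
      exact ⟨ExteriorAlgebra.lift ℂ ⟨0, by simp⟩, fun v => by simp, fun i hi => by omega⟩
    | succ k ih =>
      intro hk
      obtain ⟨ψ, hψ1, hψ⟩ := ih (by omega)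
      have hext := ext k ψ hψ1 hψ
      let kk : Fin n := ⟨k, hk⟩
      have h2 : ∀ x ∈ ⋀[ℂ]^2 W, ψ x ∈ P2 := by
        intro x hx
        change x ∈ LinearMap.range (ExteriorAlgebra.ι ℂ (M := W)) ^ 2 at hx
        rw [pow_two] at hx
        refine hP ?_
        induction hx using Submodule.mul_induction_on' with
        | mem_mul_mem a ha b hb =>
          obtain ⟨a, rfl⟩ := ha
          obtain ⟨b, rfl⟩ := hb
          rw [map_mul]
          exact Submodule.mul_mem_mul (hψ1 a) (hψ1 b)
        | add x _ y _ hx hy => rw [map_add]; exact Submodule.add_mem _ hx hy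
      obtain ⟨hd, hf⟩ := hext _ (h.mem_flag kk)
      obtain ⟨p, hp1, hp2, hp3⟩ := hlift (ψ (δ (ExteriorAlgebra.ι ℂ (e kk)))) (h2 _ (h.ι_mem _))
        (by rw [← hd, h.sq, map_zero]) (φ (ExteriorAlgebra.ι ℂ (e kk))) (hφ1 _)
        (by rw [hf, hφ])
      -- change the homomorphism on the basis vector of index `k` only
      let ℓ : W →ₗ[ℂ] P :=
        e.constr ℂ fun i => if i = kk then p else ψ (ExteriorAlgebra.ι ℂ (e i))
      have hℓe : ∀ i, ℓ (e i) = if i = kk then p else ψ (ExteriorAlgebra.ι ℂ (e i)) := fun i =>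
        e.constr_basis ℂ _ i
      have hℓ1 : ∀ v, ℓ v ∈ P1 := by
        intro v
        rw [← e.sum_repr v, map_sum]
        refine Submodule.sum_mem _ fun i _ => ?_
        rw [map_smul, hℓe]
        refine Submodule.smul_mem _ _ ?_
        split_ifs
        exacts [hp1, hψ1 _]
      let χ : ExteriorAlgebra ℂ W →ₐ[ℂ] P := ExteriorAlgebra.lift ℂ ⟨ℓ, fun v => hsq _ (hℓ1 v)⟩
      have hχ : ∀ v, χ (ExteriorAlgebra.ι ℂ v) = ℓ v := fun v =>
        ExteriorAlgebra.lift_ι_apply ℂ ℓ _ v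
      have hagree : ∀ x ∈ flagAlgebra e k, χ x = ψ x := by
        intro x hx
        have hle : flagAlgebra e k ≤ AlgHom.equalizer χ ψ := by
          refine Algebra.adjoin_le ?_
          rintro _ ⟨i, hi, rfl⟩
          change χ _ = ψ _
          have hne : i ≠ kk := by
            rintro rfl
            exact lt_irrefl _ hi
          rw [hχ, hℓe, if_neg hne]
        exact hle hx
      refine ⟨χ, fun v => by rw [hχ]; exact hℓ1 v, fun i hi => ?_⟩
      have hflag : δ (ExteriorAlgebra.ι ℂ (e i)) ∈ flagAlgebra e k :=
        flagAlgebra_mono e (by omega) (h.mem_flag i)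
      rw [hagree _ hflag, hχ, hℓe]
      rcases eq_or_ne i kk with rfl | hne
      · rw [if_pos rfl]
        exact ⟨hp2.symm, hp3⟩
      · rw [if_neg hne]
        refine hψ i (lt_of_le_of_ne (by omega) fun hik => hne (Fin.ext hik))
  obtain ⟨ψ, hψ1, hψ⟩ := main n le_rfl
  have hall := ext n ψ hψ1 hψ
  rw [flagAlgebra_eq_top] at hall
  exact ⟨ψ, hψ1, fun x => (hall x trivial).1, fun x => (hall x trivial).2⟩

end Triangular

/-! ### The path object -/

namespace DGAlgebra

section Path

variable {A B : DGAlgebra.{u} ℂ}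

theorem polyD_one : B.polyD 1 = 0 := by
  have h : B.polyD (B.polyConst 1) = 0 := by rw [polyD_polyConst, B.d_one, map_zero]
  exact h

theorem polyDeriv_one : B.polyDeriv 1 = 0 := polyDeriv_polyConst (B := B) 1

/-- The algebra containing the path object of a homomorphism `A → B`. A path `p + dt q` with
polynomials `p`, `q` in `t` with coefficients in `B` is encoded by the matrix `(± p, q; 0, p)`, the
sign being that of the degree of `p`, which makes the multiplication of paths that of matrices. -/
abbrev Path (A B : DGAlgebra.{u} ℂ) : Type u := A.carrier × Matrix (Fin 2) (Fin 2) B.Poly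

/-- The differential of paths: `d (p + dt q) = d p + dt (∂ p / ∂ t - d q)`, applied to each column
`(q, p)` of a matrix. -/
def pathD (A B : DGAlgebra.{u} ℂ) : Path A B →ₗ[ℂ] Path A B where
  toFun x := (A.d x.1,
    !![-B.polyD (x.2 0 0) + B.polyDeriv (x.2 1 0), -B.polyD (x.2 0 1) + B.polyDeriv (x.2 1 1);
      B.polyD (x.2 1 0), B.polyD (x.2 1 1)])
  map_add' x y := by
    refine Prod.ext (map_add _ _ _) ?_
    ext i j
    fin_cases i <;> fin_cases j <;> simp <;> abel
  map_smul' r x := by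
    refine Prod.ext (map_smul _ _ _) ?_
    ext i j
    fin_cases i <;> fin_cases j <;> simp

/-- The paths of degree one which start at the image of an element of `A`. -/
def path1 (f : Hom A B) : Submodule ℂ (Path A B) where
  carrier := {x | x.1 ∈ A.gr 1 ∧ x.2 1 1 ∈ B.polyGr 1 ∧ x.2 0 1 ∈ B.polyGr 0 ∧ x.2 1 0 = 0 ∧
    x.2 0 0 = -x.2 1 1 ∧ f.toAlgHom x.1 = B.polyEval 0 (x.2 1 1)}
  add_mem' := by
    rintro x y ⟨h1, h2, h3, h4, h5, h6⟩ ⟨k1, k2, k3, k4, k5, k6⟩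
    refine ⟨add_mem h1 k1, add_mem h2 k2, add_mem h3 k3, ?_, ?_, ?_⟩
    · simp [h4, k4]
    · simp [h5, k5, add_comm]
    · simp [h6, k6]
  zero_mem' := by simp
  smul_mem' r x := by
    rintro ⟨h1, h2, h3, h4, h5, h6⟩
    refine ⟨Submodule.smul_mem _ r h1, Submodule.smul_mem _ r h2, Submodule.smul_mem _ r h3,
      ?_, ?_, ?_⟩
    · simp [h4]
    · simp [h5]
    · simp [h6]

/-- The paths of degree two which start at the image of an element of `A`. -/
def path2 (f : Hom A B) : Submodule ℂ (Path A B) where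
  carrier := {x | x.1 ∈ A.gr 2 ∧ x.2 1 1 ∈ B.polyGr 2 ∧ x.2 0 1 ∈ B.polyGr 1 ∧ x.2 1 0 = 0 ∧
    x.2 0 0 = x.2 1 1 ∧ f.toAlgHom x.1 = B.polyEval 0 (x.2 1 1)}
  add_mem' := by
    rintro x y ⟨h1, h2, h3, h4, h5, h6⟩ ⟨k1, k2, k3, k4, k5, k6⟩
    refine ⟨add_mem h1 k1, add_mem h2 k2, add_mem h3 k3, ?_, ?_, ?_⟩
    · simp [h4, k4]
    · simp [h5, k5]
    · simp [h6, k6]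
  zero_mem' := by simp
  smul_mem' r x := by
    rintro ⟨h1, h2, h3, h4, h5, h6⟩
    refine ⟨Submodule.smul_mem _ r h1, Submodule.smul_mem _ r h2, Submodule.smul_mem _ r h3,
      ?_, ?_, ?_⟩
    · simp [h4]
    · simp [h5]
    · simp [h6]

/-- The end point of a path. -/
def pathEnd (A B : DGAlgebra.{u} ℂ) : Path A B →ₗ[ℂ] B.carrier where
  toFun x := B.polyEval 1 (x.2 1 1)
  map_add' _ _ := map_add (B.polyEval 1) _ _
  map_smul' _ _ := map_smul (B.polyEval 1) _ _

theorem mul_self_of_mem_path1 {f : Hom A B} {x : Path A B} (hx : x ∈ path1 f) : x * x = 0 := by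
  obtain ⟨h1, h2, h3, h4, h5, -⟩ := hx
  refine Prod.ext (A.mul_self_of_mem h1) ?_
  have hs := poly_mul_self h2
  have hc := poly_graded_comm h3 h2
  ext i j
  fin_cases i <;> fin_cases j <;>
    simp [Matrix.mul_apply, Fin.sum_univ_two, h4, h5, hs, hc]

theorem path1_mul_path1_le (f : Hom A B) : path1 f * path1 f ≤ path2 f := by
  rw [Submodule.mul_le]
  rintro x ⟨h1, h2, h3, h4, h5, h6⟩ y ⟨k1, k2, k3, k4, k5, k6⟩
  have e11 : (x * y).2 1 1 = x.2 1 1 * y.2 1 1 := by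
    simp [Matrix.mul_apply, Fin.sum_univ_two, h4]
  have e01 : (x * y).2 0 1 = -x.2 1 1 * y.2 0 1 + x.2 0 1 * y.2 1 1 := by
    simp [Matrix.mul_apply, Fin.sum_univ_two, h5]
  refine ⟨SetLike.GradedMul.mul_mem (A := A.gr) h1 k1, ?_, ?_, ?_, ?_, ?_⟩
  · rw [e11]
    exact polyGr_mul_mem (i := 1) (j := 1) h2 k2
  · rw [e01]
    exact add_mem (polyGr_mul_mem (i := 1) (j := 0) (neg_mem h2) k3)
      (polyGr_mul_mem (i := 0) (j := 1) h3 k2)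
  · simp [Matrix.mul_apply, Fin.sum_univ_two, h4, k4]
  · simp [Matrix.mul_apply, Fin.sum_univ_two, h4, k4, h5, k5]
  · simp [Matrix.mul_apply, Fin.sum_univ_two, h4, h6, k6]

theorem pathD_mul {f : Hom A B} {x : Path A B} (hx : x ∈ path1 f) (y : Path A B) :
    pathD A B (x * y) = pathD A B x * y - x * pathD A B y := by
  obtain ⟨h1, h2, h3, h4, h5, -⟩ := hx
  have l1 : ∀ z, B.polyD (x.2 1 1 * z) = B.polyD (x.2 1 1) * z - x.2 1 1 * B.polyD z := by
    intro z
    rw [polyD_mul h2]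
    simp [sub_eq_add_neg]
  have l0 : ∀ z, B.polyD (x.2 0 1 * z) = B.polyD (x.2 0 1) * z + x.2 0 1 * B.polyD z := by
    intro z
    rw [polyD_mul h3]
    simp
  refine Prod.ext ?_ ?_
  · change A.d (x.1 * y.1) = A.d x.1 * y.1 - x.1 * A.d y.1
    rw [A.leibniz h1]
    simp [sub_eq_add_neg]
  · ext i j
    fin_cases i <;> fin_cases j <;>
      simp [pathD, Matrix.mul_apply, Matrix.vecMul, dotProduct, Fin.sum_univ_two, h4, h5, l1, l0,
        polyDeriv_mul] <;>
      noncomm_ring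

theorem pathD_one : pathD A B 1 = 0 := by
  refine Prod.ext A.d_one ?_
  ext i j
  fin_cases i <;> fin_cases j <;> simp [pathD, polyD_one, polyDeriv_one]

/-- A closed path of degree two whose end point is exact is the differential of a path with
prescribed end point, if it starts in the image of a quasi-isomorphism. -/
theorem exists_path_primitive {f : Hom A B} (hf : f.IsQuasiIso) {x : Path A B} (hx : x ∈ path2 f)
    (hd : pathD A B x = 0) {b : B.carrier} (hb : b ∈ B.gr 1) (hxb : pathEnd A B x = B.d b) :
    ∃ y ∈ path1 f, pathD A B y = x ∧ pathEnd A B y = b := by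
  obtain ⟨h1, h2, h3, h4, h5, h6⟩ := hx
  set w := x.2 1 1 with hw
  set s := x.2 0 1 with hs
  have hda : A.d x.1 = 0 := congrArg Prod.fst hd
  have hdw : B.polyD w = 0 := congrFun (congrFun (congrArg Prod.snd hd) 1) 1
  have hds : B.polyD s = B.polyDeriv w := by
    have h : -B.polyD s + B.polyDeriv w = 0 := congrFun (congrFun (congrArg Prod.snd hd) 0) 1
    rwa [neg_add_eq_zero] at h
  have hw1 : B.polyEval 1 w = B.d b := hxb
  have hftc : B.polyEval 1 w - B.polyEval 0 w = B.d (B.polyEval 1 (B.polyInt s)) := by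
    rw [polyEval_one_sub_polyEval_zero, ← hds, ← polyD_polyInt, polyEval_polyD]
  -- the starting point is exact in `B`, hence in `A`
  obtain ⟨a₁, ha₁, hda₁⟩ := A.exists_homogeneous_primitive h1
    ((f.isQuasiIso_iff.1 hf).1 _ hda ⟨b - B.polyEval 1 (B.polyInt s), by
      rw [map_sub, ← hftc, ← hw1, h6]; abel⟩)
  -- the failure of the end point to be `b` is closed
  obtain ⟨z, hz, hdz, c, hc, hzc⟩ := hf.exists_cocycle
    (y := b - B.polyEval 1 (B.polyInt s) - f.toAlgHom a₁)
    (sub_mem (sub_mem hb (polyEval_mem 1 (polyInt_mem h3))) (f.map_gr ha₁)) (by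
      rw [map_sub, map_sub, ← hftc, ← hw1, ← f.map_d, hda₁, h6]; abel)
  -- the path `r + dt c` starts at the image of `a₁ + z` and ends at `b`; its velocity is forced by
  -- the `dt`-component of its differential, which is to be `s`
  let r : B.Poly := B.polyConst (f.toAlgHom (a₁ + z)) + B.polyInt (s + B.polyConst (B.d c))
  have hr0 : B.polyEval 0 r = f.toAlgHom (a₁ + z) := by
    rw [map_add, polyEval_polyConst, polyEval_zero_polyInt, add_zero]
  have hint : B.polyEval 1 (B.polyInt (B.polyConst (B.d c))) = B.d c := by
    have h := polyIntegral_monomial 0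
    simp only [polyConst, polyInt_mk, polyEval_mk]
    rw [show (1 : Polynomial ℂ) = Polynomial.monomial 0 1 from rfl, h]
    simp
  have hr1 : B.polyEval 1 r = b := by
    rw [map_add, polyEval_polyConst, map_add, map_add, map_add, hint]
    have h := hzc
    rw [sub_sub, sub_eq_iff_eq_add] at h
    rw [h]
    abel
  have hdr : B.polyD r = w := by
    rw [map_add, polyD_polyConst, ← f.map_d, map_add, hda₁, hdz, add_zero, h6, polyD_polyInt,
      map_add, polyD_polyConst, B.d_d, map_zero, add_zero, hds, polyInt_polyDeriv]
    abel
  have htr : B.polyDeriv r = s + B.polyConst (B.d c) := by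
    rw [map_add, polyDeriv_polyConst, zero_add, polyDeriv_polyInt]
  have hrmem : r ∈ B.polyGr 1 := add_mem (polyConst_mem (f.map_gr (add_mem ha₁ hz)))
    (polyInt_mem (add_mem h3 (polyConst_mem (B.d_mem hc))))
  refine ⟨(a₁ + z, !![-r, B.polyConst c; 0, r]), ⟨add_mem ha₁ hz, hrmem, polyConst_mem hc, rfl,
    rfl, hr0.symm⟩, ?_, hr1⟩
  refine Prod.ext ?_ ?_
  · change A.d (a₁ + z) = x.1
    rw [map_add, hda₁, hdz, add_zero]
  · ext i j
    fin_cases i <;> fin_cases j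
    · simp [pathD, hdr, h5]
    · simp [pathD, htr, polyD_polyConst, ← hs]
    · simp [pathD, h4]
    · simp [pathD, hdr, ← hw]

end Path

end DGAlgebra

/-! ### Lifting quasi-isomorphisms -/

namespace DGAlgebra

section Model

variable {W : Type w} [AddCommGroup W] [Module ℂ W] {M A B : DGAlgebra.{u} ℂ}

theorem map_mem_gr (χ : ExteriorAlgebra ℂ W →ₐ[ℂ] A.carrier)
    (h : ∀ v, χ (ExteriorAlgebra.ι ℂ v) ∈ A.gr 1) {i : ℕ} {x : ExteriorAlgebra ℂ W}
    (hx : x ∈ ⋀[ℂ]^i W) : χ x ∈ A.gr i := by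
  induction hx using Submodule.pow_induction_on_left' with
  | algebraMap r =>
    rw [AlgHom.commutes, Algebra.algebraMap_eq_smul_one]
    exact Submodule.smul_mem _ _ (SetLike.GradedOne.one_mem (A := A.gr))
  | add x y i _ _ hx hy => rw [map_add]; exact Submodule.add_mem _ hx hy
  | mem_mul m hm i x _ ih =>
    obtain ⟨m, rfl⟩ := hm
    rw [map_mul, Nat.succ_eq_one_add]
    exact SetLike.GradedMul.mul_mem (A := A.gr) (h m) ih

theorem exists_sum_homogeneous (x : ExteriorAlgebra ℂ W) : ∃ s : Finset ℕ,
    ∃ c : ℕ → ExteriorAlgebra ℂ W, (∀ i, c i ∈ ⋀[ℂ]^i W) ∧ x = ∑ i ∈ s, c i := by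
  classical
  exact ⟨_, fun i => (DirectSum.decompose (fun i : ℕ => ⋀[ℂ]^i W) x i : ExteriorAlgebra ℂ W),
    fun i => SetLike.coe_mem _,
    (DirectSum.sum_support_decompose (fun i : ℕ => ⋀[ℂ]^i W) x).symm⟩

variable (E : ExteriorAlgebra ℂ W ≃ₐ[ℂ] M.carrier)

theorem symm_mem_exteriorPower (hE : ∀ v, E (ExteriorAlgebra.ι ℂ v) ∈ M.gr 1) {i : ℕ}
    {y : M.carrier} (hy : y ∈ M.gr i) : E.symm y ∈ ⋀[ℂ]^i W := by
  obtain ⟨s, c, hc, hx⟩ := exists_sum_homogeneous (E.symm y)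
  have hEc : ∀ j, E (c j) ∈ M.gr j := fun j => map_mem_gr E.toAlgHom hE (hc j)
  have h1 : y = ∑ j ∈ s, E (c j) := by rw [← map_sum, ← hx, AlgEquiv.apply_symm_apply]
  have h2 : y = M.proj i (∑ j ∈ s, E (c j)) := by rw [← h1, M.proj_same hy]
  rw [map_sum] at h2
  rw [h2, map_sum]
  refine Submodule.sum_mem _ fun j _ => ?_
  rcases eq_or_ne j i with rfl | hne
  · rw [M.proj_same (hEc j), AlgEquiv.symm_apply_apply]
    exact hc j
  · rw [M.proj_ne (hEc j) hne, map_zero]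
    exact Submodule.zero_mem _

/-- The differential of `M`, transported to the exterior algebra along an isomorphism. -/
def transportD : ExteriorAlgebra ℂ W →ₗ[ℂ] ExteriorAlgebra ℂ W :=
  E.symm.toLinearMap ∘ₗ M.d ∘ₗ E.toLinearMap

theorem apply_transportD (x : ExteriorAlgebra ℂ W) : E (transportD E x) = M.d (E x) :=
  E.apply_symm_apply _

theorem transportD_mul (hE : ∀ v, E (ExteriorAlgebra.ι ℂ v) ∈ M.gr 1)
    (x y : ExteriorAlgebra ℂ W) : transportD E (x * y) =
      transportD E x * y + signAut W x * transportD E y := by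
  obtain ⟨s, c, hc, rfl⟩ := exists_sum_homogeneous x
  simp only [Finset.sum_mul, map_sum, ← Finset.sum_add_distrib]
  refine Finset.sum_congr rfl fun i _ => ?_
  apply E.injective
  rw [signAut_apply (hc i)]
  simp only [map_add, map_mul, apply_transportD, map_pow, map_neg, map_one]
  have h : E (c i) ∈ M.gr i := map_mem_gr E.toAlgHom hE (hc i)
  rw [M.leibniz h, mul_assoc]

theorem isTriangular_transportD (hE : ∀ v, E (ExteriorAlgebra.ι ℂ v) ∈ M.gr 1) {n : ℕ}
    (e : Module.Basis (Fin n) ℂ W)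
    (he : ∀ k : Fin n, transportD E (ExteriorAlgebra.ι ℂ (e k)) ∈ flagAlgebra e k) :
    IsTriangular e (transportD E) where
  leibniz := transportD_mul E hE
  sq x := E.injective (by rw [apply_transportD, apply_transportD, M.d_d, map_zero])
  ι_mem v := symm_mem_exteriorPower E hE (M.d_mem (hE v))
  mem_flag := he

variable {E}

/-- A quasi-isomorphism from a triangular exterior algebra to the target of a quasi-isomorphism
may be replaced by one to the source. -/
theorem exists_quasiIso_lift (hE : ∀ v, E (ExteriorAlgebra.ι ℂ v) ∈ M.gr 1) {n : ℕ}
    {e : Module.Basis (Fin n) ℂ W} (htri : IsTriangular e (transportD E)) {f : Hom A B}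
    (hf : f.IsQuasiIso) {φ : Hom M B} (hφ : φ.IsQuasiIso) : ∃ ψ : Hom M A, ψ.IsQuasiIso := by
  obtain ⟨Ψ, h1, hD, hF⟩ := htri.exists_lift (path1 f) (path2 f) (pathD A B) (pathEnd A B) B.d
    (B.gr 1) (φ.toAlgHom.comp E.toAlgHom) (fun v => φ.map_gr (hE v))
    (fun x => by
      change φ.toAlgHom (E (transportD E x)) = B.d (φ.toAlgHom (E x))
      rw [apply_transportD, φ.map_d])
    (fun x hx => mul_self_of_mem_path1 hx) (path1_mul_path1_le f) (fun x hx => pathD_mul hx)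
    pathD_one (map_one (B.polyEval 1))
    (fun x hx y => by
      change B.polyEval 1 ((x * y).2 1 1) = B.polyEval 1 (x.2 1 1) * B.polyEval 1 (y.2 1 1)
      rw [← map_mul]
      simp [Matrix.mul_apply, Fin.sum_univ_two, hx.2.2.2.1])
    (fun x hx hd b hb hxb => exists_path_primitive hf hx hd hb hxb)
  have hstart : ∀ x, f.toAlgHom (Ψ x).1 = B.polyEval 0 ((Ψ x).2 1 1) := by
    intro x
    let U : Submodule ℂ (ExteriorAlgebra ℂ W) :=
      { carrier := {x | f.toAlgHom (Ψ x).1 = B.polyEval 0 ((Ψ x).2 1 1)}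
        add_mem' := fun {x y} hx hy => by
          change f.toAlgHom (Ψ (x + y)).1 = _
          rw [map_add, Prod.fst_add, map_add, hx, hy, Prod.snd_add, Matrix.add_apply, map_add]
        zero_mem' := by simp
        smul_mem' := fun r x hx => by
          change f.toAlgHom (Ψ (r • x)).1 = _
          rw [map_smul, Prod.smul_fst, map_smul, hx, Prod.smul_snd, Matrix.smul_apply, map_smul] }
    have hx : x ∈ flagAlgebra e n := by rw [flagAlgebra_eq_top]; trivial
    have hxU : x ∈ U := by
      refine mem_of_mem_adjoin_of_mul_mem ?_ ?_ hx
      · change f.toAlgHom (Ψ 1).1 = B.polyEval 0 ((Ψ 1).2 1 1)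
        simp
      · rintro _ ⟨i, -, rfl⟩ y hy
        change f.toAlgHom (Ψ y).1 = B.polyEval 0 ((Ψ y).2 1 1) at hy
        change f.toAlgHom (Ψ (_ * y)).1 = B.polyEval 0 ((Ψ (_ * y)).2 1 1)
        obtain ⟨-, -, -, h4, -, h6⟩ := h1 (e i)
        rw [map_mul, Prod.fst_mul, map_mul, hy, h6, ← map_mul]
        simp [Matrix.mul_apply, Fin.sum_univ_two, h4]
    exact hxU
  let ψ : Hom M A :=
    { toAlgHom := ((AlgHom.fst ℂ A.carrier (Matrix (Fin 2) (Fin 2) B.Poly)).comp Ψ).comp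
        E.symm.toAlgHom
      map_gr := fun {i x} hx => map_mem_gr
        ((AlgHom.fst ℂ A.carrier (Matrix (Fin 2) (Fin 2) B.Poly)).comp Ψ) (fun v => (h1 v).1)
        (symm_mem_exteriorPower E hE hx)
      map_d := fun x => by
        change (Ψ (E.symm (M.d x))).1 = A.d (Ψ (E.symm x)).1
        have h := congrArg Prod.fst (hD (E.symm x))
        rw [transportD, LinearMap.comp_apply, LinearMap.comp_apply] at h
        simp only [AlgEquiv.toLinearMap_apply, AlgEquiv.apply_symm_apply] at h
        exact h }
  refine ⟨ψ, hf.of_comp hφ ψ fun x hx => ?_⟩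
  change φ.toAlgHom x - f.toAlgHom (Ψ (E.symm x)).1 ∈ _
  have hend : B.polyEval 1 ((Ψ (E.symm x)).2 1 1) = φ.toAlgHom x := by
    have h := hF (E.symm x)
    change B.polyEval 1 ((Ψ (E.symm x)).2 1 1) = φ.toAlgHom (E (E.symm x)) at h
    rwa [AlgEquiv.apply_symm_apply] at h
  have hclosed : pathD A B (Ψ (E.symm x)) = 0 := by
    have h0 : transportD E (E.symm x) = 0 :=
      E.injective (by rw [apply_transportD, AlgEquiv.apply_symm_apply, hx, map_zero])
    rw [← hD, h0, map_zero]
  have hderiv : B.polyD ((Ψ (E.symm x)).2 0 1) = B.polyDeriv ((Ψ (E.symm x)).2 1 1) := by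
    have h : -B.polyD ((Ψ (E.symm x)).2 0 1) + B.polyDeriv ((Ψ (E.symm x)).2 1 1) = 0 :=
      congrFun (congrFun (congrArg Prod.snd hclosed) 0) 1
    rwa [neg_add_eq_zero] at h
  rw [hstart, ← hend, polyEval_one_sub_polyEval_zero, ← hderiv, ← polyD_polyInt, polyEval_polyD]
  exact ⟨_, rfl⟩

/-- A formal triangular exterior algebra has a quasi-isomorphism to its cohomology. -/
theorem IsFormal.exists_quasiIso (hM : M.IsFormal)
    (hE : ∀ v, E (ExteriorAlgebra.ι ℂ v) ∈ M.gr 1) {n : ℕ} {e : Module.Basis (Fin n) ℂ W}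
    (htri : IsTriangular e (transportD E)) : ∃ φ : Hom M M.cohomology, φ.IsQuasiIso := by
  have key : ∀ A B : DGAlgebra.{u} ℂ, QuasiIsomorphic A B →
      ((∃ φ : Hom M A, φ.IsQuasiIso) ↔ ∃ φ : Hom M B, φ.IsQuasiIso) := by
    intro A B h
    induction h with
    | rel A B h =>
      obtain ⟨f, hf⟩ := h
      exact ⟨fun ⟨φ, hφ⟩ => ⟨f.comp φ, hf.comp hφ⟩,
        fun ⟨φ, hφ⟩ => exists_quasiIso_lift hE htri hf hφ⟩
    | refl A => exact Iff.rfl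
    | symm A B _ ih => exact ih.symm
    | trans A B C _ _ ih1 ih2 => exact ih1.trans ih2
  refine (key _ _ hM).1 ⟨⟨AlgHom.id ℂ _, fun hx => hx, fun x => rfl⟩,
    (Hom.isQuasiIso_iff _).2 ⟨fun x _ hx => hx, fun y hy => ⟨y, hy, 0, by simp⟩⟩⟩

end Model

end DGAlgebra

/-! ### Top forms -/

section TopForm

variable {W : Type w} [AddCommGroup W] [Module ℂ W] {n : ℕ}

theorem ι_mul_eq_signAut_mul (m : W) (x : ExteriorAlgebra ℂ W) :
    ExteriorAlgebra.ι ℂ m * x = signAut W x * ExteriorAlgebra.ι ℂ m := by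
  induction x using ExteriorAlgebra.induction with
  | algebraMap r => rw [AlgHom.commutes, Algebra.commutes]
  | ι v => rw [signAut_ι, neg_mul, ι_anticomm]
  | mul x y hx hy => rw [← mul_assoc, hx, mul_assoc, hy, map_mul, mul_assoc]
  | add x y hx hy => rw [mul_add, hx, hy, map_add, add_mul]

theorem signAut_mem_flagAlgebra (e : Fin n → W) {k : ℕ} {x : ExteriorAlgebra ℂ W}
    (hx : x ∈ flagAlgebra e k) : signAut W x ∈ flagAlgebra e k := by
  have h : flagAlgebra e k ≤ (flagAlgebra e k).comap (signAut W) := by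
    refine Algebra.adjoin_le ?_
    rintro _ ⟨i, hi, rfl⟩
    change signAut W _ ∈ flagAlgebra e k
    rw [signAut_ι]
    exact neg_mem (ι_mem_flagAlgebra e hi)
  exact h hx

theorem exists_of_mem_flagAlgebra_succ (e : Fin n → W) (k : Fin n) {x : ExteriorAlgebra ℂ W}
    (hx : x ∈ flagAlgebra e (k + 1)) : ∃ a ∈ flagAlgebra e k, ∃ b ∈ flagAlgebra e k,
      x = a + b * ExteriorAlgebra.ι ℂ (e k) := by
  let U : Submodule ℂ (ExteriorAlgebra ℂ W) := Subalgebra.toSubmodule (flagAlgebra e k) ⊔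
    (Subalgebra.toSubmodule (flagAlgebra e k)).map
      (LinearMap.mulRight ℂ (ExteriorAlgebra.ι ℂ (e k)))
  have hU : ∀ a ∈ flagAlgebra e k, ∀ b ∈ flagAlgebra e k,
      a + b * ExteriorAlgebra.ι ℂ (e k) ∈ U := fun a ha b hb =>
    Submodule.add_mem_sup ha ⟨b, hb, rfl⟩
  have hxU : x ∈ U := by
    refine mem_of_mem_adjoin_of_mul_mem ?_ ?_ hx
    · exact Submodule.mem_sup_left (one_mem (flagAlgebra e k))
    · rintro _ ⟨i, hi, rfl⟩ y hy
      obtain ⟨a, ha, _, ⟨b, hb, rfl⟩, rfl⟩ := Submodule.mem_sup.1 hy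
      rcases Nat.lt_succ_iff_lt_or_eq.1 hi with hlt | heq
      · rw [mul_add, LinearMap.mulRight_apply, ← mul_assoc]
        exact hU _ (mul_mem (ι_mem_flagAlgebra e hlt) ha) _ (mul_mem (ι_mem_flagAlgebra e hlt) hb)
      · obtain rfl : i = k := Fin.ext heq
        rw [mul_add, LinearMap.mulRight_apply, ← mul_assoc, ι_mul_eq_signAut_mul _ a,
          ι_mul_eq_signAut_mul _ b, mul_assoc, ExteriorAlgebra.ι_sq_zero, mul_zero, add_comm]
        exact hU _ (zero_mem _) _ (signAut_mem_flagAlgebra e ha)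
  obtain ⟨a, ha, _, ⟨b, hb, rfl⟩, rfl⟩ := Submodule.mem_sup.1 hxU
  exact ⟨a, ha, b, hb, rfl⟩

/-- The coefficient of the product of all basis vectors. -/
def topCoeff (e : Module.Basis (Fin n) ℂ W) : ExteriorAlgebra ℂ W →ₗ[ℂ] ℂ :=
  ExteriorAlgebra.liftAlternating (Pi.single n e.det)

theorem topCoeff_ιMulti (e : Module.Basis (Fin n) ℂ W) (v : Fin n → W) :
    topCoeff e (ExteriorAlgebra.ιMulti ℂ n v) = e.det v := by
  rw [topCoeff, ExteriorAlgebra.liftAlternating_apply_ιMulti, Pi.single_eq_same]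

theorem topCoeff_ιMulti_update (e : Module.Basis (Fin n) ℂ W) (i : Fin n) (v : W) :
    topCoeff e (ExteriorAlgebra.ιMulti ℂ n (Function.update e i v)) = e.repr v i := by
  rw [topCoeff_ιMulti]
  have h : e.det.toMultilinearMap.toLinearMap e i = e.coord i := by
    refine e.ext fun j => ?_
    change e.det (Function.update e i (e j)) = e.coord i (e j)
    rcases eq_or_ne j i with rfl | hne
    · rw [Function.update_eq_self, Module.Basis.det_self]
      simp
    · rw [AlternatingMap.map_update_self _ _ hne.symm]
      simp [hne]
  exact LinearMap.congr_fun h v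

/-- The top coefficient vanishes on forms in which the `j`-th basis vector does not occur. -/
theorem topCoeff_eq_zero (e : Module.Basis (Fin n) ℂ W) (j : Fin n) {x : ExteriorAlgebra ℂ W}
    (hx : x ∈ Algebra.adjoin ℂ {x | ∃ i, i ≠ j ∧ ExteriorAlgebra.ι ℂ (e i) = x}) :
    topCoeff e x = 0 := by
  have hvan : ∀ (m : ℕ) (f : Fin m → Fin n), (∀ k, f k ≠ j) →
      topCoeff e (ExteriorAlgebra.ιMulti ℂ m fun k => e (f k)) = 0 := by
    intro m f hf
    by_cases hm : m = n
    · subst hm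
      rw [topCoeff_ιMulti]
      refine AlternatingMap.map_eq_zero_of_not_injective _ _ fun hinj => ?_
      obtain ⟨k, hk⟩ := (Finite.injective_iff_surjective.1 (Function.Injective.of_comp hinj)) j
      exact hf k hk
    · rw [topCoeff, ExteriorAlgebra.liftAlternating_apply_ιMulti, Pi.single_eq_of_ne hm]
      rfl
  rw [← Subalgebra.mem_toSubmodule, Algebra.adjoin_eq_span] at hx
  induction hx using Submodule.span_induction with
  | zero => exact map_zero _
  | add x y _ _ hx hy => rw [map_add, hx, hy, add_zero]
  | smul r x _ hx => rw [map_smul, hx, smul_zero]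
  | mem x hx =>
    have hl : ∃ l : List (Fin n), (∀ i ∈ l, i ≠ j) ∧
        x = (l.map fun i => ExteriorAlgebra.ι ℂ (e i)).prod := by
      induction hx using Submonoid.closure_induction with
      | mem x hx =>
        obtain ⟨i, hi, rfl⟩ := hx
        exact ⟨[i], by simpa using hi, by simp⟩
      | one => exact ⟨[], by simp, by simp⟩
      | mul x y _ _ hx hy =>
        obtain ⟨l, hl, rfl⟩ := hx
        obtain ⟨l', hl', rfl⟩ := hy
        refine ⟨l ++ l', fun i hi => ?_, by simp⟩
        rcases List.mem_append.1 hi with h | h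
        exacts [hl i h, hl' i h]
    obtain ⟨l, hl, rfl⟩ := hl
    have hprod : (l.map fun i => ExteriorAlgebra.ι ℂ (e i)).prod =
        ExteriorAlgebra.ιMulti ℂ l.length fun k => e (l.get k) := by
      rw [ExteriorAlgebra.ιMulti_apply]
      congr 1
      conv_lhs => rw [← List.ofFn_get l, List.map_ofFn]
      rfl
    rw [hprod]
    exact hvan _ _ fun k => hl _ (l.get_mem k)

theorem IsTriangular.map_mem_flagAlgebra {e : Module.Basis (Fin n) ℂ W}
    {δ : ExteriorAlgebra ℂ W →ₗ[ℂ] ExteriorAlgebra ℂ W} (h : IsTriangular e δ) {k : ℕ}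
    {x : ExteriorAlgebra ℂ W} (hx : x ∈ flagAlgebra e k) : δ x ∈ flagAlgebra e k := by
  let U : Submodule ℂ (ExteriorAlgebra ℂ W) := Subalgebra.toSubmodule (flagAlgebra e k) ⊓
    (Subalgebra.toSubmodule (flagAlgebra e k)).comap δ
  have hU : x ∈ U := by
    refine mem_of_mem_adjoin_of_mul_mem ?_ ?_ hx
    · refine ⟨one_mem (flagAlgebra e k), ?_⟩
      change δ 1 ∈ flagAlgebra e k
      rw [h.one]
      exact zero_mem _
    · rintro _ ⟨i, hi, rfl⟩ y ⟨hy, hy'⟩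
      change y ∈ flagAlgebra e k at hy
      refine ⟨(flagAlgebra e k).mul_mem (ι_mem_flagAlgebra e hi) hy, ?_⟩
      change δ (_ * y) ∈ flagAlgebra e k
      rw [h.ι_mul]
      exact sub_mem (mul_mem (flagAlgebra_mono e hi.le (h.mem_flag i)) hy)
        (mul_mem (ι_mem_flagAlgebra e hi) hy')
  exact hU.2

/-- Exact forms have no component of top degree. This is the unimodularity of nilpotent Lie
algebras: replacing a basis vector in a product by its differential produces a product in which
this basis vector does not occur. -/
theorem IsTriangular.topCoeff_apply {e : Module.Basis (Fin n) ℂ W}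
    {δ : ExteriorAlgebra ℂ W →ₗ[ℂ] ExteriorAlgebra ℂ W} (h : IsTriangular e δ)
    (x : ExteriorAlgebra ℂ W) : topCoeff e (δ x) = 0 := by
  have main : ∀ k ≤ n, ∀ y ∈ flagAlgebra e k,
      ∀ z ∈ Algebra.adjoin ℂ {x | ∃ i : Fin n, k ≤ i ∧ ExteriorAlgebra.ι ℂ (e i) = x},
      topCoeff e (δ y * z) = 0 := by
    intro k
    induction k with
    | zero =>
      intro _ y hy z _
      have h0 : y ∈ LinearMap.ker δ := by
        refine mem_of_mem_adjoin_of_mul_mem h.one ?_ hy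
        rintro _ ⟨i, hi, -⟩
        exact absurd hi (Nat.not_lt_zero _)
      rw [LinearMap.mem_ker.1 h0, zero_mul, map_zero]
    | succ k ih =>
      intro hk y hy z hz
      let kk : Fin n := ⟨k, hk⟩
      -- a product in which the basis vector of index `k` does not occur
      have hvan : ∀ a ∈ flagAlgebra e k, topCoeff e (a * z) = 0 := by
        intro a ha
        refine topCoeff_eq_zero e kk (mul_mem (Algebra.adjoin_mono ?_ ha)
          (Algebra.adjoin_mono ?_ hz))
        · rintro _ ⟨i, hi, rfl⟩
          exact ⟨i, fun hik => by rw [hik] at hi; exact lt_irrefl _ hi, rfl⟩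
        · rintro _ ⟨i, hi, rfl⟩
          exact ⟨i, fun hik => by rw [hik] at hi; exact Nat.not_succ_le_self _ hi, rfl⟩
      obtain ⟨a, ha, b, hb, rfl⟩ := exists_of_mem_flagAlgebra_succ e kk hy
      have hb' : topCoeff e (δ b * (ExteriorAlgebra.ι ℂ (e kk) * z)) = 0 := by
        refine ih (by omega) b hb _ (mul_mem (Algebra.subset_adjoin ⟨kk, le_rfl, rfl⟩)
          (Algebra.adjoin_mono ?_ hz))
        rintro _ ⟨i, hi, rfl⟩
        exact ⟨i, (Nat.le_succ k).trans hi, rfl⟩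
      rw [map_add, h.leibniz, add_mul, add_mul, map_add, map_add, mul_assoc, hb',
        hvan _ (h.map_mem_flagAlgebra ha),
        hvan _ (mul_mem (signAut_mem_flagAlgebra e hb) (h.mem_flag kk))]
      simp
  have hx : x ∈ flagAlgebra e n := by rw [flagAlgebra_eq_top]; trivial
  simpa using main n le_rfl x hx 1 (one_mem _)

theorem exteriorPower_eq_zero {m : ℕ} (e : Module.Basis (Fin n) ℂ W) (hm : n < m)
    {x : ExteriorAlgebra ℂ W} (hx : x ∈ ⋀[ℂ]^m W) : x = 0 := by
  rw [← ExteriorAlgebra.ιMulti_span_fixedDegree] at hx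
  induction hx using Submodule.span_induction with
  | zero => rfl
  | add x y _ _ hx hy => rw [hx, hy, add_zero]
  | smul r x _ hx => rw [hx, smul_zero]
  | mem x hx =>
    obtain ⟨v, rfl⟩ := hx
    refine AlternatingMap.map_linearDependent _ _ fun hv => ?_
    have : FiniteDimensional ℂ W := e.finiteDimensional_of_finite
    have h1 := hv.fintype_card_le_finrank
    rw [Fintype.card_fin, Module.finrank_eq_card_basis e, Fintype.card_fin] at h1
    omega

/-- If every proper subspace may be enlarged by a vector whose differential only involves
vectors of the subspace, then the differential is triangular with respect to some basis. -/
theorem exists_triangular_basis [FiniteDimensional ℂ W]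
    (δ : ExteriorAlgebra ℂ W →ₗ[ℂ] ExteriorAlgebra ℂ W)
    (h : ∀ U : Submodule ℂ W, U ≠ ⊤ → ∃ v ∉ U, δ (ExteriorAlgebra.ι ℂ v) ∈
      Algebra.adjoin ℂ (U.map (ExteriorAlgebra.ι ℂ) : Set (ExteriorAlgebra ℂ W))) :
    ∃ e : Module.Basis (Fin (Module.finrank ℂ W)) ℂ W,
      ∀ k : Fin (Module.finrank ℂ W), δ (ExteriorAlgebra.ι ℂ (e k)) ∈ flagAlgebra e k := by
  have main : ∀ k ≤ Module.finrank ℂ W, ∃ v : Fin k → W, LinearIndependent ℂ v ∧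
      ∀ i : Fin k, δ (ExteriorAlgebra.ι ℂ (v i)) ∈ flagAlgebra v i := by
    intro k
    induction k with
    | zero =>
      intro _
      exact ⟨Fin.elim0, linearIndependent_empty_type, fun i => i.elim0⟩
    | succ k ih =>
      intro hk
      obtain ⟨v, hv, hδ⟩ := ih (by omega)
      have hU : Submodule.span ℂ (Set.range v) ≠ ⊤ := by
        intro htop
        have h1 := finrank_span_eq_card hv
        rw [htop, finrank_top, Fintype.card_fin] at h1
        omega
      obtain ⟨x, hx, hxδ⟩ := h _ hU
      have hle : ∀ j ≤ k, flagAlgebra v j ≤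
          flagAlgebra (Fin.snoc v x : Fin (k + 1) → W) j := by
        intro j hj
        refine Algebra.adjoin_mono ?_
        rintro _ ⟨i, hi, rfl⟩
        exact ⟨i.castSucc, hi, by rw [Fin.snoc_castSucc]⟩
      refine ⟨Fin.snoc v x, linearIndependent_finSnoc.2 ⟨hv, hx⟩, fun i => ?_⟩
      induction i using Fin.lastCases with
      | cast i =>
        rw [Fin.snoc_castSucc]
        exact hle _ i.2.le (hδ i)
      | last =>
        rw [Fin.snoc_last]
        refine Algebra.adjoin_le ?_ hxδ
        rintro _ ⟨y, hy, rfl⟩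
        have hspan : Submodule.span ℂ (Set.range v) ≤ (Subalgebra.toSubmodule
            (flagAlgebra v k)).comap (ExteriorAlgebra.ι ℂ) := by
          refine Submodule.span_le.2 ?_
          rintro _ ⟨i, rfl⟩
          exact ι_mem_flagAlgebra v i.2
        exact hle k le_rfl (hspan hy)
  obtain ⟨v, hv, hδ⟩ := main _ le_rfl
  refine ⟨basisOfLinearIndependentOfCardEqFinrank' v hv (by simp), ?_⟩
  simpa using hδ

end TopForm

namespace DGAlgebra

variable {W : Type w} [AddCommGroup W] [Module ℂ W] {M : DGAlgebra.{u} ℂ}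

/-- The differential of a formal differential graded algebra with underlying algebra
`Λ W`, which is triangular, vanishes. -/
theorem IsFormal.d_ι_eq_zero (hM : M.IsFormal) {E : ExteriorAlgebra ℂ W ≃ₐ[ℂ] M.carrier}
    (hE : ∀ v, E (ExteriorAlgebra.ι ℂ v) ∈ M.gr 1) {n : ℕ} {e : Module.Basis (Fin n) ℂ W}
    (htri : IsTriangular e (transportD E)) (v : W) : M.d (E (ExteriorAlgebra.ι ℂ v)) = 0 := by
  by_contra hv
  obtain ⟨φ, hφ⟩ := hM.exists_quasiIso hE htri
  -- the class `φ v` is also the image of a closed vector `u`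
  obtain ⟨x, hx, hdx, c, -, hc⟩ := hφ.exists_cocycle (i := 0) (φ.map_gr (hE v)) rfl
  have hc' : φ.toAlgHom (E (ExteriorAlgebra.ι ℂ v)) = φ.toAlgHom x := by
    rw [hc]
    exact add_zero _
  obtain ⟨u, hu⟩ : ∃ u, ExteriorAlgebra.ι ℂ u = E.symm x := by
    have h := symm_mem_exteriorPower E hE hx
    change _ ∈ LinearMap.range (ExteriorAlgebra.ι ℂ (M := W)) ^ 1 at h
    rw [pow_one] at h
    exact h
  have hux : E (ExteriorAlgebra.ι ℂ u) = x := by rw [hu, AlgEquiv.apply_symm_apply]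
  have hne : v - u ≠ 0 := by
    intro h0
    rw [sub_eq_zero.1 h0, hux] at hv
    exact hv hdx
  have hker : φ.toAlgHom (E (ExteriorAlgebra.ι ℂ (v - u))) = 0 := by
    rw [map_sub, map_sub, map_sub, hux, hc', sub_self]
  obtain ⟨i, hi⟩ : ∃ i, e.repr (v - u) i ≠ 0 := by
    by_contra! h
    exact hne (e.repr.map_eq_zero_iff.1 (Finsupp.ext h))
  -- a top form with a factor in the kernel of `φ`
  set ω := ExteriorAlgebra.ιMulti ℂ n (Function.update e i (v - u)) with hω
  have hωmem : E ω ∈ M.gr n := by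
    refine map_mem_gr E.toAlgHom hE ?_
    rw [← ExteriorAlgebra.ιMulti_span_fixedDegree]
    exact Submodule.subset_span ⟨_, rfl⟩
  have hclosed : M.d (E ω) = 0 := by
    have h := exteriorPower_eq_zero e (Nat.lt_succ_self n)
      (symm_mem_exteriorPower E hE (M.d_mem hωmem))
    rw [← E.apply_symm_apply (M.d (E ω)), h, map_zero]
  have hφω : φ.toAlgHom (E ω) = 0 := by
    rw [hω, ExteriorAlgebra.ιMulti_apply]
    have h : φ.toAlgHom (E (List.ofFn fun k =>
        ExteriorAlgebra.ι ℂ (Function.update e i (v - u) k)).prod) =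
        ((List.ofFn fun k => ExteriorAlgebra.ι ℂ (Function.update e i (v - u) k)).map
          (φ.toAlgHom.comp E.toAlgHom)).prod := map_list_prod (φ.toAlgHom.comp E.toAlgHom) _
    rw [h]
    refine List.prod_eq_zero ?_
    rw [List.map_ofFn, List.mem_ofFn]
    refine ⟨i, ?_⟩
    rw [Function.comp_apply, Function.update_self]
    exact hker
  obtain ⟨z, hz⟩ := (φ.isQuasiIso_iff.1 hφ).1 _ hclosed (by rw [hφω]; exact zero_mem _)
  have h0 : transportD E (E.symm z) = ω :=
    E.injective (by rw [apply_transportD, AlgEquiv.apply_symm_apply, hz])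
  have h1 := htri.topCoeff_apply (E.symm z)
  rw [h0, hω, topCoeff_ιMulti_update] at h1
  exact hi h1

end DGAlgebra

/-! ### Nilpotent Lie algebras with complex structure -/

namespace LieComplexStructure

variable {g : Type u} [LieRing g] [LieAlgebra ℝ g] (I : LieComplexStructure g)

theorem conjC_conjC (x : ℂ ⊗[ℝ] g) : conjC g (conjC g x) = x := by
  induction x with
  | zero => simp
  | tmul a v => simp [conjC_tmul]
  | add x y hx hy => rw [map_add, map_add, hx, hy]

theorem conjC_mem_g01 {x : ℂ ⊗[ℝ] g} (hx : x ∈ I.g10) : conjC g x ∈ I.g01 := ⟨x, hx, rfl⟩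

theorem conjC_mem_g10 {x : ℂ ⊗[ℝ] g} (hx : x ∈ I.g01) : conjC g x ∈ I.g10 := by
  obtain ⟨y, hy, rfl⟩ := hx
  rw [conjC_conjC]
  exact hy

theorem mem_g10_of_Q_eq_zero {x : ℂ ⊗[ℝ] g} (hx : I.Q x = 0) : x ∈ I.g10 := by
  have h := I.P_mem x
  have h2 := I.P_add_Q x
  rw [hx, add_zero] at h2
  rwa [h2] at h

theorem mem_g01_of_P_eq_zero {x : ℂ ⊗[ℝ] g} (hx : I.P x = 0) : x ∈ I.g01 := by
  have h := I.Q_mem x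
  have h2 := I.P_add_Q x
  rw [hx, zero_add] at h2
  rwa [h2] at h

theorem eq_zero_of_mem {x : ℂ ⊗[ℝ] g} (h10 : x ∈ I.g10) (h01 : x ∈ I.g01) : x = 0 := by
  rw [← I.P_of_mem h10, I.P_eq_zero h01]

theorem Q_bracket01 (x y : ℂ ⊗[ℝ] g) : I.Q (I.bracket01 x y) = ⁅I.Q x, I.Q y⁆ := by
  rw [bracket01_apply, map_add, map_add, I.Q_eq_zero (I.P_mem _), I.Q_eq_zero (I.P_mem _),
    I.Q_of_mem (I.g01.lie_mem (I.Q_mem _) (I.Q_mem _)), add_zero, add_zero]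

theorem bracket01_swap (x y : ℂ ⊗[ℝ] g) : I.bracket01 y x = -I.bracket01 x y := by
  have h := I.bracket01_self (x + y)
  simp only [map_add, LinearMap.add_apply, bracket01_self, zero_add, add_zero] at h
  exact eq_neg_of_add_eq_zero_left h

/-- If the part of type `(0,1)` of the bracket vanishes, then so does the part of type `(1,0)`, which
is its complex conjugate. -/
theorem bracket01_eq_zero_iff : I.bracket01 = 0 ↔ IsLieAbelian g := by
  constructor
  · intro h
    have h0 : ∀ x y, I.bracket01 x y = 0 := fun x y => by rw [h]; rfl
    have hQQ : ∀ x ∈ I.g01, ∀ y ∈ I.g01, ⁅x, y⁆ = 0 := by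
      intro x hx y hy
      rw [← I.Q_of_mem hx, ← I.Q_of_mem hy, ← Q_bracket01, h0, map_zero]
    have hPQ : ∀ x ∈ I.g10, ∀ y ∈ I.g01, ⁅x, y⁆ ∈ I.g01 := by
      intro x hx y hy
      refine I.mem_g01_of_P_eq_zero ?_
      have h1 := h0 x y
      rwa [bracket01_apply, I.P_of_mem hx, I.Q_eq_zero hx, I.Q_of_mem hy, I.P_eq_zero hy, zero_lie,
        zero_lie, map_zero, add_zero, zero_add] at h1
    have hPQ0 : ∀ x ∈ I.g10, ∀ y ∈ I.g01, ⁅x, y⁆ = 0 := by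
      intro x hx y hy
      refine I.eq_zero_of_mem ?_ (hPQ x hx y hy)
      have h1 := I.conjC_mem_g10 (hPQ _ (I.conjC_mem_g10 hy) _ (I.conjC_mem_g01 hx))
      rw [conjC_lie, conjC_conjC, conjC_conjC, ← lie_skew] at h1
      exact neg_mem_iff.1 h1
    have hPP : ∀ x ∈ I.g10, ∀ y ∈ I.g10, ⁅x, y⁆ = 0 := by
      intro x hx y hy
      rw [← conjC_conjC ⁅x, y⁆, conjC_lie, hQQ _ (I.conjC_mem_g01 hx) _ (I.conjC_mem_g01 hy),
        map_zero]
    have hall : ∀ x y : ℂ ⊗[ℝ] g, ⁅x, y⁆ = 0 := by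
      intro x y
      rw [← I.P_add_Q x, ← I.P_add_Q y, add_lie, lie_add, lie_add,
        hPP _ (I.P_mem _) _ (I.P_mem _), hPQ0 _ (I.P_mem _) _ (I.Q_mem _),
        hQQ _ (I.Q_mem _) _ (I.Q_mem _), ← lie_skew, hPQ0 _ (I.P_mem _) _ (I.Q_mem _)]
      simp
    refine ⟨fun x y => ?_⟩
    have h1 : (1 * 1 : ℂ) ⊗ₜ[ℝ] ⁅x, y⁆ = 0 := hall (1 ⊗ₜ x) (1 ⊗ₜ y)
    refine Module.FaithfullyFlat.tensorProduct_mk_injective (A := ℝ) (B := ℂ) g ?_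
    rw [map_zero]
    simpa using h1
  · intro h
    have hall : ∀ x y : ℂ ⊗[ℝ] g, ⁅x, y⁆ = 0 := by
      intro x y
      change bracketMap _ x y = 0
      induction x with
      | zero => simp
      | add x x' hx hx' => rw [map_add, LinearMap.add_apply, hx, hx', add_zero]
      | tmul a v =>
        induction y with
        | zero => simp
        | add y y' hy hy' => rw [map_add, hy, hy', add_zero]
        | tmul b z =>
          change (a * b) ⊗ₜ ⁅v, z⁆ = 0
          rw [h.trivial, TensorProduct.tmul_zero]
    refine LinearMap.ext₂ fun x y => ?_
    simp [bracket01_apply, hall]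

/-- The span of the brackets of type `(0,1)` of elements of a subspace with arbitrary vectors. -/
def bracketSpan (K : Submodule ℂ (ℂ ⊗[ℝ] g)) : Submodule ℂ (ℂ ⊗[ℝ] g) :=
  Submodule.span ℂ {z | ∃ x ∈ K, ∃ y, I.bracket01 x y = z}

theorem bracketSpan_le {K S : Submodule ℂ (ℂ ⊗[ℝ] g)}
    (h : ∀ x ∈ K, ∀ y, I.bracket01 x y ∈ S) : I.bracketSpan K ≤ S := by
  refine Submodule.span_le.2 ?_
  rintro _ ⟨x, hx, y, rfl⟩
  exact h x hx y

theorem lie_mem_lowerCentralSeries {L : Type*} [LieRing L] [LieAlgebra ℂ L] {n : ℕ} {x : L}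
    (hx : x ∈ LieModule.lowerCentralSeries ℂ L L n) (y : L) :
    ⁅x, y⁆ ∈ LieModule.lowerCentralSeries ℂ L L (n + 1) := by
  rw [← lie_skew, LieModule.lowerCentralSeries_succ]
  exact neg_mem (LieSubmodule.lie_mem_lie (LieSubmodule.mem_top y) hx)

section Nilpotent

variable [LieRing.IsNilpotent g]

/-- Nilpotency of `𝔤^{0,1}`, regarded as the quotient by vectors of type `(1,0)`. -/
theorem le_g10_of_le_bracketSpan {K : Submodule ℂ (ℂ ⊗[ℝ] g)}
    (h : K ≤ I.g10.toSubmodule ⊔ I.bracketSpan K) : K ≤ I.g10.toSubmodule := by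
  obtain ⟨N, hN⟩ := LieModule.IsNilpotent.nilpotent ℂ (ℂ ⊗[ℝ] g) (ℂ ⊗[ℝ] g)
  have key : ∀ n, ∀ x ∈ K,
      I.Q x ∈ LieModule.lowerCentralSeries ℂ (ℂ ⊗[ℝ] g) (ℂ ⊗[ℝ] g) n := by
    intro n
    induction n with
    | zero => intro x _; simp
    | succ n ih =>
      intro x hx
      obtain ⟨p, hp, s, hs, rfl⟩ := Submodule.mem_sup.1 (h hx)
      rw [map_add, I.Q_eq_zero hp, zero_add]
      have hle : I.bracketSpan K ≤ (LieModule.lowerCentralSeries ℂ (ℂ ⊗[ℝ] g) (ℂ ⊗[ℝ] g)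
          (n + 1)).toSubmodule.comap I.Q := by
        refine I.bracketSpan_le fun x hx y => ?_
        rw [Submodule.mem_comap, Q_bracket01]
        exact lie_mem_lowerCentralSeries (ih x hx) _
      exact hle hs
  intro x hx
  have h0 := key N x hx
  rw [hN, LieSubmodule.mem_bot] at h0
  exact I.mem_g10_of_Q_eq_zero h0

/-- The bracket of type `(0,1)` of a nilpotent Lie algebra is nilpotent. -/
theorem eq_bot_of_le_bracketSpan {K : Submodule ℂ (ℂ ⊗[ℝ] g)} (h : K ≤ I.bracketSpan K) :
    K = ⊥ := by
  have hK : K ≤ I.g10.toSubmodule := I.le_g10_of_le_bracketSpan (h.trans le_sup_right)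
  obtain ⟨N, hN⟩ := LieModule.IsNilpotent.nilpotent ℂ (ℂ ⊗[ℝ] g) (ℂ ⊗[ℝ] g)
  -- `K` consists of vectors of type `(1,0)`, for which the bracket of type `(0,1)` with a vector is
  -- the usual bracket with its component of type `(0,1)`, up to vectors of type `(0,1)`
  have key : ∀ n, K ≤ (LieModule.lowerCentralSeries ℂ (ℂ ⊗[ℝ] g) (ℂ ⊗[ℝ] g) n).toSubmodule ⊔
      I.g01.toSubmodule := by
    intro n
    induction n with
    | zero => simp
    | succ n ih =>
      refine h.trans (I.bracketSpan_le fun x hx y => ?_)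
      obtain ⟨l, hl, q, hq, hlq⟩ := Submodule.mem_sup.1 (ih hx)
      have e : I.bracket01 x y = ⁅l, I.Q y⁆ + (-I.Q ⁅l, I.Q y⁆) := by
        rw [bracket01_apply, I.P_of_mem (hK hx), I.Q_eq_zero (hK hx), zero_lie, zero_lie, map_zero,
          add_zero, zero_add, ← hlq, add_lie, map_add,
          I.P_eq_zero (I.g01.lie_mem hq (I.Q_mem y)), add_zero]
        nth_rewrite 2 [← I.P_add_Q ⁅l, I.Q y⁆]
        abel
      rw [e]
      exact Submodule.add_mem_sup (lie_mem_lowerCentralSeries hl _) (neg_mem (I.Q_mem _))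
  rw [eq_bot_iff]
  intro x hx
  have h0 := key N hx
  rw [hN, LieSubmodule.bot_toSubmodule, bot_sup_eq] at h0
  exact I.eq_zero_of_mem (hK hx) h0

end Nilpotent

/-- With `K` the common zeros of a space of covectors, this yields a covector outside this space
whose differential is a form in the covectors of the space, see `delbar_ι_mem`. -/
theorem exists_covector {Z K : Submodule ℂ (ℂ ⊗[ℝ] g)} (h : ¬K ≤ Z ⊔ I.bracketSpan K) :
    ∃ α ∈ Z.dualAnnihilator, α ∉ K.dualAnnihilator ∧ ∀ x ∈ K, ∀ y, α (I.bracket01 x y) = 0 := by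
  obtain ⟨k, hk, hkS⟩ := SetLike.not_le_iff_exists.1 h
  obtain ⟨α, hα, hker⟩ := Submodule.exists_le_ker_of_notMem hkS
  refine ⟨α, (Submodule.mem_dualAnnihilator α).2 fun x hx => hker (Submodule.mem_sup_left hx),
    fun hmem => hα ((Submodule.mem_dualAnnihilator α).1 hmem k hk), fun x hx y => ?_⟩
  exact hker (Submodule.mem_sup_right (Submodule.subset_span ⟨x, hx, y, rfl⟩))

theorem map_range_eq_zeroForms :
    (ExteriorAlgebra.map I.covectors01.subtype).range = I.zeroForms := by
  refine le_antisymm ?_ ?_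
  · rintro _ ⟨x, rfl⟩
    change ExteriorAlgebra.map I.covectors01.subtype x ∈ I.zeroForms
    induction x using ExteriorAlgebra.induction with
    | algebraMap r => rw [AlgHom.commutes]; exact Subalgebra.algebraMap_mem _ r
    | ι v =>
      rw [ExteriorAlgebra.map_apply_ι]
      exact Algebra.subset_adjoin ⟨v, v.2, rfl⟩
    | mul x y hx hy => rw [map_mul]; exact mul_mem hx hy
    | add x y hx hy => rw [map_add]; exact add_mem hx hy
  · refine Algebra.adjoin_le ?_
    rintro _ ⟨α, hα, rfl⟩
    exact ⟨ExteriorAlgebra.ι ℂ ⟨α, hα⟩, ExteriorAlgebra.map_apply_ι _ _⟩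

theorem map_subtype_injective :
    Function.Injective (ExteriorAlgebra.map I.covectors01.subtype) :=
  ExteriorAlgebra.map_injective_field I.covectors01.ker_subtype

variable [FiniteDimensional ℝ g]

theorem delbar_ι (α : Module.Dual ℂ (ℂ ⊗[ℝ] g)) : I.delbar (ExteriorAlgebra.ι ℂ α) =
    (twoForm (I.bracket01.compr₂ α) : ComplexForms g) := by
  rw [delbar_eq, ceDifferential, antideriv_ι]
  rfl

theorem delbar_ι_mem {K : Submodule ℂ (ℂ ⊗[ℝ] g)} {α : Module.Dual ℂ (ℂ ⊗[ℝ] g)}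
    (hα : ∀ x ∈ K, ∀ y, α (I.bracket01 x y) = 0) : I.delbar (ExteriorAlgebra.ι ℂ α) ∈
      K.dualAnnihilator.map (ExteriorAlgebra.ι ℂ) *
        K.dualAnnihilator.map (ExteriorAlgebra.ι ℂ) := by
  obtain ⟨C, hC⟩ := K.exists_isCompl
  let π : (ℂ ⊗[ℝ] g) →ₗ[ℂ] (ℂ ⊗[ℝ] g) := C.projection K hC.symm
  have hπ : ∀ x, x - π x ∈ K := by
    intro x
    have h := Submodule.projection_add_projection_eq_self hC x
    rw [← eq_sub_iff_add_eq] at h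
    exact h ▸ Submodule.projection_apply_mem hC x
  have hker : ∀ x ∈ K, π x = 0 := fun x hx =>
    (Submodule.projection_apply_eq_zero_iff hC.symm).2 hx
  have hα' : ∀ x ∈ K, ∀ y, α (I.bracket01 y x) = 0 := by
    intro x hx y
    rw [bracket01_swap, map_neg, hα x hx, neg_zero]
  -- the two-form of `α` descends to the quotient by `K`
  have e : I.bracket01.compr₂ α = (I.bracket01.compr₂ α).compl₁₂ π π := by
    refine LinearMap.ext₂ fun x y => ?_
    change α (I.bracket01 x y) = α (I.bracket01 (π x) (π y))
    have h1 := hα _ (hπ x) y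
    have h2 := hα' _ (hπ y) (π x)
    rw [map_sub, LinearMap.sub_apply, map_sub, sub_eq_zero] at h1
    rw [map_sub, map_sub, sub_eq_zero] at h2
    rw [h1, h2]
  have hmem : ∀ β : Module.Dual ℂ (ℂ ⊗[ℝ] g), β ∘ₗ π ∈ K.dualAnnihilator := fun β =>
    (Submodule.mem_dualAnnihilator _).2 fun x hx => by
      rw [LinearMap.comp_apply, hker x hx, map_zero]
  rw [delbar_ι, e]
  exact twoForm_mem _ π π _ _ hmem hmem

theorem delbar_ι_eq_zero_iff (α : Module.Dual ℂ (ℂ ⊗[ℝ] g)) :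
    I.delbar (ExteriorAlgebra.ι ℂ α) = 0 ↔ ∀ x y, α (I.bracket01 x y) = 0 := by
  rw [delbar_ι]
  constructor
  · intro h x y
    have h0 : twoForm (I.bracket01.compr₂ α) = 0 := Subtype.ext h
    have h1 := pairing_twoForm (I.bracket01.compr₂ α)
      (fun x => by rw [LinearMap.compr₂_apply, bracket01_self, map_zero]) x y
    rw [h0, map_zero, LinearMap.zero_apply] at h1
    exact h1.symm
  · intro h
    have h0 : I.bracket01.compr₂ α = 0 := LinearMap.ext₂ h
    rw [h0, map_zero]
    rfl

theorem delbar_ι_mul (α : Module.Dual ℂ (ℂ ⊗[ℝ] g)) (y : ComplexForms g) :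
    I.delbar (ExteriorAlgebra.ι ℂ α * y) =
      I.delbar (ExteriorAlgebra.ι ℂ α) * y - ExteriorAlgebra.ι ℂ α * I.delbar y := by
  rw [delbar_eq, ceDifferential, antideriv_mul, signAut_ι, neg_mul, sub_eq_add_neg]

theorem delbar_one : I.delbar 1 = 0 := I.dolbeault.d_one

theorem delbar_eq_zero_of_mem_adjoin {U : Submodule ℂ (Module.Dual ℂ (ℂ ⊗[ℝ] g))}
    (hU : ∀ α ∈ U, I.delbar (ExteriorAlgebra.ι ℂ α) = 0) {x : ComplexForms g}
    (hx : x ∈ Algebra.adjoin ℂ (U.map (ExteriorAlgebra.ι ℂ) : Set (ComplexForms g))) :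
    I.delbar x = 0 := by
  have h : x ∈ LinearMap.ker I.delbar := by
    refine mem_of_mem_adjoin_of_mul_mem I.delbar_one ?_ hx
    rintro _ ⟨α, hα, rfl⟩ y hy
    rw [LinearMap.mem_ker] at hy ⊢
    rw [delbar_ι_mul, hU α hα, hy, zero_mul, mul_zero, sub_zero]
  exact h

theorem dualCoannihilator_dualAnnihilator (U : Submodule ℂ (Module.Dual ℂ (ℂ ⊗[ℝ] g))) :
    U.dualCoannihilator.dualAnnihilator = U :=
  Subspace.dualCoannihilator_dualAnnihilator_eq

/-- The vanishing of the differential on covectors, which formality implies, is dual to the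
vanishing of the bracket of type `(0,1)`. -/
theorem bracket01_eq_zero_of_isFormal [LieRing.IsNilpotent g] (h : I.dolbeault.IsFormal) : I.bracket01 = 0 := by
  let E : ComplexForms g ≃ₐ[ℂ] I.dolbeault.carrier := AlgEquiv.refl
  have hE : ∀ α, E (ExteriorAlgebra.ι ℂ α) ∈ I.dolbeault.gr 1 := by
    intro α
    change _ ∈ LinearMap.range (ExteriorAlgebra.ι ℂ (M := Module.Dual ℂ (ℂ ⊗[ℝ] g))) ^ 1
    rw [pow_one]
    exact ⟨α, rfl⟩
  obtain ⟨e, he⟩ := exists_triangular_basis (DGAlgebra.transportD E) (by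
    intro U hU
    have hK : ¬U.dualCoannihilator ≤ ⊥ ⊔ I.bracketSpan U.dualCoannihilator := by
      intro hle
      rw [bot_sup_eq] at hle
      have h0 := dualCoannihilator_dualAnnihilator U
      rw [I.eq_bot_of_le_bracketSpan hle, Submodule.dualAnnihilator_bot] at h0
      exact hU h0.symm
    obtain ⟨α, -, hαU, hα⟩ := I.exists_covector hK
    have hmem := I.delbar_ι_mem hα
    rw [dualCoannihilator_dualAnnihilator] at hαU hmem
    exact ⟨α, hαU, mul_le_adjoin _ hmem⟩)
  have hd := h.d_ι_eq_zero hE (DGAlgebra.isTriangular_transportD E hE e he)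
  refine LinearMap.ext₂ fun x y => (Module.forall_dual_apply_eq_zero_iff ℂ _).1 fun α => ?_
  exact (I.delbar_ι_eq_zero_iff α).1 (hd α) x y

/-- The algebra of forms of type `(0,*)` is the exterior algebra of the covectors of
type `(0,1)`. -/
def zeroFormsEquiv : ExteriorAlgebra ℂ I.covectors01 ≃ₐ[ℂ] I.dolbeaultZero.carrier :=
  (AlgEquiv.ofInjective _ I.map_subtype_injective).trans
    (Subalgebra.equivOfEq _ I.zeroForms I.map_range_eq_zeroForms)

/-- The inclusion of the forms of type `(0,*)` into all forms. -/
def zeroFormsVal : I.dolbeaultZero.carrier →ₐ[ℂ] ComplexForms g := I.zeroForms.val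

theorem zeroFormsVal_injective : Function.Injective I.zeroFormsVal := Subtype.val_injective

theorem zeroFormsVal_equiv (x : ExteriorAlgebra ℂ I.covectors01) :
    I.zeroFormsVal (I.zeroFormsEquiv x) = ExteriorAlgebra.map I.covectors01.subtype x := rfl

theorem zeroFormsVal_d (x : I.dolbeaultZero.carrier) :
    I.zeroFormsVal (I.dolbeaultZero.d x) = I.delbar (I.zeroFormsVal x) := rfl

theorem map_transportD (x : ExteriorAlgebra ℂ I.covectors01) :
    ExteriorAlgebra.map I.covectors01.subtype (DGAlgebra.transportD I.zeroFormsEquiv x) =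
      I.delbar (ExteriorAlgebra.map I.covectors01.subtype x) := by
  rw [← zeroFormsVal_equiv, DGAlgebra.apply_transportD, zeroFormsVal_d, zeroFormsVal_equiv]

/-- The vanishing of the differential on covectors of type `(0,1)`, which formality implies, is dual
to the vanishing of the bracket of `𝔤^{0,1}`. -/
theorem lie_Q_eq_zero_of_isFormal [LieRing.IsNilpotent g] (h : I.dolbeaultZero.IsFormal)
    (x y : ℂ ⊗[ℝ] g) : ⁅I.Q x, I.Q y⁆ = 0 := by
  have hE : ∀ α, I.zeroFormsEquiv (ExteriorAlgebra.ι ℂ α) ∈ I.dolbeaultZero.gr 1 := by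
    intro α
    change I.zeroFormsVal (I.zeroFormsEquiv (ExteriorAlgebra.ι ℂ α)) ∈
      LinearMap.range (ExteriorAlgebra.ι ℂ (M := Module.Dual ℂ (ℂ ⊗[ℝ] g))) ^ 1
    rw [pow_one, zeroFormsVal_equiv, ExteriorAlgebra.map_apply_ι]
    exact ⟨_, rfl⟩
  obtain ⟨e, he⟩ := exists_triangular_basis (DGAlgebra.transportD I.zeroFormsEquiv) (by
    intro U hU
    set U' := U.map I.covectors01.subtype with hU'
    have hU'le : U' ≤ I.covectors01 := Submodule.map_subtype_le _ _
    have hK : ¬U'.dualCoannihilator ≤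
        I.g10.toSubmodule ⊔ I.bracketSpan U'.dualCoannihilator := by
      intro hle
      have h0 := Submodule.dualAnnihilator_anti (I.le_g10_of_le_bracketSpan hle)
      rw [dualCoannihilator_dualAnnihilator] at h0
      refine hU (eq_top_iff.2 fun α _ => ?_)
      obtain ⟨β, hβ, hβα⟩ := h0 α.2
      rwa [← Subtype.ext hβα]
    obtain ⟨α, hα01, hαU, hα⟩ := I.exists_covector hK
    have hmem := I.delbar_ι_mem hα
    rw [dualCoannihilator_dualAnnihilator] at hαU hmem
    refine ⟨⟨α, hα01⟩, fun hmemU => hαU ⟨_, hmemU, rfl⟩, mul_le_adjoin _ ?_⟩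
    have hmap : U'.map (ExteriorAlgebra.ι ℂ) = (U.map (ExteriorAlgebra.ι ℂ)).map
        (ExteriorAlgebra.map I.covectors01.subtype).toLinearMap := by
      rw [hU', ← Submodule.map_comp, ← Submodule.map_comp, ExteriorAlgebra.map_comp_ι]
    rw [hmap, ← Submodule.map_mul] at hmem
    obtain ⟨z, hz, hzα⟩ := hmem
    have hzd : z = DGAlgebra.transportD I.zeroFormsEquiv (ExteriorAlgebra.ι ℂ ⟨α, hα01⟩) := by
      apply I.map_subtype_injective
      rw [map_transportD, ExteriorAlgebra.map_apply_ι]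
      exact hzα
    rwa [← hzd])
  have hd := h.d_ι_eq_zero hE (DGAlgebra.isTriangular_transportD I.zeroFormsEquiv hE e he)
  refine (Module.forall_dual_apply_eq_zero_iff ℂ _).1 fun α => ?_
  have hα : I.delbar (ExteriorAlgebra.ι ℂ (α ∘ₗ I.Q)) = 0 := by
    have h0 := congrArg I.zeroFormsVal (hd ⟨α ∘ₗ I.Q, I.comp_Q_mem α⟩)
    rw [zeroFormsVal_d, zeroFormsVal_equiv, ExteriorAlgebra.map_apply_ι, map_zero] at h0
    exact h0
  have h1 := (I.delbar_ι_eq_zero_iff _).1 hα x y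
  rwa [LinearMap.comp_apply, Q_bracket01] at h1

theorem dolbeault_isFormal_iff [LieRing.IsNilpotent g] :
    I.dolbeault.IsFormal ↔ IsLieAbelian g := by
  rw [← I.bracket01_eq_zero_iff]
  refine ⟨I.bracket01_eq_zero_of_isFormal, fun h => DGAlgebra.isFormal_of_d_eq_zero _ ?_⟩
  refine LinearMap.ext fun x => I.delbar_eq_zero_of_mem_adjoin (U := ⊤) (fun α _ => ?_) ?_
  · rw [delbar_ι_eq_zero_iff, h]
    simp
  · rw [Submodule.map_top]
    induction x using ExteriorAlgebra.induction with
    | algebraMap r => exact Subalgebra.algebraMap_mem _ r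
    | ι v => exact Algebra.subset_adjoin ⟨v, rfl⟩
    | mul x y hx hy => exact mul_mem hx hy
    | add x y hx hy => exact add_mem hx hy

theorem dolbeaultZero_isFormal_iff [LieRing.IsNilpotent g] :
    I.dolbeaultZero.IsFormal ↔ IsLieAbelian I.g01 := by
  constructor
  · refine fun h => ⟨fun x y => Subtype.ext ?_⟩
    have h0 := I.lie_Q_eq_zero_of_isFormal h x y
    rwa [I.Q_of_mem x.2, I.Q_of_mem y.2] at h0
  · refine fun h => DGAlgebra.isFormal_of_d_eq_zero _ ?_
    refine LinearMap.ext fun x => I.zeroFormsVal_injective ?_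
    rw [zeroFormsVal_d]
    refine (I.delbar_eq_zero_of_mem_adjoin (U := I.covectors01) (fun α hα => ?_) x.2).trans
      (map_zero I.zeroFormsVal).symm
    rw [delbar_ι_eq_zero_iff]
    intro x y
    have h0 : ⁅I.Q x, I.Q y⁆ = 0 :=
      congrArg Subtype.val (h.trivial ⟨I.Q x, I.Q_mem x⟩ ⟨I.Q y, I.Q_mem y⟩)
    rw [bracket01_apply, h0, zero_add, ← map_add]
    exact (Submodule.mem_dualAnnihilator α).1 hα _ (I.P_mem _)

end LieComplexStructure

end

theorem corollary4p10 {g : Type*} [LieRing g] [LieAlgebra ℝ g] [FiniteDimensional ℝ g]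
    [LieRing.IsNilpotent g] (I : LieComplexStructure g) :
    (I.dolbeault.IsFormal ↔ IsLieAbelian g) ∧
      (I.dolbeaultZero.IsFormal ↔ IsLieAbelian I.g01) :=
  ⟨I.dolbeault_isFormal_iff, I.dolbeaultZero_isFormal_iff⟩
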